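/- Let $K$ be a number field with an embedding $K\subseteq\mathbb{C}$, let $N\ge 0$ and $d\ge 2$ be integers, and write $\mathbf{X}=(X_0,\dots,X_N)$. Let $F=(F_0,\dots,F_N)$ be homogeneous forms of degree $d$ in $\mathbf{X}$ with coefficients in $K(s)$, having no common zero other than the origin over an algebraic closure of $K(s)$ (that is, $F$ is a lift of an endomorphism of $\mathbb{P}^N$ of degree $d$ over $K(s)$), and let $\Phi\neq 0$ be a homogeneous form in $\mathbf{X}$ with coefficients in $K(s)$. For a polynomial $\Psi$ in $\mathbf X$ over a field of characteristic $0$ and a tuple $F$ of forms as above over that field, let the pushforward $$F_*\Psi(\mathbf{X})=\prod_{F(\mathbf{Y})=\mathbf{X}}\Psi(\mathbf{Y})$$ be the polynomial in $\mathbf{X}$ given by the product over all solutions $\mathbf{Y}$ of $F(\mathbf{Y})=\mathbf{X}$ with coordinates in an algebraic closure of the field of rational functions in $\mathbf{X}$, and let $F_*^k$ be the $k$-th iterate of $F_*$. For $t\in\mathbb{C}$ let $F_t,\Phi_t$ denote the specializations of the coefficients at $s=t$. For a polynomial $\Psi$ in $\mathbf{X}$ over $\mathbb{C}$ let $\|\Psi\|$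 be the largest absolute value of its coefficients. For a nonzero polynomial $\Psi$ in $\mathbf X$ over $K(s)$ let $\deg_s(\Psi)$ be the maximum of $\deg_s(c)$ over the nonzero coefficients $c$ of $\Psi$, where $\deg_s(p/q)=\deg p-\deg q$ for nonzero $p,q\in K[s]$. Put $\log^+x=\max\{\log x,0\}$. Then there are real constants $C$ and $R$, depending on $K\subseteq\mathbb{C}$, $N$, $F$ and $\Phi$ but not on $k$ or $t$, such that for all integers $k\ge 0$ and all $t\in\mathbb{C}$ with $|t|>R$, the forms $F_*^k\Phi$ and $(F_t)_*^k\Phi_t$ are nonzero and $$\Big|\log\|(F_t)_*^k\Phi_t\|-\deg_s(F_*^k\Phi)\log^+|t|\Big|\le C\,d^{3k(N+1)}.$$ -/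

import Mathlib

noncomputable section

namespace FormPushforward

open MvPolynomial

/-- The field in which the fibre `F(Y) = X` over the generic point is solved: an algebraic closure
of the field `k(X_0, …, X_N)`. -/
abbrev GenericClosure (k : Type*) [Field k] (N : ℕ) : Type _ :=
  AlgebraicClosure (FractionRing (MvPolynomial (Fin (N + 1)) k))

/-- `F` has no common zero other than the origin over an algebraic closure of `k`; a tuple of forms
of the same degree with this property is exactly a lift of an endomorphism of `ℙ^N` over `k`. -/
def Nondegenerate {k : Type*} [Field k] {N : ℕ}
    (F : Fin (N + 1) → MvPolynomial (Fin (N + 1)) k) : Prop :=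
  ∀ y : Fin (N + 1) → AlgebraicClosure k, (∀ i, aeval y (F i) = 0) → y = 0

/-- The product `∏_{F(Y) = X} Φ(Y)` over all solutions `Y` with coordinates in an algebraic closure
of `k(X_0, …, X_N)`. In characteristic zero, if `F` is nondegenerate of degree `d`, there are
exactly `d ^ (N + 1)` solutions, all of them simple. -/
def fiberProduct {k : Type*} [Field k] {N : ℕ}
    (F : Fin (N + 1) → MvPolynomial (Fin (N + 1)) k) (Φ : MvPolynomial (Fin (N + 1)) k) :
    GenericClosure k N :=
  ∏ᶠ Y ∈ {Y : Fin (N + 1) → GenericClosure k N |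
      ∀ i, aeval Y (F i) = algebraMap (MvPolynomial (Fin (N + 1)) k) (GenericClosure k N) (X i)},
    aeval Y Φ

open Classical in
/-- The pushforward `F_* Φ`: the (unique) polynomial in `X` equal to `∏_{F(Y) = X} Φ(Y)`. The value
`0` is used if there is no such polynomial. -/
def pushforward {k : Type*} [Field k] {N : ℕ}
    (F : Fin (N + 1) → MvPolynomial (Fin (N + 1)) k) (Φ : MvPolynomial (Fin (N + 1)) k) :
    MvPolynomial (Fin (N + 1)) k :=
  if h : ∃ Ψ : MvPolynomial (Fin (N + 1)) k,
      algebraMap (MvPolynomial (Fin (N + 1)) k) (GenericClosure k N) Ψ = fiberProduct F Φ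
  then h.choose else 0

/-- The specialization `Φ_t` at `s = t` of a polynomial with coefficients in `K(s)`, where
`σ : K → ℂ` is the embedding of the constants. (At a pole of a coefficient, the value is junk.) -/
def specialize {K : Type*} [Field K] (σ : K →+* ℂ) (t : ℂ) {N : ℕ}
    (Φ : MvPolynomial (Fin (N + 1)) (RatFunc K)) : MvPolynomial (Fin (N + 1)) ℂ :=
  ∑ m ∈ Φ.support, monomial m ((coeff m Φ).num.eval₂ σ t / (coeff m Φ).denom.eval₂ σ t)

/-- `‖Ψ‖`, the largest absolute value of a coefficient of `Ψ`. -/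
def coeffNorm {N : ℕ} (Ψ : MvPolynomial (Fin (N + 1)) ℂ) : ℝ :=
  ((Ψ.support.sup fun m => ‖coeff m Ψ‖₊ : NNReal) : ℝ)

/-- `deg_s(Φ)`, the largest degree in `s` of a nonzero coefficient of `Φ`, where the degree of a
rational function is the degree of its numerator minus that of its denominator. The value is `0`
for `Φ = 0`. -/
def degS {K : Type*} [Field K] {N : ℕ} (Φ : MvPolynomial (Fin (N + 1)) (RatFunc K)) : ℤ :=
  if h : Φ.support.Nonempty then Φ.support.sup' h fun m => (coeff m Φ).intDegree else 0

end FormPushforward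

end

/-! The value of `F_*^k Φ` at a point is a product of values of `Φ` over its `k`-fold backward
orbit. Control of the backward orbits of `F_t` therefore gives crude bounds on `(F_t)_*^k Φ_t`, and
arithmetic in `K` sharpens them to an asymptotic formula with an explicit range of validity.

Algebra. By the Nullstellensatz the polynomial ring over `K(s)` is finite over the subring generated
by `F`. So the generic fibre is finite with integral coordinates, Galois descent places products
over it in the polynomial ring, and a count of monomials bounds its cardinality by `d^(N+1)`.
Finitely many conditions depending on `F` alone, all true for large `|t|`, make pushforward commute
with specialization for every regular `Ψ` at once (`eventually_pushforward`), so iteration does not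
enlarge the threshold on `|t|`.

Analysis. Put `H = B(k+1)d^(k(N+1))`. An inequality `‖y‖^d ≤ |t|^A ‖F_t(y)‖` with `d ≥ 2` keeps
backward orbits of the unit ball in the ball of radius `|t|^A`, for every `k`, whence the upper
bound `|t|^H`. On that ball `F_t` is Lipschitz, so the `k`-fold image of the set where `Φ_t` is very
small has less volume than the unit ball. A point missed by this image has only `k`-fold preimages
at which `Φ_t` is not small (`exists_forall_iterate_eq_le_norm`). Hence `|log ‖(F_t)_*^k Φ_t‖| ≤ H
log|t|`.

Arithmetic. A power `D^a` with `a ≤ H` of a fixed `D` in `𝓞 K[s]` clears the denominators of `F_*^k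
Φ`. The resulting polynomials are at most `|t|^H` for `|t| ≥ R` at every embedding, so by Cauchy
their degrees are at most `H` and their coefficients at most `R^H`. A leading coefficient is a
nonzero algebraic integer with all conjugates at most `R^H`, hence is at least `R^(-O(H))`. So for
`|t| ≥ R^(O(H))` each polynomial is its leading term up to a factor `R^(O(H))`
(`norm_eval₂_bounds_of_large`), and the error in the logarithm is `O(H)`. For smaller `|t|` one has
`log|t| = O(H)` and the crude bounds give `O(H^2)`. Since `(k+1)^2` is `O(2^k)`, `H^2` is
`O(d^(3k(N+1)))`. -/

namespace FormPushforward

open MvPolynomial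

/-! ### Finiteness of the polynomial ring over the subring generated by `F` -/

section Nullstellensatz

variable {k : Type*} [Field k] {N d : ℕ} {F : Fin (N + 1) → MvPolynomial (Fin (N + 1)) k}

attribute [local instance] MvPolynomial.gradedAlgebra in
theorem homogeneousComponent_mul_of_isHomogeneous {σ R : Type*} [CommRing R] {n i : ℕ}
    (a : MvPolynomial σ R) {b : MvPolynomial σ R} (hb : b.IsHomogeneous i) (h : i ≤ n) :
    homogeneousComponent n (a * b) = homogeneousComponent (n - i) a * b := by
  have := DirectSum.coe_decompose_mul_of_right_mem_of_le (𝒜 := homogeneousSubmodule σ R)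
    (a := a) (b := b) (i := i) (n := n) ((mem_homogeneousSubmodule _ _).2 hb) h
  have e : ∀ (p : MvPolynomial σ R) (j : ℕ),
      (DirectSum.decompose (homogeneousSubmodule σ R) p j : MvPolynomial σ R) =
        homogeneousComponent j p := fun p j => decomposition.decompose'_apply p j
  rwa [e, e] at this

/-- Nondegeneracy puts every variable in the radical of the ideal of the `F j`. Both `X i ^ M` and
`F j` are homogeneous, so passing to components of degree `M` makes the coefficients homogeneous of
degree `M - d`. -/
theorem exists_X_pow_eq_sum (hF : ∀ i, (F i).IsHomogeneous d) (hF' : Nondegenerate F) :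
    ∃ (M : ℕ) (g : Fin (N + 1) → Fin (N + 1) → MvPolynomial (Fin (N + 1)) k),
      d ≤ M ∧ 0 < M ∧ (∀ i j, (g i j).IsHomogeneous (M - d)) ∧
      ∀ i, X i ^ M = ∑ j, g i j * F j := by
  have key : ∀ i, X i ∈ (Ideal.span (Set.range F)).radical := by
    intro i
    rw [← vanishingIdeal_zeroLocus_eq_radical (K := AlgebraicClosure k), mem_vanishingIdeal_iff]
    intro y hy
    have : y = 0 := hF' y fun i => hy _ (Ideal.subset_span ⟨i, rfl⟩)
    simp [this]
  choose m hm using key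
  -- One exponent for all variables, positive and at least `d`, so that `M - d` is not truncated.
  set M := d + 1 + ∑ i, m i with hM
  have h2 : ∀ i, ∃ c : Fin (N + 1) → MvPolynomial (Fin (N + 1)) k,
      ∑ j, c j * F j = X i ^ M := by
    intro i
    rw [← Ideal.mem_span_range_iff_exists_fun]
    have hle : m i ≤ M := by
      have := Finset.single_le_sum (f := m) (fun i _ => Nat.zero_le _) (Finset.mem_univ i)
      omega
    exact Ideal.pow_mem_of_pow_mem _ (hm i) hle
  choose c hc using h2
  refine ⟨M, fun i j => homogeneousComponent (M - d) (c i j), by omega, by omega,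
    fun i j => homogeneousComponent_isHomogeneous _ _, fun i => ?_⟩
  have h3 : homogeneousComponent M (X i ^ M : MvPolynomial (Fin (N + 1)) k) = X i ^ M := by
    have hh : (X i ^ M : MvPolynomial (Fin (N + 1)) k).IsHomogeneous M := by
      simpa using (isHomogeneous_X k i).pow M
    rw [homogeneousComponent_of_mem ((mem_homogeneousSubmodule _ _).2 hh), if_pos rfl]
  rw [← h3, ← hc i, map_sum]
  exact Finset.sum_congr rfl fun j _ =>
    homogeneousComponent_mul_of_isHomogeneous _ (hF j) (by omega)

/-- The monomials with all exponents below `M` generate the polynomial ring as a module: a factor `X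
i ^ M` is replaced by `∑ g i j * F j`, which leaves a coefficient of degree smaller by `d`. -/
theorem isIntegral_range_aeval (hd : 0 < d) (hF : ∀ i, (F i).IsHomogeneous d)
    (hF' : Nondegenerate F) :
    Algebra.IsIntegral (aeval F : MvPolynomial (Fin (N + 1)) k →ₐ[k] _).range
      (MvPolynomial (Fin (N + 1)) k) := by
  obtain ⟨M, g, hdM, hM, hg, hX⟩ := exists_X_pow_eq_sum hF hF'
  set S := (aeval F : MvPolynomial (Fin (N + 1)) k →ₐ[k] _).range
  let T : Set (MvPolynomial (Fin (N + 1)) k) :=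
    Set.range fun a : Fin (N + 1) → Fin M =>
      (monomial (Finsupp.equivFunOnFinite.symm fun i => (a i : ℕ)) (1 : k))
  have hFS : ∀ j, F j ∈ S := fun j => ⟨X j, by simp⟩
  have hC : ∀ (c : k) (b : MvPolynomial (Fin (N + 1)) k),
      b ∈ Submodule.span S T →
      C c * b ∈ Submodule.span S T := by
    intro c b hb
    exact Submodule.smul_mem _ (algebraMap k S c) hb
  have main : ∀ n : ℕ, ∀ p : MvPolynomial (Fin (N + 1)) k, p.totalDegree ≤ n →
      p ∈ Submodule.span S T := by
    intro n
    induction n using Nat.strong_induction_on with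
    | _ n ih =>
      have hmon : ∀ s : Fin (N + 1) →₀ ℕ, s.degree ≤ n →
          monomial s (1 : k) ∈ Submodule.span S T := by
        intro s hs
        by_cases h : ∀ i, s i < M
        · apply Submodule.subset_span
          exact ⟨fun i => ⟨s i, h i⟩, congrArg (fun s => monomial s (1 : k)) (Finsupp.ext fun j => rfl)⟩
        · push Not at h
          obtain ⟨i, hi⟩ := h
          have e1 : monomial s (1 : k) = monomial (s - Finsupp.single i M) 1 * X i ^ M := by
            rw [X_pow_eq_monomial, monomial_mul, one_mul]
            congr 2
            ext j
            by_cases hj : i = j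
            · subst hj; simp [hi]
            · simp [hj]
          rw [e1, hX, Finset.mul_sum]
          refine Submodule.sum_mem _ fun j _ => ?_
          have e2 : monomial (s - Finsupp.single i M) (1 : k) * (g i j * F j) =
              (⟨F j, hFS j⟩ : S) • (monomial (s - Finsupp.single i M) (1 : k) * g i j) := by
            rw [Subalgebra.smul_def, smul_eq_mul]; ring
          rw [e2]
          apply Submodule.smul_mem
          have e3 : (s - Finsupp.single i M).degree + M = s.degree := by
            have : s = (s - Finsupp.single i M) + Finsupp.single i M := by
              ext j
              by_cases hj : i = j
              · subst hj; simp [hi]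
              · simp [hj]
            conv_rhs => rw [this, map_add]
            simp
          have e4 : (monomial (s - Finsupp.single i M) (1 : k) * g i j).totalDegree ≤
              (s - Finsupp.single i M).degree + (M - d) := by
            refine (totalDegree_mul _ _).trans (add_le_add ?_ (hg i j).totalDegree_le)
            exact (totalDegree_monomial_le _ _)
          exact ih (n - d) (by omega) _ (by omega)
      intro p hp
      rw [p.as_sum]
      refine Submodule.sum_mem _ fun s hs => ?_
      have := hmon s ((le_totalDegree hs).trans hp)
      have := hC (coeff s p) _ this
      rwa [C_mul_monomial, mul_one] at this
  have : Module.Finite S (MvPolynomial (Fin (N + 1)) k) := by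
    have hT : T.Finite := Set.finite_range _
    refine ⟨⟨hT.toFinset, ?_⟩⟩
    rw [Set.Finite.coe_toFinset, eq_top_iff]
    exact fun p _ => main _ p le_rfl
  infer_instance

theorem isIntegral_aeval (hd : 0 < d) (hF : ∀ i, (F i).IsHomogeneous d) (hF' : Nondegenerate F) :
    (aeval F : MvPolynomial (Fin (N + 1)) k →ₐ[k] _).toRingHom.IsIntegral := by
  intro x
  obtain ⟨p, hp, hpx⟩ := (isIntegral_range_aeval hd hF hF').isIntegral x
  have hlift : p ∈ Polynomial.lifts (aeval F : MvPolynomial (Fin (N + 1)) k →ₐ[k]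
      _).rangeRestrict.toRingHom := by
    rw [Polynomial.lifts_iff_coeff_lifts]
    exact fun n => AlgHom.rangeRestrict_surjective (aeval F) _
  obtain ⟨q, hq, -, hqm⟩ := Polynomial.lifts_and_degree_eq_and_monic hlift hp
  refine ⟨q, hqm, ?_⟩
  rw [← hq, Polynomial.eval₂_map] at hpx
  exact hpx

/-- The `N + 1` forms generate a subring over which a ring of transcendence degree `N + 1` is
algebraic, so they form a transcendence basis. -/
theorem injective_aeval (hd : 0 < d) (hF : ∀ i, (F i).IsHomogeneous d) (hF' : Nondegenerate F) :
    Function.Injective (aeval F : MvPolynomial (Fin (N + 1)) k →ₐ[k] _) := by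
  have := isIntegral_range_aeval hd hF hF'
  rw [← Algebra.adjoin_range_eq_range_aeval k F] at this
  have : Algebra.IsAlgebraic (Algebra.adjoin k (Set.range F)) (MvPolynomial (Fin (N + 1)) k) :=
    inferInstance
  have : IsTranscendenceBasis k F :=
    Algebra.IsAlgebraic.isTranscendenceBasis_of_lift_le_trdeg_of_finite k F
      (by rw [MvPolynomial.trdeg_of_isDomain]; simp)
  exact this.1

end Nullstellensatz

end FormPushforward

namespace FormPushforward

open MvPolynomial

/-! ### Extending homomorphisms along integral extensions -/

section Lifting

variable {R B Ω : Type*} [CommRing R] [CommRing B] [Field Ω] [IsAlgClosed Ω]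

theorem exists_ringHom_comp_eq_of_injective [IsDomain R] [IsDomain B] (f : R →+* B)
    (hf : Function.Injective f) (hint : f.IsIntegral) (g : R →+* Ω) (hg : Function.Injective g) :
    ∃ h : B →+* Ω, h.comp f = g := by
  algebraize [f, g]
  have : FaithfulSMul R B := (faithfulSMul_iff_algebraMap_injective _ _).2 hf
  have : FaithfulSMul R Ω := (faithfulSMul_iff_algebraMap_injective _ _).2 hg
  have : Module.IsTorsionFree R B := inferInstance
  let l : B →ₐ[R] Ω := IsAlgClosed.lift
  exact ⟨l.toRingHom, RingHom.ext fun x => l.commutes x⟩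

/-- Lying over for the prime `ker g` reduces to an integral extension of domains with `g` injective,
where algebraic closedness applies. -/
theorem exists_ringHom_comp_eq_of_isIntegral (f : R →+* B) (hf : Function.Injective f)
    (hint : f.IsIntegral) (g : R →+* Ω) : ∃ h : B →+* Ω, h.comp f = g := by
  algebraize [f]
  have hP : (RingHom.ker g).IsPrime := RingHom.ker_isPrime g
  obtain ⟨Q, -, hQ, hQP⟩ := Ideal.exists_ideal_over_prime_of_isIntegral (S := B) (RingHom.ker g) ⊥
    (by rw [← RingHom.ker_eq_comap_bot]
        exact ((RingHom.injective_iff_ker_eq_bot _).1 hf).le.trans bot_le)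
  let f' : R ⧸ RingHom.ker g →+* B ⧸ Q := Ideal.quotientMap Q f hQP.ge
  have hf' : Function.Injective f' := Ideal.quotientMap_injective' hQP.le
  have hint' : f'.IsIntegral := by
    intro x
    obtain ⟨x, rfl⟩ := Ideal.Quotient.mk_surjective x
    obtain ⟨p, hp, hpx⟩ := hint x
    refine ⟨p.map (Ideal.Quotient.mk _), hp.map _, ?_⟩
    rw [Polynomial.eval₂_map]
    have : f'.comp (Ideal.Quotient.mk _) = (Ideal.Quotient.mk Q).comp f := by
      ext; simp [f']
    rw [this, ← Polynomial.hom_eval₂, hpx, map_zero]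
  let g' : R ⧸ RingHom.ker g →+* Ω := RingHom.kerLift g
  have hg' : Function.Injective g' := RingHom.kerLift_injective g
  obtain ⟨l, hl⟩ := exists_ringHom_comp_eq_of_injective f' hf' hint' g' hg'
  refine ⟨l.comp (Ideal.Quotient.mk Q), ?_⟩
  ext x
  exact RingHom.congr_fun hl (Ideal.Quotient.mk _ x)

omit [IsAlgClosed Ω] in
theorem injective_of_comp_injective_of_isIntegral [IsDomain B] (f : R →+* B)
    (hint : f.IsIntegral) (h : B →+* Ω) (hinj : Function.Injective (h.comp f)) :
    Function.Injective h := by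
  have hf : Function.Injective f := Function.Injective.of_comp hinj
  algebraize [f]
  have : IsDomain R := hf.isDomain f
  rw [RingHom.injective_iff_ker_eq_bot] at hinj ⊢
  apply Ideal.eq_bot_of_comap_eq_bot (R := R)
  rw [← hinj]
  rfl

end Lifting

section Integral

variable {R Ω : Type*} [CommRing R] [CommRing Ω] (f : R →+* Ω)

theorem isIntegralElem_prod {ι : Type*} (s : Finset ι) {g : ι → Ω}
    (h : ∀ i ∈ s, f.IsIntegralElem (g i)) : f.IsIntegralElem (∏ i ∈ s, g i) := by
  algebraize [f]
  exact IsIntegral.prod (R := R) g fun i hi => h i hi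

theorem isIntegralElem_sum {ι : Type*} (s : Finset ι) {g : ι → Ω}
    (h : ∀ i ∈ s, f.IsIntegralElem (g i)) : f.IsIntegralElem (∑ i ∈ s, g i) := by
  algebraize [f]
  exact IsIntegral.sum (R := R) g fun i hi => h i hi

theorem isIntegralElem_eval₂ {σ A : Type*} [CommRing A] (h : A →+* R) {y : σ → Ω}
    (hy : ∀ i, f.IsIntegralElem (y i)) (p : MvPolynomial σ A) :
    f.IsIntegralElem (eval₂ (f.comp h) y p) := by
  induction p using MvPolynomial.induction_on with
  | C a => rw [eval₂_C]; exact f.isIntegralElem_map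
  | add p q hp hq => rw [eval₂_add]; exact hp.add f hq
  | mul_X p i hp => rw [eval₂_mul, eval₂_X]; exact hp.mul f (hy i)

end Integral

/-! ### The generic fibre: finiteness and a generic point -/

section Solutions

variable {k : Type*} [Field k] {N d : ℕ} {F : Fin (N + 1) → MvPolynomial (Fin (N + 1)) k}

/-- The generic fibre `F(Y) = X`. -/
def solutions (F : Fin (N + 1) → MvPolynomial (Fin (N + 1)) k) :
    Set (Fin (N + 1) → GenericClosure k N) :=
  {Y | ∀ i, aeval Y (F i) = algebraMap (MvPolynomial (Fin (N + 1)) k) (GenericClosure k N) (X i)}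

theorem algebraMap_genericClosure_injective : Function.Injective
    (algebraMap (MvPolynomial (Fin (N + 1)) k) (GenericClosure k N)) := by
  have h1 := (algebraMap (FractionRing (MvPolynomial (Fin (N + 1)) k)) (GenericClosure k N)).injective
  have h2 := IsFractionRing.injective (MvPolynomial (Fin (N + 1)) k)
    (FractionRing (MvPolynomial (Fin (N + 1)) k))
  have h3 := h1.comp h2
  rwa [← RingHom.coe_comp, ← IsScalarTower.algebraMap_eq] at h3

theorem aeval_aeval_of_mem_solutions {Y} (hY : Y ∈ solutions F) (p : MvPolynomial (Fin (N + 1)) k) :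
    aeval Y (aeval F p) = algebraMap _ (GenericClosure k N) p := by
  have : (aeval Y).comp (aeval F) =
      IsScalarTower.toAlgHom k (MvPolynomial (Fin (N + 1)) k) (GenericClosure k N) := by
    ext i
    simpa using hY i
  exact DFunLike.congr_fun this p

/-- Evaluating at `Y` the monic equation of `X i` over the subring generated by `F` turns each `F j`
into `X j`. The same equation thus serves for all `Y`, which also yields finiteness of the fibre. -/
theorem isIntegral_of_mem_solutions (hd : 0 < d) (hF : ∀ i, (F i).IsHomogeneous d)
    (hF' : Nondegenerate F) (i : Fin (N + 1)) : ∃ p : Polynomial (MvPolynomial (Fin (N + 1)) k),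
      p.Monic ∧ ∀ Y ∈ solutions F, p.eval₂ (algebraMap _ (GenericClosure k N)) (Y i) = 0 := by
  obtain ⟨p, hp, hpX⟩ := isIntegral_aeval hd hF hF' (X i)
  refine ⟨p, hp, fun Y hY => ?_⟩
  have := congrArg (aeval Y) hpX
  rw [map_zero] at this
  have e := Polynomial.hom_eval₂ p (aeval F : MvPolynomial (Fin (N + 1)) k →ₐ[k] _).toRingHom
    (aeval Y : MvPolynomial (Fin (N + 1)) k →ₐ[k] _).toRingHom (X i)
  have e2 : (aeval Y : MvPolynomial (Fin (N + 1)) k →ₐ[k] _).toRingHom.comp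
      (aeval F : MvPolynomial (Fin (N + 1)) k →ₐ[k] _).toRingHom =
      algebraMap _ (GenericClosure k N) := RingHom.ext fun q => aeval_aeval_of_mem_solutions hY q
  rw [e2] at e
  have e3 : (aeval Y : MvPolynomial (Fin (N + 1)) k →ₐ[k] _).toRingHom (X i) = Y i := by simp
  rw [e3] at e
  rw [← e]
  exact this

theorem finite_solutions (hd : 0 < d) (hF : ∀ i, (F i).IsHomogeneous d)
    (hF' : Nondegenerate F) : (solutions F).Finite := by
  choose p hp hpY using isIntegral_of_mem_solutions hd hF hF'
  refine (Set.Finite.pi' (t := fun i => {y : GenericClosure k N |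
    (p i).eval₂ (algebraMap _ (GenericClosure k N)) y = 0}) fun i => ?_).subset
      fun Y hY i => hpY i Y hY
  have h0 : (p i).map (algebraMap _ (GenericClosure k N)) ≠ 0 := ((hp i).map _).ne_zero
  refine (Polynomial.finite_setOfPred_isRoot h0).subset fun y hy => ?_
  rw [Set.mem_ofPred_eq, Polynomial.IsRoot.def, Polynomial.eval_map]
  exact hy

/-- Extending the embedding of the polynomial ring along `aeval F` yields the solution. It satisfies
no polynomial relation over `k`, which is what later allows every point of a specialized fibre to be
reached from it. -/
theorem exists_injective_solution (hd : 0 < d) (hF : ∀ i, (F i).IsHomogeneous d)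
    (hF' : Nondegenerate F) : ∃ Y ∈ solutions F,
      Function.Injective (aeval Y : MvPolynomial (Fin (N + 1)) k →ₐ[k] GenericClosure k N) := by
  obtain ⟨h, hh⟩ := exists_ringHom_comp_eq_of_isIntegral
    (aeval F : MvPolynomial (Fin (N + 1)) k →ₐ[k] _).toRingHom (injective_aeval hd hF hF')
    (isIntegral_aeval hd hF hF') (algebraMap _ (GenericClosure k N))
  have hinj := injective_of_comp_injective_of_isIntegral _ (isIntegral_aeval hd hF hF') h
    (by rw [hh]; exact algebraMap_genericClosure_injective)
  have e : ∀ p, h p = aeval (fun i => h (X i)) p := by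
    intro p
    have : h = (aeval (fun i => h (X i)) : MvPolynomial (Fin (N + 1)) k →ₐ[k]
        GenericClosure k N).toRingHom := by
      apply MvPolynomial.ringHom_ext
      · intro r
        have := RingHom.congr_fun hh (C r)
        simp only [AlgHom.toRingHom_eq_coe, RingHom.coe_comp, RingHom.coe_coe,
          Function.comp_apply, aeval_C] at this
        rw [MvPolynomial.algebraMap_eq] at this
        rw [this]
        simp [IsScalarTower.algebraMap_apply k (MvPolynomial (Fin (N + 1)) k) (GenericClosure k N)]
      · intro i; simp
    conv_lhs => rw [this]
    rfl
  refine ⟨fun i => h (X i), fun i => ?_, ?_⟩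
  · rw [← e]
    have := RingHom.congr_fun hh (X i)
    simpa using this
  · intro p q hpq
    rw [← e, ← e] at hpq
    exact hinj hpq

end Solutions

/-! ### Galois descent for sums and products over the generic fibre -/

section Descent

variable {k : Type*} [Field k] {N d : ℕ} {F : Fin (N + 1) → MvPolynomial (Fin (N + 1)) k}

theorem map_mem_solutions (s : Gal(GenericClosure k N/FractionRing (MvPolynomial (Fin (N + 1)) k)))
    {Y} (hY : Y ∈ solutions F) : (fun i => s (Y i)) ∈ solutions F := by
  intro i
  have : aeval (fun i => s (Y i)) (F i) = (s.toAlgHom.restrictScalars k) (aeval Y (F i)) := by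
    rw [comp_aeval_apply]; rfl
  rw [this, hY i, IsScalarTower.algebraMap_apply _ (FractionRing (MvPolynomial (Fin (N + 1)) k))]
  simp

theorem galois_sum_prod_solutions (hS : (solutions F).Finite)
    (s : Gal(GenericClosure k N/FractionRing (MvPolynomial (Fin (N + 1)) k)))
    (Ψ : MvPolynomial (Fin (N + 1)) k) :
    s (∏ Y ∈ hS.toFinset, aeval Y Ψ) = ∏ Y ∈ hS.toFinset, aeval Y Ψ ∧
    s (∑ Y ∈ hS.toFinset, aeval Y Ψ) = ∑ Y ∈ hS.toFinset, aeval Y Ψ := by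
  have hs : ∀ Y, s (aeval Y Ψ) = aeval (fun i => s (Y i)) Ψ := by
    intro Y
    have : aeval (fun i => s (Y i)) Ψ = (s.toAlgHom.restrictScalars k) (aeval Y Ψ) := by
      rw [comp_aeval_apply]; rfl
    rw [this]; rfl
  have e : ∀ Y : Fin (N + 1) → GenericClosure k N, (fun i => s (s.symm (Y i))) = Y := by
    intro Y; ext i; simp
  have e' : ∀ Y : Fin (N + 1) → GenericClosure k N, (fun i => s.symm (s (Y i))) = Y := by
    intro Y; ext i; simp
  rw [map_prod, map_sum]
  constructor
  · refine Finset.prod_bij' (fun Y _ i => s (Y i)) (fun Y _ i => s.symm (Y i)) ?_ ?_ ?_ ?_ ?_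
    · exact fun Y hY => by simpa using map_mem_solutions s (by simpa using hY)
    · exact fun Y hY => by simpa using map_mem_solutions s.symm (by simpa using hY)
    · exact fun Y _ => e' Y
    · exact fun Y _ => e Y
    · exact fun Y _ => hs Y
  · refine Finset.sum_bij' (fun Y _ i => s (Y i)) (fun Y _ i => s.symm (Y i)) ?_ ?_ ?_ ?_ ?_
    · exact fun Y hY => by simpa using map_mem_solutions s (by simpa using hY)
    · exact fun Y hY => by simpa using map_mem_solutions s.symm (by simpa using hY)
    · exact fun Y _ => e' Y
    · exact fun Y _ => e Y
    · exact fun Y _ => hs Y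

variable {A : Type*} [CommRing A] (j : A →+* k)

/-- The canonical map from the polynomial ring with coefficients in `A` to the generic closure. -/
noncomputable def toGenericClosure (N : ℕ) (j : A →+* k) :
    MvPolynomial (Fin (N + 1)) A →+* GenericClosure k N :=
  (algebraMap (MvPolynomial (Fin (N + 1)) k) (GenericClosure k N)).comp (map j)

theorem toGenericClosure_id :
    toGenericClosure N (RingHom.id k) = algebraMap _ (GenericClosure k N) := by
  refine RingHom.ext fun p => ?_
  rw [toGenericClosure, RingHom.comp_apply, MvPolynomial.map_id]

theorem toGenericClosure_injective (hj : Function.Injective j) :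
    Function.Injective (toGenericClosure N j) :=
  algebraMap_genericClosure_injective.comp (map_injective j hj)

-- In characteristic zero a Galois-fixed element lies in the fraction field. Being integral it is
-- then a polynomial over `k`, and its coefficients are integral over `A`, hence in `A` by `hj`.
attribute [local instance] MvPolynomial.algebraMvPolynomial in
theorem exists_map_eq_of_galois [CharZero k]
    (hj : ∀ c : k, j.IsIntegralElem c → c ∈ j.range) {z : GenericClosure k N}
    (hz : (toGenericClosure N j).IsIntegralElem z)
    (hfix : ∀ s : Gal(GenericClosure k N/FractionRing (MvPolynomial (Fin (N + 1)) k)), s z = z) :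
    ∃ Q : MvPolynomial (Fin (N + 1)) A, toGenericClosure N j Q = z := by
  have : CharZero (FractionRing (MvPolynomial (Fin (N + 1)) k)) :=
    charZero_of_injective_algebraMap (R := MvPolynomial (Fin (N + 1)) k)
      (IsFractionRing.injective _ _)
  obtain ⟨w, rfl⟩ := (InfiniteGalois.mem_range_algebraMap_iff_fixed
    (k := FractionRing (MvPolynomial (Fin (N + 1)) k)) z).2 hfix
  obtain ⟨p, hp, hpz⟩ := hz
  have hw : p.eval₂ ((algebraMap (MvPolynomial (Fin (N + 1)) k)
      (FractionRing (MvPolynomial (Fin (N + 1)) k))).comp (map j)) w = 0 := by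
    apply (algebraMap (FractionRing (MvPolynomial (Fin (N + 1)) k)) (GenericClosure k N)).injective
    rw [Polynomial.hom_eval₂, map_zero, ← hpz, ← RingHom.comp_assoc,
      ← IsScalarTower.algebraMap_eq]
    rfl
  have hwi : IsIntegral (MvPolynomial (Fin (N + 1)) k) w :=
    ⟨p.map (map j), hp.map _, by rw [Polynomial.eval₂_map]; exact hw⟩
  obtain ⟨P, rfl⟩ := IsIntegrallyClosed.isIntegral_iff.1 hwi
  algebraize [j]
  have hP : IsIntegral (MvPolynomial (Fin (N + 1)) A) P := by
    refine ⟨p, hp, ?_⟩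
    apply IsFractionRing.injective (MvPolynomial (Fin (N + 1)) k)
      (FractionRing (MvPolynomial (Fin (N + 1)) k))
    rw [Polynomial.hom_eval₂, map_zero, ← hw]
    rfl
  rw [MvPolynomial.isIntegral_iff_isIntegral_coeff] at hP
  have hr : P ∈ (map j : MvPolynomial (Fin (N + 1)) A →+* _).range := by
    rw [← SetLike.mem_coe, RingHom.coe_range, MvPolynomial.mem_range_map_iff_coeffs_subset]
    intro c hc
    rw [Finset.mem_coe, mem_coeffs_iff] at hc
    obtain ⟨n, -, rfl⟩ := hc
    obtain ⟨a, ha⟩ := hj _ (hP n)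
    exact ⟨a, ha⟩
  obtain ⟨Q, rfl⟩ := hr
  exact ⟨Q, by rw [toGenericClosure, RingHom.comp_apply, ← IsScalarTower.algebraMap_apply]⟩

theorem aeval_map_eq_eval₂ (Y : Fin (N + 1) → GenericClosure k N)
    (p : MvPolynomial (Fin (N + 1)) A) :
    aeval Y (map j p) = eval₂ ((toGenericClosure N j).comp C) Y p := by
  rw [aeval_def, eval₂_map]
  congr 1
  ext a
  simp [toGenericClosure, IsScalarTower.algebraMap_apply k (MvPolynomial (Fin (N + 1)) k)
    (GenericClosure k N)]

theorem isIntegralElem_aeval_map {Y : Fin (N + 1) → GenericClosure k N}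
    (hY : ∀ i, (toGenericClosure N j).IsIntegralElem (Y i)) (p : MvPolynomial (Fin (N + 1)) A) :
    (toGenericClosure N j).IsIntegralElem (aeval Y (map j p)) := by
  rw [aeval_map_eq_eval₂]
  exact isIntegralElem_eval₂ _ _ hY p

variable [CharZero k]

theorem exists_map_eq_sum_solutions (hS : (solutions F).Finite)
    (hj : ∀ c : k, j.IsIntegralElem c → c ∈ j.range) {Ψ : MvPolynomial (Fin (N + 1)) k}
    (hΨ : ∀ Y ∈ solutions F, (toGenericClosure N j).IsIntegralElem (aeval Y Ψ)) :
    ∃ Q : MvPolynomial (Fin (N + 1)) A,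
      toGenericClosure N j Q = ∑ Y ∈ hS.toFinset, aeval Y Ψ :=
  exists_map_eq_of_galois j hj
    (isIntegralElem_sum _ _ fun Y hY => hΨ Y (by simpa using hY))
    fun s => (galois_sum_prod_solutions hS s Ψ).2

theorem exists_map_eq_prod_solutions (hS : (solutions F).Finite)
    (hj : ∀ c : k, j.IsIntegralElem c → c ∈ j.range) {Ψ : MvPolynomial (Fin (N + 1)) k}
    (hΨ : ∀ Y ∈ solutions F, (toGenericClosure N j).IsIntegralElem (aeval Y Ψ)) :
    ∃ Q : MvPolynomial (Fin (N + 1)) A,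
      toGenericClosure N j Q = ∏ Y ∈ hS.toFinset, aeval Y Ψ :=
  exists_map_eq_of_galois j hj
    (isIntegralElem_prod _ _ fun Y hY => hΨ Y (by simpa using hY))
    fun s => (galois_sum_prod_solutions hS s Ψ).1

omit [CharZero k] in
theorem fiberProduct_eq_prod (hS : (solutions F).Finite) (Ψ : MvPolynomial (Fin (N + 1)) k) :
    fiberProduct F Ψ = ∏ Y ∈ hS.toFinset, aeval Y Ψ :=
  finprod_mem_eq_finite_toFinset_prod _ hS

omit [CharZero k] in
theorem pushforward_eq_of_algebraMap_eq {Ψ Q : MvPolynomial (Fin (N + 1)) k}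
    (h : algebraMap _ (GenericClosure k N) Q = fiberProduct F Ψ) : pushforward F Ψ = Q := by
  have h' : ∃ Ψ' : MvPolynomial (Fin (N + 1)) k,
      algebraMap (MvPolynomial (Fin (N + 1)) k) (GenericClosure k N) Ψ' = fiberProduct F Ψ := ⟨Q, h⟩
  rw [pushforward, dif_pos h']
  exact algebraMap_genericClosure_injective (h'.choose_spec.trans h.symm)

theorem exists_map_eq_pushforward (hS : (solutions F).Finite)
    (hj : ∀ c : k, j.IsIntegralElem c → c ∈ j.range) {Ψ : MvPolynomial (Fin (N + 1)) k}
    (hΨ : ∀ Y ∈ solutions F, (toGenericClosure N j).IsIntegralElem (aeval Y Ψ)) :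
    ∃ Q : MvPolynomial (Fin (N + 1)) A, map j Q = pushforward F Ψ := by
  obtain ⟨Q, hQ⟩ := exists_map_eq_prod_solutions j hS hj hΨ
  exact ⟨Q, (pushforward_eq_of_algebraMap_eq (by rw [fiberProduct_eq_prod hS, ← hQ]; rfl)).symm⟩

omit [CharZero k] in
theorem isIntegralElem_of_mem_solutions (hd : 0 < d) (hF : ∀ i, (F i).IsHomogeneous d)
    (hF' : Nondegenerate F) {Y} (hY : Y ∈ solutions F) (i : Fin (N + 1)) :
    (toGenericClosure N (RingHom.id k)).IsIntegralElem (Y i) := by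
  obtain ⟨p, hp, h⟩ := isIntegral_of_mem_solutions hd hF hF' i
  refine ⟨p, hp, ?_⟩
  rw [toGenericClosure_id]
  exact h Y hY

theorem algebraMap_pushforward (hd : 0 < d) (hF : ∀ i, (F i).IsHomogeneous d)
    (hF' : Nondegenerate F) (hS : (solutions F).Finite) (Ψ : MvPolynomial (Fin (N + 1)) k) :
    algebraMap _ (GenericClosure k N) (pushforward F Ψ) = ∏ Y ∈ hS.toFinset, aeval Y Ψ := by
  obtain ⟨Q, hQ⟩ := exists_map_eq_prod_solutions (RingHom.id k) hS (fun c _ => ⟨c, rfl⟩) (Ψ := Ψ)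
    fun Y hY => by
      have := isIntegralElem_aeval_map (RingHom.id k)
        (isIntegralElem_of_mem_solutions hd hF hF' hY) Ψ
      rwa [MvPolynomial.map_id] at this
  rw [← hQ, pushforward_eq_of_algebraMap_eq (Q := Q)]
  · rw [toGenericClosure_id]
  · rw [fiberProduct_eq_prod hS, ← hQ, toGenericClosure_id]

end Descent

end FormPushforward

namespace FormPushforward

open MvPolynomial

/-! ### Counting monomials -/

section Count

variable {n : ℕ}

/-- The number of monomials of degree at most `A` in `n` variables. -/
noncomputable def monomialCount (n A : ℕ) : ℕ := Nat.card {s : Fin n →₀ ℕ | s.degree ≤ A}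

theorem finite_setOf_degree_le (n A : ℕ) : Finite {s : Fin n →₀ ℕ | s.degree ≤ A} :=
  Finite.of_injective (β := Fin n → Fin (A + 1))
    (fun s i => ⟨s.1 i, Nat.lt_succ_of_le ((Finsupp.le_degree i s.1).trans s.2)⟩) fun s t h => by
      ext i
      simpa using congrArg Fin.val (congrFun h i)

theorem monomialCount_le_pow (n A : ℕ) : monomialCount n A ≤ (A + 1) ^ n := by
  have := Nat.card_le_card_of_injective (α := {s : Fin n →₀ ℕ | s.degree ≤ A})
    (β := Fin n → Fin (A + 1))
    (fun s i => ⟨s.1 i, Nat.lt_succ_of_le ((Finsupp.le_degree i s.1).trans s.2)⟩) fun s t h => by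
      ext i
      simpa using congrArg Fin.val (congrFun h i)
  simpa [monomialCount] using this

theorem monomialCount_pos (n A : ℕ) : 0 < monomialCount n A := by
  have := finite_setOf_degree_le n A
  have : Nonempty {s : Fin n →₀ ℕ | s.degree ≤ A} := ⟨⟨0, by simp⟩⟩
  exact Nat.card_pos

/-- Divide each exponent by `d` with remainder: there are `d ^ n` remainders, and the quotients have
degree at most `A + β`. -/
theorem monomialCount_mul_add_le {d : ℕ} (hd : 0 < d) (A β : ℕ) :
    monomialCount n (d * A + β) ≤ d ^ n * monomialCount n (A + β) := by
  have := finite_setOf_degree_le n (A + β)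
  have hdeg : ∀ s : Fin n →₀ ℕ, s.degree ≤ d * A + β →
      (Finsupp.equivFunOnFinite.symm fun i => s i / d).degree ≤ A + β := by
    intro s hs
    rw [Finsupp.degree_eq_sum] at hs ⊢
    have h1 : ∑ i, s i / d ≤ (∑ i, s i) / d := by
      rw [Nat.le_div_iff_mul_le hd, Finset.sum_mul]
      exact Finset.sum_le_sum fun i _ => Nat.div_mul_le_self _ _
    calc ∑ i, s i / d ≤ (∑ i, s i) / d := h1
      _ ≤ (d * A + β) / d := Nat.div_le_div_right hs
      _ = A + β / d := by rw [Nat.mul_add_div hd]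
      _ ≤ A + β := by gcongr; exact Nat.div_le_self _ _
  have := Nat.card_le_card_of_injective (α := {s : Fin n →₀ ℕ | s.degree ≤ d * A + β})
    (β := (Fin n → Fin d) × {s : Fin n →₀ ℕ | s.degree ≤ A + β})
    (fun s => (fun i => ⟨s.1 i % d, Nat.mod_lt _ hd⟩,
      ⟨Finsupp.equivFunOnFinite.symm fun i => s.1 i / d, hdeg _ s.2⟩)) fun s t h => by
      ext i
      rw [Prod.mk.injEq] at h
      have h1 := congrArg Fin.val (congrFun h.1 i)
      have h2 := DFunLike.congr_fun (congrArg Subtype.val h.2) i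
      simp only [Finsupp.equivFunOnFinite_symm_apply_apply] at h1 h2
      rw [← Nat.div_add_mod (s.1 i) d, ← Nat.div_add_mod (t.1 i) d, h1, h2]
  simpa [monomialCount, Nat.card_prod] using this

/-- If `m > d ^ n`, the hypothesis would force exponential growth of the number of monomials, which
grows only polynomially. -/
theorem le_pow_of_mul_monomialCount_le {d m β : ℕ} (hd : 0 < d)
    (h : ∀ A, m * monomialCount n A ≤ monomialCount n (d * A + β)) : m ≤ d ^ n := by
  by_contra! hm
  have hD : (0 : ℝ) < (d : ℝ) ^ n := by positivity
  set r : ℝ := (m : ℝ) / (d : ℝ) ^ n with hr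
  have hr1 : 1 < r := by
    rw [hr, one_lt_div hD]
    exact_mod_cast hm
  -- The hypothesis at `A = j * β`, combined with division of exponents, gains a factor `r` whenever
  -- `A` increases by `β`.
  have hstep : ∀ j : ℕ, r ^ j ≤ monomialCount n (j * β) := by
    intro j
    induction j with
    | zero =>
      rw [pow_zero]
      exact_mod_cast monomialCount_pos n (0 * β)
    | succ j ih =>
      have h1 := (h (j * β)).trans (monomialCount_mul_add_le hd (j * β) β)
      have h2 : (m : ℝ) * monomialCount n (j * β) ≤
          (d : ℝ) ^ n * monomialCount n (j * β + β) := by exact_mod_cast h1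
      have h3 : r * monomialCount n (j * β) ≤ monomialCount n (j * β + β) := by
        rw [hr, div_mul_eq_mul_div, div_le_iff₀ hD]
        linarith
      rw [pow_succ', add_one_mul]
      exact (mul_le_mul_of_nonneg_left ih (by linarith)).trans h3
  have hlim := (tendsto_pow_const_div_const_pow_of_one_lt n hr1).const_mul (((β : ℝ) + 1) ^ n)
  rw [mul_zero] at hlim
  have hev := (hlim.eventually (gt_mem_nhds one_pos)).and (Filter.eventually_ge_atTop 1)
  obtain ⟨j, hj, hj1⟩ := hev.exists
  have h1 : (monomialCount n (j * β) : ℝ) ≤ ((j * β + 1 : ℕ) : ℝ) ^ n := by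
    exact_mod_cast monomialCount_le_pow n (j * β)
  have h2 : ((j * β + 1 : ℕ) : ℝ) ^ n ≤ ((β : ℝ) + 1) ^ n * (j : ℝ) ^ n := by
    rw [← mul_pow]
    have : (1 : ℝ) ≤ j := by exact_mod_cast hj1
    gcongr
    push_cast
    nlinarith
  rw [← mul_div_assoc, div_lt_one (by positivity)] at hj
  linarith [hstep j]

theorem finrank_restrictTotalDegree (k : Type*) [Field k] (A : ℕ) :
    Module.finrank k (restrictTotalDegree (Fin n) k A) = monomialCount n A := by
  have := Module.finrank_eq_nat_card_basis
    (basisRestrictSupport k {s : Fin n →₀ ℕ | (s.sum fun _ e => e) ≤ A})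
  exact this

theorem totalDegree_aeval_le {k σ : Type*} [Field k] {d : ℕ} {F : σ → MvPolynomial σ k}
    (hF : ∀ i, (F i).IsHomogeneous d) (p : MvPolynomial σ k) :
    (aeval F p).totalDegree ≤ d * p.totalDegree := by
  rw [aeval_def, eval₂_eq]
  refine (totalDegree_finsetSum _ _).trans (Finset.sup_le fun s hs => ?_)
  refine (totalDegree_mul _ _).trans ?_
  rw [MvPolynomial.algebraMap_eq, totalDegree_C, zero_add]
  refine (totalDegree_finsetProd _ _).trans ?_
  calc ∑ i ∈ s.support, (F i ^ s i).totalDegree ≤ ∑ i ∈ s.support, d * s i :=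
        Finset.sum_le_sum fun i _ => (totalDegree_pow _ _).trans (by
          rw [mul_comm]; exact Nat.mul_le_mul_right _ (hF i).totalDegree_le)
    _ = d * (s.sum fun _ e => e) := by rw [← Finset.mul_sum]; rfl
    _ ≤ d * p.totalDegree := Nat.mul_le_mul_left _ (le_totalDegree hs)

end Count

/-! ### Bounding the number of solutions -/

section Separation

/-- The evaluation vectors span: a linear form vanishing on all of them would be a linear relation
among the functions. -/
theorem exists_linearIndependent_eval {G Ω ι : Type*} [Field Ω] [Fintype ι] {f : ι → G → Ω}
    (hf : LinearIndependent Ω f) :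
    ∃ g : ι → G, LinearIndependent Ω fun a i => f i (g a) := by
  have htop : Submodule.span Ω (Set.range fun (g : G) (i : ι) => f i g) = ⊤ := by
    by_contra hne
    obtain ⟨φ, hφ, hle⟩ := Submodule.exists_le_ker_of_lt_top _ (lt_top_iff_ne_top.2 hne)
    classical
    have hc : ∀ g, ∑ i, φ (Pi.single i 1) * f i g = 0 := by
      intro g
      have h0 : φ (fun i => f i g) = 0 := hle (Submodule.subset_span ⟨g, rfl⟩)
      rw [← h0, pi_eq_sum_univ (fun i => f i g), map_sum]
      refine Finset.sum_congr rfl fun i _ => ?_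
      rw [map_smul, smul_eq_mul, mul_comm]
      congr 2
      ext j
      simp [Pi.single_apply, eq_comm]
    have hz := Fintype.linearIndependent_iff.1 hf (fun i => φ (Pi.single i 1))
      (by ext g; simpa [Finset.sum_apply] using hc g)
    apply hφ
    refine LinearMap.pi_ext' fun i => LinearMap.ext_ring ?_
    simpa using hz i
  obtain ⟨v, hv, -, hli⟩ := Submodule.exists_fun_fin_finrank_span_eq Ω
    (Set.range fun (g : G) (i : ι) => f i g)
  have hcard : Module.finrank Ω (Submodule.span Ω (Set.range fun (g : G) (i : ι) => f i g)) =
      Fintype.card ι := by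
    rw [htop, finrank_top, Module.finrank_fintype_fun_eq_card]
  let e : ι ≃ Fin (Module.finrank Ω
      (Submodule.span Ω (Set.range fun (g : G) (i : ι) => f i g))) :=
    Fintype.equivOfCardEq (by rw [Fintype.card_fin, hcard])
  choose g hg using hv
  refine ⟨fun a => g (e a), ?_⟩
  have hge : (fun a i => f i (g (e a))) = v ∘ e := funext fun a => hg (e a)
  rw [hge]
  exact hli.comp e e.injective

variable {k : Type*} [Field k] {N d : ℕ} {F : Fin (N + 1) → MvPolynomial (Fin (N + 1)) k}

/-- Evaluations at distinct solutions are linearly independent characters, so as many polynomials `b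
a` as solutions are independent on the fibre. They are then independent over the subring generated
by `F`, and comparing dimensions in bounded degree gives the upper half of Bézout, which suffices.
-/
theorem card_solutions_le (hd : 0 < d) (hF : ∀ i, (F i).IsHomogeneous d)
    (hS : (solutions F).Finite) : hS.toFinset.card ≤ d ^ (N + 1) := by
  classical
  have hli : LinearIndependent (GenericClosure k N)
      fun (Y : hS.toFinset) (p : MvPolynomial (Fin (N + 1)) k) => aeval Y.1 p := by
    have h0 := linearIndependent_monoidHom (MvPolynomial (Fin (N + 1)) k) (GenericClosure k N)
    refine h0.comp (fun Y : hS.toFinset => ((aeval Y.1 : MvPolynomial (Fin (N + 1)) k →ₐ[k]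
      GenericClosure k N) : MvPolynomial (Fin (N + 1)) k →* GenericClosure k N)) ?_
    intro Y Z h
    ext i
    simpa using DFunLike.congr_fun h (X i)
  obtain ⟨b, hb⟩ := exists_linearIndependent_eval hli
  set β := ∑ a, (b a).totalDegree with hβ
  rw [← Fintype.card_coe]
  refine le_pow_of_mul_monomialCount_le (β := β) hd fun A => ?_
  -- At a solution `Y` the image of `p` becomes `∑ p a (X) * b a (Y)`, so independence of the
  -- vectors `b a (Y)` forces `p = 0`.
  let Θ : (hS.toFinset → restrictTotalDegree (Fin (N + 1)) k A) →ₗ[k]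
      restrictTotalDegree (Fin (N + 1)) k (d * A + β) :=
    { toFun := fun p => ⟨∑ a, aeval F (p a).1 * b a, by
        rw [mem_restrictTotalDegree]
        refine (totalDegree_finsetSum _ _).trans (Finset.sup_le fun a _ => ?_)
        refine (totalDegree_mul _ _).trans (add_le_add ?_ ?_)
        · exact (totalDegree_aeval_le hF _).trans
            (Nat.mul_le_mul_left _ ((mem_restrictTotalDegree _ _ _).1 (p a).2))
        · exact Finset.single_le_sum (f := fun a => (b a).totalDegree) (fun _ _ => Nat.zero_le _)
            (Finset.mem_univ a)⟩
      map_add' := fun p q => by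
        ext1
        simp [add_mul, Finset.sum_add_distrib]
      map_smul' := fun c p => by
        ext1
        simp [Finset.smul_sum] }
  have hΘ : Function.Injective Θ := by
    rw [← LinearMap.ker_eq_bot, LinearMap.ker_eq_bot']
    intro p hp
    have h0 : ∑ a, aeval F (p a).1 * b a = 0 := congrArg Subtype.val hp
    have h1 := Fintype.linearIndependent_iff.1 hb
      (fun a => algebraMap _ (GenericClosure k N) (p a).1) (by
        ext Y
        have h2 := congrArg (aeval Y.1) h0
        have hY : Y.1 ∈ solutions F := hS.mem_toFinset.1 Y.2
        simp only [map_sum, map_mul, map_zero, aeval_aeval_of_mem_solutions hY] at h2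
        simp only [Finset.sum_apply, Pi.smul_apply, smul_eq_mul, Pi.zero_apply]
        exact h2)
    ext1 a
    ext1
    exact algebraMap_genericClosure_injective ((h1 a).trans (map_zero _).symm)
  have := LinearMap.finrank_le_finrank_of_injective hΘ
  rwa [Module.finrank_pi_fintype, Finset.sum_const, finrank_restrictTotalDegree,
    finrank_restrictTotalDegree, Finset.card_univ, smul_eq_mul] at this

end Separation

end FormPushforward

namespace FormPushforward

open MvPolynomial

/-! ### Extending a specialization to integral elements -/

section IntegralSubring

variable {R Ω Ω' : Type*} [CommRing R] [CommRing Ω] [Field Ω'] [IsAlgClosed Ω']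

/-- The subring of elements integral over the image of `f`. -/
def integralSubring (f : R →+* Ω) : Subring Ω where
  carrier := {z | f.IsIntegralElem z}
  mul_mem' ha hb := ha.mul f hb
  one_mem' := f.isIntegralElem_one
  add_mem' ha hb := ha.add f hb
  zero_mem' := f.isIntegralElem_zero
  neg_mem' ha := ha.neg f

/-- The structure map of the integral closure. -/
def toIntegralSubring (f : R →+* Ω) : R →+* integralSubring f :=
  f.codRestrict _ fun _ => f.isIntegralElem_map

theorem coe_toIntegralSubring (f : R →+* Ω) (x : R) : (toIntegralSubring f x : Ω) = f x := rfl

theorem isIntegral_toIntegralSubring (f : R →+* Ω) : (toIntegralSubring f).IsIntegral := by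
  intro z
  obtain ⟨p, hp, hpz⟩ := z.2
  refine ⟨p, hp, Subtype.ext ?_⟩
  have := Polynomial.hom_eval₂ p (toIntegralSubring f) (integralSubring f).subtype z
  exact this.trans hpz

theorem exists_ringHom_integralSubring {f : R →+* Ω} (hf : Function.Injective f) (g : R →+* Ω') :
    ∃ h : integralSubring f →+* Ω', h.comp (toIntegralSubring f) = g :=
  exists_ringHom_comp_eq_of_isIntegral _ (fun _ _ hxy => hf (congrArg Subtype.val hxy))
    (isIntegral_toIntegralSubring f) g

end IntegralSubring

theorem finset_eq_of_sum_eq {ι R M : Type*} [Ring R] [Nontrivial R] [AddCommGroup M] [Module R M]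
    {v : ι → M} (hv : LinearIndependent R v) {s t : Finset ι}
    (h : ∑ i ∈ s, v i = ∑ i ∈ t, v i) : s = t := by
  classical
  have h1 : (∑ i ∈ s, Finsupp.single i (1 : R)) = ∑ i ∈ t, Finsupp.single i (1 : R) := by
    apply hv
    simpa [map_sum] using h
  ext i
  have h2 := DFunLike.congr_fun h1 i
  simp only [Finsupp.finsetSum_apply, Finsupp.single_apply, Finset.sum_ite_eq'] at h2
  by_cases hs : i ∈ s <;> by_cases ht : i ∈ t <;> simp_all

/-! ### Specializing the points of the generic fibre -/

section Specialization

theorem toGenericClosure_X {k A : Type*} [Field k] [CommRing A] {N : ℕ} (j : A →+* k)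
    (i : Fin (N + 1)) : toGenericClosure N j (X i) =
      algebraMap (MvPolynomial (Fin (N + 1)) k) (GenericClosure k N) (X i) := by
  simp [toGenericClosure]

variable {k : Type*} [Field k] {N d : ℕ} {A Ω' : Type*} [CommRing A] {j : A →+* k}
  {F : Fin (N + 1) → MvPolynomial (Fin (N + 1)) A} [Field Ω']

/-- Evaluation at an integral point, with values in the integral closure. -/
noncomputable def evalIntegral (j : A →+* k) (Y : Fin (N + 1) → GenericClosure k N)
    (hY : ∀ i, (toGenericClosure N j).IsIntegralElem (Y i)) :
    MvPolynomial (Fin (N + 1)) A →+* integralSubring (toGenericClosure N j) :=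
  eval₂Hom ((toIntegralSubring (toGenericClosure N j)).comp C) fun i => ⟨Y i, hY i⟩

theorem coe_evalIntegral {Y : Fin (N + 1) → GenericClosure k N}
    (hY : ∀ i, (toGenericClosure N j).IsIntegralElem (Y i)) (p : MvPolynomial (Fin (N + 1)) A) :
    (evalIntegral j Y hY p : GenericClosure k N) = aeval Y (map j p) := by
  have : (integralSubring (toGenericClosure N j)).subtype.comp (evalIntegral j Y hY) =
      eval₂Hom ((toGenericClosure N j).comp C) Y := by
    apply MvPolynomial.ringHom_ext
    · intro a
      simp only [evalIntegral, RingHom.comp_apply, coe_eval₂Hom, eval₂_C]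
      rfl
    · intro i
      simp [evalIntegral]
  rw [aeval_map_eq_eval₂]
  exact RingHom.congr_fun this p

/-- The specialization of an integral point. -/
noncomputable def specializePoint (h : integralSubring (toGenericClosure N j) →+* Ω')
    (Y : Fin (N + 1) → GenericClosure k N)
    (hY : ∀ i, (toGenericClosure N j).IsIntegralElem (Y i)) : Fin (N + 1) → Ω' :=
  fun i => h ⟨Y i, hY i⟩

variable {g : MvPolynomial (Fin (N + 1)) A →+* Ω'}
  {h : integralSubring (toGenericClosure N j) →+* Ω'}
  (hg : h.comp (toIntegralSubring (toGenericClosure N j)) = g)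

include hg

theorem apply_evalIntegral {Y : Fin (N + 1) → GenericClosure k N}
    (hY : ∀ i, (toGenericClosure N j).IsIntegralElem (Y i)) (p : MvPolynomial (Fin (N + 1)) A) :
    h (evalIntegral j Y hY p) = eval₂ (g.comp C) (specializePoint h Y hY) p := by
  have : h.comp (evalIntegral j Y hY) = eval₂Hom (g.comp C) (specializePoint h Y hY) := by
    apply MvPolynomial.ringHom_ext
    · intro a
      simp only [evalIntegral, RingHom.comp_apply, coe_eval₂Hom, eval₂_C, ← hg]
    · intro i
      simp [evalIntegral, specializePoint]
  exact RingHom.congr_fun this p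

theorem eval₂_specializePoint_of_mem {Y : Fin (N + 1) → GenericClosure k N}
    (hY : ∀ i, (toGenericClosure N j).IsIntegralElem (Y i))
    (hYS : Y ∈ solutions fun i => map j (F i)) (i : Fin (N + 1)) :
    eval₂ (g.comp C) (specializePoint h Y hY) (F i) = g (X i) := by
  rw [← apply_evalIntegral hg]
  have : evalIntegral j Y hY (F i) = toIntegralSubring (toGenericClosure N j) (X i) := by
    ext
    rw [coe_evalIntegral, hYS i]
    rw [coe_toIntegralSubring, toGenericClosure_X]
  rw [this, ← hg]
  rfl

variable (hS : (solutions fun i => map j (F i)).Finite)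
  (hint : ∀ Y ∈ solutions fun i => map j (F i), ∀ i, (toGenericClosure N j).IsIntegralElem (Y i))

theorem apply_eq_prod {Q Ψ : MvPolynomial (Fin (N + 1)) A}
    (hQ : toGenericClosure N j Q = ∏ Y ∈ hS.toFinset, aeval Y (map j Ψ)) :
    g Q = ∏ Y ∈ hS.toFinset.attach,
      eval₂ (g.comp C) (specializePoint h Y.1 (hint Y.1 (hS.mem_toFinset.1 Y.2))) Ψ := by
  have e : toIntegralSubring (toGenericClosure N j) Q = ∏ Y ∈ hS.toFinset.attach,
      evalIntegral j Y.1 (hint Y.1 (hS.mem_toFinset.1 Y.2)) Ψ := by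
    ext
    rw [SubmonoidClass.coe_finsetProd]
    simp only [coe_evalIntegral]
    rw [Finset.prod_attach hS.toFinset fun Y => aeval Y (map j Ψ)]
    exact hQ
  rw [← hg, RingHom.comp_apply, e, map_prod]
  exact Finset.prod_congr rfl fun Y _ => by rw [apply_evalIntegral rfl]

theorem apply_eq_sum {Q Ψ : MvPolynomial (Fin (N + 1)) A}
    (hQ : toGenericClosure N j Q = ∑ Y ∈ hS.toFinset, aeval Y (map j Ψ)) :
    g Q = ∑ Y ∈ hS.toFinset.attach,
      eval₂ (g.comp C) (specializePoint h Y.1 (hint Y.1 (hS.mem_toFinset.1 Y.2))) Ψ := by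
  have e : toIntegralSubring (toGenericClosure N j) Q = ∑ Y ∈ hS.toFinset.attach,
      evalIntegral j Y.1 (hint Y.1 (hS.mem_toFinset.1 Y.2)) Ψ := by
    ext
    rw [AddSubmonoidClass.coe_finsetSum]
    simp only [coe_evalIntegral]
    rw [Finset.sum_attach hS.toFinset fun Y => aeval Y (map j Ψ)]
    exact hQ
  rw [← hg, RingHom.comp_apply, e, map_sum]
  exact Finset.sum_congr rfl fun Y _ => by rw [apply_evalIntegral rfl]

/-- Some difference of coordinates divides, among integral elements, a `c` that survives
specialization, so that difference survives too. -/
theorem specializePoint_injective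
    (hsep : ∀ Y ∈ solutions fun i => map j (F i), ∀ Y' ∈ solutions fun i => map j (F i), Y ≠ Y' →
      ∃ c : MvPolynomial (Fin (N + 1)) A, g c ≠ 0 ∧ ∃ i w, (toGenericClosure N j).IsIntegralElem w ∧
        toGenericClosure N j c = (Y i - Y' i) * w) :
    Function.Injective fun Y : hS.toFinset =>
      specializePoint h Y.1 (hint Y.1 (hS.mem_toFinset.1 Y.2)) := by
  intro Y Y' hYY
  by_contra hne
  obtain ⟨c, hc, i, w, hw, hcw⟩ := hsep Y.1 (hS.mem_toFinset.1 Y.2) Y'.1 (hS.mem_toFinset.1 Y'.2)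
    fun h => hne (Subtype.ext h)
  apply hc
  have e : toIntegralSubring (toGenericClosure N j) c =
      (⟨Y.1 i, hint Y.1 (hS.mem_toFinset.1 Y.2) i⟩ -
        ⟨Y'.1 i, hint Y'.1 (hS.mem_toFinset.1 Y'.2) i⟩) * ⟨w, hw⟩ := Subtype.ext hcw
  rw [← hg, RingHom.comp_apply, e, map_mul, map_sub]
  have h1 := congrFun hYY i
  simp only [specializePoint] at h1
  rw [h1, sub_self, zero_mul]

omit hg

/-- Evaluation at a generic solution embeds the polynomial ring into the integral closure, which is
integral over its image, so evaluation at `Z` extends. The extension `h` depends on `Z`. -/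
theorem exists_specializePoint_eq [IsAlgClosed Ω'] (hj : Function.Injective j) (hd : 0 < d)
    (hF : ∀ i, (map j (F i)).IsHomogeneous d) (hF' : Nondegenerate fun i => map j (F i))
    {Z : Fin (N + 1) → Ω'} (hZ : ∀ i, eval₂ (g.comp C) Z (F i) = g (X i)) :
    ∃ h : integralSubring (toGenericClosure N j) →+* Ω',
      h.comp (toIntegralSubring (toGenericClosure N j)) = g ∧
      ∃ Y : hS.toFinset, specializePoint h Y.1 (hint Y.1 (hS.mem_toFinset.1 Y.2)) = Z := by
  obtain ⟨Y, hYS, hY⟩ := exists_injective_solution hd hF hF'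
  have hYi := hint Y hYS
  have hinj : Function.Injective (evalIntegral j Y hYi) := by
    intro p q hpq
    have := congrArg Subtype.val hpq
    rw [coe_evalIntegral, coe_evalIntegral] at this
    exact map_injective j hj (hY this)
  have hcomp : (evalIntegral j Y hYi).comp (bind₁ F : _ →ₐ[A] _).toRingHom =
      toIntegralSubring (toGenericClosure N j) := by
    apply MvPolynomial.ringHom_ext
    · intro a
      simp [evalIntegral]
    · intro i
      ext
      have : (bind₁ F).toRingHom (X i) = F i := by simp
      rw [RingHom.comp_apply, this, coe_evalIntegral, hYS i]
      rw [coe_toIntegralSubring, toGenericClosure_X]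
  have hintg : (evalIntegral j Y hYi).IsIntegral :=
    RingHom.IsIntegral.tower_top _ _ (hcomp ▸ isIntegral_toIntegralSubring (toGenericClosure N j))
  obtain ⟨h, hh⟩ := exists_ringHom_comp_eq_of_isIntegral _ hinj hintg (eval₂Hom (g.comp C) Z)
  refine ⟨h, ?_, ⟨Y, hS.mem_toFinset.2 hYS⟩, ?_⟩
  · rw [← hcomp, ← RingHom.comp_assoc, hh]
    apply MvPolynomial.ringHom_ext
    · intro a
      simp
    · intro i
      simpa using hZ i
  · ext i
    have := RingHom.congr_fun hh (X i)
    simpa [evalIntegral, specializePoint] using this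

end Specialization

/-! ### Pushforward commutes with specialization -/

section Commutation

variable {k k' : Type*} [Field k] [CharZero k] [Field k'] {N d : ℕ} {A : Type*} [CommRing A]
  {j : A →+* k} {φ : A →+* k'} {F : Fin (N + 1) → MvPolynomial (Fin (N + 1)) A}

/-- Specialization maps the generic fibre bijectively onto the specialized one: injectively by
`hsep`, surjectively because every point comes from some extension `h'` and the image is the same
for all extensions. -/
theorem pushforward_map_eq (hji : Function.Injective j)
    (hj : ∀ c : k, j.IsIntegralElem c → c ∈ j.range) (hd : 0 < d)
    (hF : ∀ i, (map j (F i)).IsHomogeneous d) (hF' : Nondegenerate fun i => map j (F i))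
    (hint : ∀ Y ∈ solutions fun i => map j (F i), ∀ i, (toGenericClosure N j).IsIntegralElem (Y i))
    (hsep : ∀ Y ∈ solutions fun i => map j (F i), ∀ Y' ∈ solutions fun i => map j (F i), Y ≠ Y' →
      ∃ c : MvPolynomial (Fin (N + 1)) A, map φ c ≠ 0 ∧ ∃ i w,
        (toGenericClosure N j).IsIntegralElem w ∧ toGenericClosure N j c = (Y i - Y' i) * w)
    {Q Ψ : MvPolynomial (Fin (N + 1)) A}
    (hQ : map j Q = pushforward (fun i => map j (F i)) (map j Ψ)) :
    pushforward (fun i => map φ (F i)) (map φ Ψ) = map φ Q := by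
  classical
  have hS := finite_solutions hd hF hF'
  set g := toGenericClosure N φ with hg
  obtain ⟨h, hh⟩ := exists_ringHom_integralSubring (toGenericClosure_injective (N := N) j hji) g
  have hQ' : toGenericClosure N j Q = ∏ Y ∈ hS.toFinset, aeval Y (map j Ψ) := by
    rw [← algebraMap_pushforward hd hF hF', ← hQ]; rfl
  let θ : (integralSubring (toGenericClosure N j) →+* GenericClosure k' N) → hS.toFinset →
      Fin (N + 1) → GenericClosure k' N := fun h Y =>
    specializePoint h Y.1 (hint Y.1 (hS.mem_toFinset.1 Y.2))
  have hinj : ∀ h : integralSubring (toGenericClosure N j) →+* GenericClosure k' N,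
      h.comp (toIntegralSubring (toGenericClosure N j)) = g → Function.Injective (θ h) := by
    intro h hh
    refine specializePoint_injective hh hS hint fun Y hY Y' hY' hne => ?_
    obtain ⟨c, hc, h2⟩ := hsep Y hY Y' hY' hne
    refine ⟨c, fun h0 => hc ?_, h2⟩
    exact algebraMap_genericClosure_injective (h0.trans (map_zero _).symm)
  -- For each `p` the sum of `p` over the generic fibre lies in `A[X]`, so its specialization
  -- depends on `g` alone. Independence of characters then recovers the set of points from these
  -- sums.
  have himage : ∀ h' : integralSubring (toGenericClosure N j) →+* GenericClosure k' N,
      h'.comp (toIntegralSubring (toGenericClosure N j)) = g →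
      hS.toFinset.attach.image (θ h) = hS.toFinset.attach.image (θ h') := by
    intro h' hh'
    let χ : (Fin (N + 1) → GenericClosure k' N) →
        (MvPolynomial (Fin (N + 1)) A →* GenericClosure k' N) := fun Z =>
      (eval₂Hom (g.comp C) Z : MvPolynomial (Fin (N + 1)) A →* GenericClosure k' N)
    have hχ : Function.Injective χ := by
      intro Z Z' h
      ext i
      simpa [χ] using DFunLike.congr_fun h (X i)
    have hli := (linearIndependent_monoidHom (MvPolynomial (Fin (N + 1)) A)
      (GenericClosure k' N)).comp χ hχ
    refine finset_eq_of_sum_eq hli ?_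
    rw [Finset.sum_image fun _ _ _ _ e => hinj h hh e, Finset.sum_image fun _ _ _ _ e => hinj h' hh' e]
    ext p
    obtain ⟨T, hT⟩ := exists_map_eq_sum_solutions j hS hj (Ψ := map j p) fun Y hY =>
      isIntegralElem_aeval_map j (hint Y hY) p
    have h1 := (apply_eq_sum hh hS hint hT).symm.trans (apply_eq_sum hh' hS hint hT)
    simp only [Finset.sum_apply, Function.comp_apply]
    exact h1
  have hsol : solutions (fun i => map φ (F i)) = ↑(hS.toFinset.attach.image (θ h)) := by
    ext Z
    constructor
    · intro hZ
      obtain ⟨h', hh', Y, hY⟩ := exists_specializePoint_eq (g := g) hS hint hji hd hF hF' (Z := Z)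
        fun i => by
          rw [hg, ← aeval_map_eq_eval₂, hZ i]
          simp [toGenericClosure]
      rw [himage h' hh']
      exact Finset.mem_coe.2 (Finset.mem_image.2 ⟨Y, Finset.mem_attach _ _, hY⟩)
    · intro hZ
      obtain ⟨Y, -, rfl⟩ := Finset.mem_image.1 (Finset.mem_coe.1 hZ)
      intro i
      rw [aeval_map_eq_eval₂]
      refine (eval₂_specializePoint_of_mem hh _ (hS.mem_toFinset.1 Y.2) i).trans ?_
      simp [hg, toGenericClosure]
  have hS' : (solutions fun i => map φ (F i)).Finite := hsol ▸ Finset.finite_toSet _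
  apply pushforward_eq_of_algebraMap_eq
  rw [fiberProduct_eq_prod hS']
  have : hS'.toFinset = hS.toFinset.attach.image (θ h) := by
    ext Z
    rw [hS'.mem_toFinset, hsol, Finset.mem_coe]
  rw [this, Finset.prod_image fun _ _ _ _ e => hinj h hh e]
  refine (apply_eq_prod hh hS hint hQ').trans (Finset.prod_congr rfl fun Y _ => ?_)
  rw [hg, ← aeval_map_eq_eval₂]

/-- Here `X` is specialized to `x` as well. The points `θ Y` may coincide, and the product formula
counts them with multiplicity. -/
theorem exists_points [IsAlgClosed k'] (hji : Function.Injective j) (hd : 0 < d)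
    (hF : ∀ i, (map j (F i)).IsHomogeneous d) (hF' : Nondegenerate fun i => map j (F i))
    (hint : ∀ Y ∈ solutions fun i => map j (F i), ∀ i, (toGenericClosure N j).IsIntegralElem (Y i))
    (hS : (solutions fun i => map j (F i)).Finite) (φ : A →+* k')
    (x : Fin (N + 1) → k') : ∃ θ : hS.toFinset → Fin (N + 1) → k',
      (∀ Y i, eval₂ φ (θ Y) (F i) = x i) ∧
      ∀ Q Ψ : MvPolynomial (Fin (N + 1)) A,
        map j Q = pushforward (fun i => map j (F i)) (map j Ψ) →
        eval₂ φ x Q = ∏ Y, eval₂ φ (θ Y) Ψ := by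
  obtain ⟨h, hh⟩ := exists_ringHom_integralSubring (toGenericClosure_injective (N := N) j hji)
    (eval₂Hom φ x)
  have hφ : (eval₂Hom φ x).comp C = φ := by ext; simp
  refine ⟨fun Y => specializePoint h Y.1 (hint Y.1 (hS.mem_toFinset.1 Y.2)), fun Y i => ?_, ?_⟩
  · have := eval₂_specializePoint_of_mem hh (hint Y.1 (hS.mem_toFinset.1 Y.2))
      (hS.mem_toFinset.1 Y.2) i
    rw [hφ] at this
    simpa using this
  · intro Q Ψ hQ
    have := apply_eq_prod hh hS hint (Q := Q) (Ψ := Ψ)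
      (by rw [← algebraMap_pushforward hd hF hF', ← hQ]; rfl)
    rw [hφ] at this
    exact this

end Commutation

end FormPushforward

namespace FormPushforward

open MvPolynomial MeasureTheory

/-! ### Cauchy estimates for coefficients -/

section Cauchy

theorem norm_coeff_mul_pow_le (q : Polynomial ℂ) {r B : ℝ} (hr : 0 < r)
    (h : ∀ z : ℂ, ‖z‖ = r → ‖q.eval z‖ ≤ B) (k : ℕ) : ‖q.coeff k‖ * r ^ k ≤ B := by
  have h1 := Complex.norm_iteratedDeriv_le_of_forall_mem_sphere_norm_le (c := 0) (C := B) k hr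
    (f := fun z => q.eval z) q.differentiable.diffContOnCl (by simpa using h)
  have h2 : iteratedDeriv k (fun z => q.eval z) 0 = k.factorial * q.coeff k := by
    have h3 : ∀ i, deriv^[i] (fun z => q.eval z) = fun z => (Polynomial.derivative^[i] q).eval z := by
      intro i
      induction i with
      | zero => rfl
      | succ i ih =>
        rw [Function.iterate_succ_apply', ih, Function.iterate_succ_apply']
        funext z
        exact Polynomial.deriv _
    rw [iteratedDeriv_eq_iterate, h3]
    beta_reduce
    rw [← Polynomial.coeff_zero_eq_eval_zero,
      Polynomial.coeff_iterate_derivative, zero_add, Nat.descFactorial_self, nsmul_eq_mul]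
  rw [h2, norm_mul, Complex.norm_natCast, mul_div_assoc,
    mul_le_mul_iff_right₀ (by positivity), le_div_iff₀ (by positivity)] at h1
  exact h1

theorem norm_coeff_mul_pow_degree_le {n : ℕ} (p : MvPolynomial (Fin n) ℂ) {r B : ℝ} (hr : 0 < r)
    (h : ∀ x : Fin n → ℂ, (∀ i, ‖x i‖ = r) → ‖eval x p‖ ≤ B) (m : Fin n →₀ ℕ) :
    ‖coeff m p‖ * r ^ m.degree ≤ B := by
  induction n generalizing B with
  | zero =>
    have := h Fin.elim0 fun i => i.elim0
    rw [Finsupp.degree_eq_sum]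
    rw [p.eq_C_of_isEmpty, eval_C] at this
    simpa [Subsingleton.elim m 0] using this
  | succ n ih =>
    rw [← Finsupp.cons_tail m, ← finSuccEquiv_coeff_coeff, Finsupp.degree_eq_sum, Fin.sum_univ_succ,
      Finsupp.cons_zero, pow_add, mul_comm (r ^ _), ← mul_assoc]
    simp only [Finsupp.cons_succ, ← Finsupp.degree_eq_sum]
    rw [← le_div_iff₀ (by positivity)]
    apply ih
    intro x hx
    rw [le_div_iff₀ (by positivity), ← Polynomial.coeff_map, ← Polynomial.coe_mapRingHom]
    apply norm_coeff_mul_pow_le _ hr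
    intro z hz
    have := h (Fin.cons z x) (by intro i; refine Fin.cases ?_ ?_ i <;> simp [hx, hz])
    rw [eval_eq_eval_mv_eval'] at this
    exact this

end Cauchy

/-! ### Volume estimates -/

section Measure

variable {n : ℕ}

/-- Lebesgue measure is a multiple of Hausdorff measure of dimension `2 * n`, for which the
Lipschitz estimate is immediate. -/
theorem volume_image_le_of_lipschitzOnWith {G : (Fin n → ℂ) → (Fin n → ℂ)} {s : Set (Fin n → ℂ)}
    {Λ : NNReal} (hG : LipschitzOnWith Λ G s) :
    volume (G '' s) ≤ (Λ : ENNReal) ^ (2 * n) * volume s := by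
  have hfin : Module.finrank ℝ (Fin n → ℂ) = 2 * n := by
    rw [Module.finrank_pi_fintype]; simp [mul_comm]
  have h := hG.hausdorffMeasure_image_le (d := Module.finrank ℝ (Fin n → ℂ)) (by positivity)
  have hc := Measure.isAddLeftInvariant_eq_smul (volume : Measure (Fin n → ℂ))
    (Measure.hausdorffMeasure (Module.finrank ℝ (Fin n → ℂ)))
  rw [hc, Measure.smul_apply, Measure.smul_apply, ENNReal.smul_def, ENNReal.smul_def, smul_eq_mul,
    smul_eq_mul]
  rw [ENNReal.rpow_natCast] at h
  rw [← hfin]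
  calc _ ≤ _ := mul_le_mul_right h _
    _ = _ := by ring

theorem exists_mem_closedBall_of_volume_lt {G : (Fin n → ℂ) → (Fin n → ℂ)} {B : ℝ} {Λ : NNReal}
    (hG : LipschitzOnWith Λ G (Metric.closedBall 0 B)) {E : Set (Fin n → ℂ)} {k : ℕ}
    (hE : ((Λ : ENNReal) ^ (2 * n)) ^ k * volume E < volume (Metric.closedBall (0 : Fin n → ℂ) 1)) :
    ∃ x ∈ Metric.closedBall (0 : Fin n → ℂ) 1, ∀ y, G^[k] y = x →
      (∀ i ≤ k, G^[i] y ∈ Metric.closedBall 0 B) → y ∉ E := by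
  -- The iterated images of `E` are cut by the ball before each application of `G`, since the
  -- Lipschitz bound holds only there.
  let W : ℕ → Set (Fin n → ℂ) := fun i => Nat.rec E (fun _ S => G '' (S ∩ Metric.closedBall 0 B)) i
  have hW : ∀ i, volume (W i) ≤ ((Λ : ENNReal) ^ (2 * n)) ^ i * volume E := by
    intro i
    induction i with
    | zero => simp [W]
    | succ i ih =>
      calc volume (W (i + 1)) ≤ (Λ : ENNReal) ^ (2 * n) * volume (W i ∩ Metric.closedBall 0 B) :=
            volume_image_le_of_lipschitzOnWith (hG.mono Set.inter_subset_right)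
        _ ≤ (Λ : ENNReal) ^ (2 * n) * (((Λ : ENNReal) ^ (2 * n)) ^ i * volume E) := by
            gcongr
            exact (measure_mono Set.inter_subset_left).trans ih
        _ = _ := by ring
  obtain ⟨x, hx, hxW⟩ : ∃ x ∈ Metric.closedBall (0 : Fin n → ℂ) 1, x ∉ W k := by
    by_contra! hcon
    exact absurd ((measure_mono hcon).trans (hW k)) (not_le.2 hE)
  refine ⟨x, hx, fun y hy hball hyE => hxW ?_⟩
  have : ∀ i ≤ k, G^[i] y ∈ W i := by
    intro i
    induction i with
    | zero => exact fun _ => hyE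
    | succ i ih =>
      intro hi
      rw [Function.iterate_succ_apply']
      exact ⟨_, ⟨ih (by omega), hball i (by omega)⟩, rfl⟩
  exact hy ▸ this k le_rfl

/-- Fubini on the pairs `(z, y)` with `|z| ≤ 1` and `y + z • v ∈ E`. Integrating over `y` first
gives the left side by translation invariance; integrating over `z` first leaves a one-variable
sublevel set. -/
theorem volume_sublevel_le {f : (Fin n → ℂ) → ℂ} (hf : Continuous f) {v : Fin n → ℂ} {c : ℂ}
    {e : ℕ} (hroots : ∀ y, ∃ l : Multiset ℂ, l.card = e ∧
      ∀ z : ℂ, f (y + z • v) = c * (l.map fun a => z - a).prod) {B η : ℝ} (hη : 0 ≤ η) :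
    volume (Metric.closedBall (0 : ℂ) 1) *
        volume (Metric.closedBall (0 : Fin n → ℂ) B ∩ {y | ‖f y‖ < ‖c‖ * η ^ e}) ≤
      e * volume (Metric.closedBall (0 : ℂ) η) *
        volume (Metric.closedBall (0 : Fin n → ℂ) (B + ‖v‖)) := by
  set E := Metric.closedBall (0 : Fin n → ℂ) B ∩ {y | ‖f y‖ < ‖c‖ * η ^ e} with hE
  have hEm : MeasurableSet E := Metric.isClosed_closedBall.measurableSet.inter
    (isOpen_lt hf.norm continuous_const).measurableSet
  set T : Set (ℂ × (Fin n → ℂ)) := {p | p.2 + p.1 • v ∈ E} with hT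
  have hTm : MeasurableSet T := by
    have : Measurable fun p : ℂ × (Fin n → ℂ) => p.2 + p.1 • v := by fun_prop
    exact this hEm
  have h1 : ((volume.restrict (Metric.closedBall (0 : ℂ) 1)).prod volume) T =
      volume (Metric.closedBall (0 : ℂ) 1) * volume E := by
    rw [Measure.prod_apply hTm]
    have : ∀ z : ℂ, volume (Prod.mk z ⁻¹' T) = volume E := by
      intro z
      exact measure_preimage_add_right volume (z • v) E
    simp [this, mul_comm]
  rw [← h1, Measure.prod_apply_symm hTm]
  have h2 : ∀ y, (volume.restrict (Metric.closedBall (0 : ℂ) 1)) ((fun z => (z, y)) ⁻¹' T) ≤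
      (Metric.closedBall (0 : Fin n → ℂ) (B + ‖v‖)).indicator
        (fun _ => e * volume (Metric.closedBall (0 : ℂ) η)) y := by
    intro y
    by_cases hy : y ∈ Metric.closedBall (0 : Fin n → ℂ) (B + ‖v‖)
    · rw [Set.indicator_of_mem hy]
      obtain ⟨l, hl, hfl⟩ := hroots y
      refine (Measure.restrict_apply_le _ _).trans ?_
      -- Away from the discs of radius `η` about the roots, each of the `e` factors exceeds `η`.
      have hsub : (fun z : ℂ => (z, y)) ⁻¹' T ⊆ ⋃ a ∈ l.toFinset, Metric.closedBall a η := by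
        intro z hz
        by_contra hcon
        simp only [Set.mem_iUnion, not_exists, Metric.mem_closedBall, dist_eq_norm,
          Multiset.mem_toFinset, not_le] at hcon
        have hz2 : ‖f (y + z • v)‖ < ‖c‖ * η ^ e := hz.2
        rw [hfl, norm_mul] at hz2
        have h3 : η ^ e ≤ ‖(l.map fun a => z - a).prod‖ := by
          rw [← hl]
          clear hl hfl hz2
          induction l using Multiset.induction_on with
          | empty => simp
          | cons a l ih =>
            rw [Multiset.card_cons, Multiset.map_cons, Multiset.prod_cons, norm_mul, pow_succ']
            exact mul_le_mul (hcon a (Multiset.mem_cons_self _ _)).le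
              (ih fun b hb => hcon b (Multiset.mem_cons_of_mem hb)) (by positivity) (norm_nonneg _)
        exact absurd hz2 (not_lt.2 (by gcongr))
      calc volume ((fun z : ℂ => (z, y)) ⁻¹' T) ≤ volume (⋃ a ∈ l.toFinset, Metric.closedBall a η) :=
            measure_mono hsub
        _ ≤ ∑ a ∈ l.toFinset, volume (Metric.closedBall a η) := measure_biUnion_finset_le _ _
        _ = l.toFinset.card * volume (Metric.closedBall (0 : ℂ) η) := by
            simp [Measure.addHaar_closedBall_center]
        _ ≤ e * volume (Metric.closedBall (0 : ℂ) η) := by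
            gcongr
            exact (Multiset.toFinset_card_le l).trans hl.le
    · rw [Set.indicator_of_notMem hy, nonpos_iff_eq_zero,
        Measure.restrict_apply (measurable_prodMk_right hTm)]
      convert measure_empty (μ := (volume : Measure ℂ))
      ext z
      simp only [Set.mem_inter_iff, Set.mem_preimage, Set.mem_empty_iff_false, iff_false, not_and]
      intro hz hz1
      apply hy
      have hz2 := hz.1
      simp only [Metric.mem_closedBall, dist_zero_right] at hz1 hz2 ⊢
      calc ‖y‖ = ‖(y + z • v) - z • v‖ := by simp
        _ ≤ ‖y + z • v‖ + ‖z • v‖ := norm_sub_le _ _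
        _ ≤ B + 1 * ‖v‖ := by
            rw [norm_smul]
            gcongr
        _ = B + ‖v‖ := by ring
  refine (lintegral_mono h2).trans ?_
  rw [lintegral_indicator Metric.isClosed_closedBall.measurableSet]
  simp

end Measure

end FormPushforward

namespace FormPushforward

open MvPolynomial Filter Bornology

/-! ### Homogeneous forms restricted to lines -/

section Line

theorem natDegree_coeff_prod_linear {n : ℕ} (y v : Fin n → ℂ) (m : Fin n →₀ ℕ) (s : Finset (Fin n)) :
    (∏ i ∈ s, (Polynomial.C (y i) + Polynomial.C (v i) * Polynomial.X) ^ m i).natDegree ≤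
        ∑ i ∈ s, m i ∧
      (∏ i ∈ s, (Polynomial.C (y i) + Polynomial.C (v i) * Polynomial.X) ^ m i).coeff
        (∑ i ∈ s, m i) = ∏ i ∈ s, v i ^ m i := by
  classical
  induction s using Finset.induction_on with
  | empty => simp
  | insert i s hi ih =>
    rw [Finset.prod_insert hi, Finset.sum_insert hi, Finset.prod_insert hi]
    have h1 : (Polynomial.C (y i) + Polynomial.C (v i) * Polynomial.X).natDegree ≤ 1 := by
      rw [add_comm]; exact Polynomial.natDegree_linear_le
    have h2 : ((Polynomial.C (y i) + Polynomial.C (v i) * Polynomial.X) ^ m i).natDegree ≤ m i :=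
      (Polynomial.natDegree_pow_le_of_le _ h1).trans (mul_one _).le
    refine ⟨Polynomial.natDegree_mul_le_of_le h2 ih.1, ?_⟩
    rw [Polynomial.coeff_mul_add_eq_of_natDegree_le h2 ih.1, ih.2]
    congr 1
    have := Polynomial.coeff_pow_of_natDegree_le (m := m i) h1
    rw [mul_one] at this
    rw [this]
    simp [Polynomial.coeff_C]

/-- The coefficient of `z ^ e` in `P (y + z • v)` is `P v`, independently of `y`. -/
theorem exists_roots_of_isHomogeneous {n e : ℕ} {P : MvPolynomial (Fin n) ℂ}
    (hP : P.IsHomogeneous e) {v : Fin n → ℂ} (hv : eval v P ≠ 0) (y : Fin n → ℂ) :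
    ∃ l : Multiset ℂ, l.card = e ∧
      ∀ z : ℂ, eval (y + z • v) P = eval v P * (l.map fun a => z - a).prod := by
  set q : Polynomial ℂ :=
    eval₂ Polynomial.C (fun i => Polynomial.C (y i) + Polynomial.C (v i) * Polynomial.X) P with hq
  have hsum : ∀ m ∈ P.support, ∑ i, m i = e := fun m hm => by
    rw [← Finsupp.degree_eq_sum]
    exact hP.degree_eq_sum_deg_support hm |>.symm
  have hqe : q = ∑ m ∈ P.support, Polynomial.C (coeff m P) *
      ∏ i, (Polynomial.C (y i) + Polynomial.C (v i) * Polynomial.X) ^ m i := by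
    rw [hq, eval₂_eq']
  have hdeg : q.natDegree ≤ e := by
    rw [hqe]
    refine Polynomial.natDegree_sum_le_of_forall_le _ _ fun m hm => ?_
    refine (Polynomial.natDegree_C_mul_le _ _).trans ?_
    exact ((natDegree_coeff_prod_linear y v m Finset.univ).1).trans (hsum m hm).le
  have hcoeff : q.coeff e = eval v P := by
    rw [hqe, Polynomial.finsetSum_coeff, eval_eq']
    refine Finset.sum_congr rfl fun m hm => ?_
    rw [Polynomial.coeff_C_mul, ← hsum m hm, (natDegree_coeff_prod_linear y v m Finset.univ).2]
  have hnat : q.natDegree = e :=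
    le_antisymm hdeg (Polynomial.le_natDegree_of_ne_zero (hcoeff ▸ hv))
  have hlead : q.leadingCoeff = eval v P := by rw [Polynomial.leadingCoeff, hnat, hcoeff]
  have hsplit := IsAlgClosed.splits q
  refine ⟨q.roots, by rw [← hsplit.natDegree_eq_card_roots, hnat], fun z => ?_⟩
  have h1 : q.eval z = eval (y + z • v) P := by
    rw [hq, ← Polynomial.coe_evalRingHom, ← MvPolynomial.coe_eval₂Hom, ← RingHom.comp_apply]
    have : (Polynomial.evalRingHom z).comp (eval₂Hom Polynomial.C
        (fun i => Polynomial.C (y i) + Polynomial.C (v i) * Polynomial.X)) = eval (y + z • v) := by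
      apply MvPolynomial.ringHom_ext
      · intro a; simp
      · intro i
        simp only [RingHom.comp_apply, coe_eval₂Hom, eval₂_X, Polynomial.coe_evalRingHom,
          Polynomial.eval_add, Polynomial.eval_mul, Polynomial.eval_C, Polynomial.eval_X, eval_X,
          Pi.add_apply, Pi.smul_apply, smul_eq_mul, mul_comm z]
    rw [this]
  rw [← h1, ← hlead]
  conv_lhs => rw [hsplit.eq_prod_roots]
  rw [Polynomial.eval_mul, Polynomial.eval_C, Polynomial.eval_multiset_prod, Multiset.map_map]
  simp

end Line

/-! ### Growth of polynomials and rational functions at infinity -/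

section LogAsymptotics

theorem exists_log_norm_eval_bound {p : Polynomial ℂ} (hp : p ≠ 0) : ∃ C : ℝ,
    ∀ᶠ t in cobounded ℂ, p.eval t ≠ 0 ∧
      |Real.log ‖p.eval t‖ - p.natDegree * Real.log ‖t‖| ≤ C := by
  have hrev : Tendsto (fun t : ℂ => p.reverse.eval t⁻¹) (cobounded ℂ) (nhds p.leadingCoeff) := by
    have h1 : Tendsto (fun t : ℂ => t⁻¹) (cobounded ℂ) (nhds 0) := tendsto_inv₀_cobounded
    have h2 := (p.reverse.continuous.tendsto 0).comp h1
    rwa [← Polynomial.coeff_zero_eq_eval_zero, Polynomial.coeff_zero_reverse] at h2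
  have hlc : p.leadingCoeff ≠ 0 := Polynomial.leadingCoeff_ne_zero.2 hp
  have hlog : Tendsto (fun t : ℂ => Real.log ‖p.reverse.eval t⁻¹‖) (cobounded ℂ)
      (nhds (Real.log ‖p.leadingCoeff‖)) :=
    hrev.norm.log (norm_ne_zero_iff.2 hlc)
  refine ⟨|Real.log ‖p.leadingCoeff‖| + 1, ?_⟩
  filter_upwards [hrev.eventually_ne hlc, hlog.eventually (Metric.ball_mem_nhds _ one_pos),
    eventually_ne_cobounded (0 : ℂ)] with t h1 h2 h3'
  have h3 : t ≠ 0 := h3'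
  let := invertibleOfNonzero h3
  have h4 : p.eval t = p.reverse.eval t⁻¹ * t ^ p.natDegree := by
    have := Polynomial.eval₂_reverse_mul_pow (RingHom.id ℂ) t p
    simp only [Polynomial.eval₂_id, invOf_eq_inv] at this
    exact this.symm
  refine ⟨by rw [h4]; exact mul_ne_zero h1 (pow_ne_zero _ h3), ?_⟩
  rw [h4, norm_mul, norm_pow, Real.log_mul (norm_ne_zero_iff.2 h1)
    (pow_ne_zero _ (norm_ne_zero_iff.2 h3)), Real.log_pow, add_sub_cancel_right]
  replace h2 : dist _ _ < 1 := h2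
  rw [Real.dist_eq] at h2
  have := abs_sub_abs_le_abs_sub (Real.log ‖p.reverse.eval t⁻¹‖) (Real.log ‖p.leadingCoeff‖)
  linarith

variable {K : Type*} [Field K] (τ : K →+* ℂ)

theorem exists_log_norm_eval₂_bound {p : Polynomial K} (hp : p ≠ 0) : ∃ C : ℝ,
    ∀ᶠ t in cobounded ℂ, p.eval₂ τ t ≠ 0 ∧
      |Real.log ‖p.eval₂ τ t‖ - p.natDegree * Real.log ‖t‖| ≤ C := by
  have := exists_log_norm_eval_bound (p := p.map τ)
    ((Polynomial.map_ne_zero_iff τ.injective).2 hp)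
  simpa only [Polynomial.eval_map, Polynomial.natDegree_map] using this

/-- The value of a rational function at `t`, with coefficients embedded by `τ`. -/
noncomputable def ratEval (t : ℂ) (c : RatFunc K) : ℂ := c.num.eval₂ τ t / c.denom.eval₂ τ t

theorem ratEval_zero (t : ℂ) : ratEval τ t 0 = 0 := by simp [ratEval]

theorem ratEval_add {t : ℂ} {x y : RatFunc K} (hx : x.denom.eval₂ τ t ≠ 0)
    (hy : y.denom.eval₂ τ t ≠ 0) : ratEval τ t (x + y) = ratEval τ t x + ratEval τ t y := by
  unfold ratEval
  have hxy : (x + y).denom.eval₂ τ t ≠ 0 := fun h => by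
    have := Polynomial.eval₂_eq_zero_of_dvd_of_eval₂_eq_zero τ t (RatFunc.denom_add_dvd x y) h
    rw [Polynomial.eval₂_mul] at this
    exact mul_ne_zero hx hy this
  rw [div_add_div _ _ hx hy, div_eq_div_iff hxy (mul_ne_zero hx hy)]
  simp only [← Polynomial.eval₂_mul, ← Polynomial.eval₂_add]
  rw [RatFunc.num_denom_add, mul_comm]

theorem ratEval_mul {t : ℂ} {x y : RatFunc K} (hx : x.denom.eval₂ τ t ≠ 0)
    (hy : y.denom.eval₂ τ t ≠ 0) : ratEval τ t (x * y) = ratEval τ t x * ratEval τ t y := by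
  unfold ratEval
  have hxy : (x * y).denom.eval₂ τ t ≠ 0 := fun h => by
    have := Polynomial.eval₂_eq_zero_of_dvd_of_eval₂_eq_zero τ t (RatFunc.denom_mul_dvd x y) h
    rw [Polynomial.eval₂_mul] at this
    exact mul_ne_zero hx hy this
  rw [div_mul_div_comm, div_eq_div_iff hxy (mul_ne_zero hx hy)]
  simp only [← Polynomial.eval₂_mul]
  rw [RatFunc.num_denom_mul, mul_comm]

theorem exists_pow_norm_ratFunc_bound {c : RatFunc K} (hc : c ≠ 0) : ∃ A : ℕ,
    ∀ᶠ t in cobounded ℂ, ‖ratEval τ t c‖ ≤ ‖t‖ ^ A ∧ 1 ≤ ‖t‖ ^ A * ‖ratEval τ t c‖ := by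
  obtain ⟨C₁, h₁⟩ := exists_log_norm_eval₂_bound τ (RatFunc.num_ne_zero hc)
  obtain ⟨C₂, h₂⟩ := exists_log_norm_eval₂_bound τ c.denom_ne_zero
  -- The extra `1` in the exponent absorbs the constants `C₁` and `C₂` once `log ‖t‖` exceeds their
  -- sum.
  refine ⟨c.num.natDegree + c.denom.natDegree + 1, ?_⟩
  have hbig : ∀ᶠ t in cobounded ℂ, max (C₁ + C₂) 1 ≤ Real.log ‖t‖ :=
    (Real.tendsto_log_atTop.comp tendsto_norm_cobounded_atTop).eventually_ge_atTop _
  filter_upwards [h₁, h₂, hbig, eventually_ne_cobounded (0 : ℂ)] with t ⟨n1, h1⟩ ⟨n2, h2⟩ h3 h4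
  have hn : ratEval τ t c ≠ 0 := div_ne_zero n1 n2
  have hlog : Real.log ‖ratEval τ t c‖ =
      Real.log ‖c.num.eval₂ τ t‖ - Real.log ‖c.denom.eval₂ τ t‖ := by
    rw [ratEval, norm_div, Real.log_div (norm_ne_zero_iff.2 n1) (norm_ne_zero_iff.2 n2)]
  have hT : 0 < ‖t‖ := norm_pos_iff.2 h4
  rw [abs_le] at h1 h2
  have h5 := le_max_left (C₁ + C₂) 1
  have h6 := le_max_right (C₁ + C₂) 1
  have hx : (0 : ℝ) ≤ c.num.natDegree * Real.log ‖t‖ :=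
    mul_nonneg (Nat.cast_nonneg _) (by linarith)
  have hy : (0 : ℝ) ≤ c.denom.natDegree * Real.log ‖t‖ :=
    mul_nonneg (Nat.cast_nonneg _) (by linarith)
  constructor
  · rw [← Real.log_le_log_iff (norm_pos_iff.2 hn) (by positivity), Real.log_pow, hlog]
    push_cast
    linarith
  · have hpos : 0 < ‖ratEval τ t c‖ := norm_pos_iff.2 hn
    rw [← Real.log_nonneg_iff (by positivity), Real.log_mul (by positivity) hpos.ne', Real.log_pow,
      hlog]
    push_cast
    linarith

end LogAsymptotics

/-! ### Rational functions regular at a point, and specialization -/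

section Regular

variable {K : Type*} [Field K] (τ : K →+* ℂ) (t : ℂ) {N : ℕ}

/-- The rational functions without a pole at `t`. -/
noncomputable def regularAt : ValuationSubring (RatFunc K) where
  carrier := {c | c.denom.eval₂ τ t ≠ 0}
  mul_mem' {a b} ha hb h := by
    have := Polynomial.eval₂_eq_zero_of_dvd_of_eval₂_eq_zero τ t (RatFunc.denom_mul_dvd a b) h
    rw [Polynomial.eval₂_mul] at this
    exact (mul_ne_zero ha hb) this
  one_mem' := by simp
  add_mem' {a b} ha hb h := by
    have := Polynomial.eval₂_eq_zero_of_dvd_of_eval₂_eq_zero τ t (RatFunc.denom_add_dvd a b) h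
    rw [Polynomial.eval₂_mul] at this
    exact (mul_ne_zero ha hb) this
  zero_mem' := by simp
  neg_mem' {a} ha h := by
    have := Polynomial.eval₂_eq_zero_of_dvd_of_eval₂_eq_zero τ t
      (RatFunc.denom_mul_dvd (-1) a) (by rwa [neg_one_mul])
    rw [Polynomial.eval₂_mul] at this
    refine (mul_ne_zero ?_ ha) this
    have : (-1 : RatFunc K) = RatFunc.C (-1) := by simp
    rw [this, RatFunc.denom_C]
    simp
  mem_or_inv_mem' c := by
    by_cases hc : c = 0
    · left; simp [hc]
    by_contra! h
    simp only [Set.mem_ofPred_eq, not_not] at h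
    have h1 : c.denom.eval₂ τ t = 0 := by simpa using h.1
    have h2 : c⁻¹.denom.eval₂ τ t = 0 := by simpa using h.2
    have h3 := Polynomial.eval₂_eq_zero_of_dvd_of_eval₂_eq_zero τ t
      (RatFunc.associated_denom_inv hc).dvd h2
    -- Numerator and denominator are coprime, so they cannot both vanish at `t`.
    obtain ⟨a, b, hab⟩ := c.isCoprime_num_denom
    have := congrArg (Polynomial.eval₂ τ t) hab
    rw [Polynomial.eval₂_add, Polynomial.eval₂_mul, Polynomial.eval₂_mul, h1, h3] at this
    simp at this

/-- Evaluation at `t`. -/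
noncomputable def evalAt : regularAt τ t →+* ℂ where
  toFun c := ratEval τ t c
  map_one' := by simp [ratEval]
  map_zero' := ratEval_zero τ t
  map_mul' a b := ratEval_mul τ a.2 b.2
  map_add' a b := ratEval_add τ a.2 b.2

/-- The inclusion of the rational functions without a pole at `t`. -/
noncomputable def inclAt : regularAt τ t →+* RatFunc K := (regularAt τ t).subtype

theorem evalAt_apply (c : regularAt τ t) : evalAt τ t c = ratEval τ t (inclAt τ t c) := rfl

theorem inclAt_injective : Function.Injective (inclAt τ t) := Subtype.val_injective

/-- A valuation ring is integrally closed; this is the hypothesis `hj` of the descent. -/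
theorem mem_range_inclAt_of_isIntegralElem (c : RatFunc K) (hc : (inclAt τ t).IsIntegralElem c) :
    c ∈ (inclAt τ t).range := by
  have : IsIntegral (regularAt τ t) c := hc
  obtain ⟨a, ha⟩ := IsIntegrallyClosed.isIntegral_iff.1 this
  exact ⟨a, ha⟩

theorem eventually_mem_regularAt (c : RatFunc K) : ∀ᶠ t in cobounded ℂ, c ∈ regularAt τ t := by
  obtain ⟨C, hC⟩ := exists_log_norm_eval₂_bound τ c.denom_ne_zero
  exact hC.mono fun t ht => ht.1

/-- All coefficients are regular at `t`. -/
def IsRegularAt (P : MvPolynomial (Fin (N + 1)) (RatFunc K)) : Prop :=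
  ∃ Ψ : MvPolynomial (Fin (N + 1)) (regularAt τ t), MvPolynomial.map (inclAt τ t) Ψ = P

theorem isRegularAt_iff {P : MvPolynomial (Fin (N + 1)) (RatFunc K)} :
    IsRegularAt τ t P ↔ ∀ m ∈ P.support, coeff m P ∈ regularAt τ t := by
  constructor
  · rintro ⟨Ψ, rfl⟩ m -
    rw [coeff_map]
    exact (coeff m Ψ).2
  · intro h
    have : P ∈ Set.range (MvPolynomial.map (inclAt τ t)) := by
      rw [MvPolynomial.mem_range_map_iff_coeffs_subset]
      intro c hc
      rw [Finset.mem_coe, mem_coeffs_iff] at hc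
      obtain ⟨m, hm, rfl⟩ := hc
      exact ⟨⟨_, h m hm⟩, rfl⟩
    exact this

theorem eventually_isRegularAt (P : MvPolynomial (Fin (N + 1)) (RatFunc K)) :
    ∀ᶠ t in cobounded ℂ, IsRegularAt τ t P := by
  simp only [isRegularAt_iff]
  rw [Finset.eventually_all]
  exact fun m _ => eventually_mem_regularAt τ _

theorem coeff_specialize (P : MvPolynomial (Fin (N + 1)) (RatFunc K)) (m : Fin (N + 1) →₀ ℕ) :
    coeff m (specialize τ t P) = ratEval τ t (coeff m P) := by
  classical
  rw [specialize, coeff_sum]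
  simp only [coeff_monomial]
  rw [Finset.sum_ite_eq']
  split_ifs with h
  · rfl
  · rw [notMem_support_iff.1 h, ratEval_zero]

theorem specialize_map (Ψ : MvPolynomial (Fin (N + 1)) (regularAt τ t)) :
    specialize τ t (MvPolynomial.map (inclAt τ t) Ψ) = MvPolynomial.map (evalAt τ t) Ψ := by
  ext m
  rw [coeff_specialize, coeff_map, coeff_map]
  rfl

theorem isHomogeneous_specialize {P : MvPolynomial (Fin (N + 1)) (RatFunc K)} {e : ℕ}
    (hP : P.IsHomogeneous e) : (specialize τ t P).IsHomogeneous e := by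
  intro m hm
  apply hP
  intro h0
  rw [coeff_specialize, h0, ratEval_zero] at hm
  exact hm rfl

theorem eventually_specialize_ne_zero {P : MvPolynomial (Fin (N + 1)) (RatFunc K)} (hP : P ≠ 0) :
    ∀ᶠ t in cobounded ℂ, specialize τ t P ≠ 0 := by
  obtain ⟨m, hm⟩ := ne_zero_iff.1 hP
  obtain ⟨A, hA⟩ := exists_pow_norm_ratFunc_bound τ hm
  filter_upwards [hA] with t ht h0
  have := congrArg (coeff m) h0
  rw [coeff_specialize, coeff_zero] at this
  rw [this] at ht
  norm_num at ht

end Regular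

end FormPushforward

namespace FormPushforward

open MvPolynomial Filter Bornology

/-- A nonzero integral element divides a nonzero element of `R` among integral elements. Applied to
differences of solutions, this supplies the separating `c`. -/
theorem exists_eq_mul_of_isIntegralElem {R Ω : Type*} [CommRing R] [IsDomain R] [Field Ω]
    {f : R →+* Ω} {δ : Ω} (hδ : f.IsIntegralElem δ) (h0 : δ ≠ 0) :
    ∃ c : R, c ≠ 0 ∧ ∃ w, f.IsIntegralElem w ∧ f c = δ * w := by
  algebraize [toIntegralSubring f]
  have h1 : IsIntegral R (⟨δ, hδ⟩ : integralSubring f) :=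
    isIntegral_toIntegralSubring f ⟨δ, hδ⟩
  have h2 : (⟨δ, hδ⟩ : integralSubring f) ∈ nonZeroDivisors (integralSubring f) :=
    mem_nonZeroDivisors_of_ne_zero fun h => h0 (congrArg Subtype.val h)
  obtain ⟨c, hc, w, hw⟩ := h1.isAlgebraic.exists_nonzero_dvd h2
  exact ⟨c, hc, w.1, w.2, congrArg Subtype.val hw⟩

/-! ### Commutation with specialization for all large `t` -/

section Eventually

variable {K : Type*} [Field K] (τ : K →+* ℂ) {N d : ℕ}
  {F : Fin (N + 1) → MvPolynomial (Fin (N + 1)) (RatFunc K)}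

theorem isRegularAt_zero (t : ℂ) :
    IsRegularAt τ t (0 : MvPolynomial (Fin (N + 1)) (RatFunc K)) := ⟨0, map_zero _⟩

theorem eventually_isIntegralElem {z : GenericClosure (RatFunc K) N}
    (hz : (algebraMap (MvPolynomial (Fin (N + 1)) (RatFunc K)) _).IsIntegralElem z) :
    ∀ᶠ t in cobounded ℂ, (toGenericClosure N (inclAt τ t)).IsIntegralElem z := by
  obtain ⟨p, hp, hpz⟩ := hz
  have h : ∀ᶠ t in cobounded ℂ, ∀ i ∈ p.support, IsRegularAt τ t (p.coeff i) := by
    rw [Finset.eventually_all]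
    exact fun i _ => eventually_isRegularAt τ _
  filter_upwards [h] with t ht
  have hl : p ∈ Polynomial.lifts (MvPolynomial.map (inclAt τ t)) := by
    rw [Polynomial.lifts_iff_coeff_lifts]
    intro i
    by_cases hi : i ∈ p.support
    · exact ht i hi
    · rw [Polynomial.notMem_support_iff.1 hi]
      exact isRegularAt_zero τ t
  obtain ⟨q, hq, -, hqm⟩ := Polynomial.lifts_and_natDegree_eq_and_monic hl hp
  refine ⟨q, hqm, ?_⟩
  rw [← hq, Polynomial.eval₂_map] at hpz
  exact hpz

/-- The conditions imposed on `t` concern only `F` and its finite fibre: regular coefficients,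
integral solutions, distinct specializations. The quantifier over `Ψ` therefore stands inside the
eventuality, and all iterates are covered by one threshold. -/
theorem eventually_pushforward [CharZero K] (hd : 0 < d) (hF : ∀ i, (F i).IsHomogeneous d)
    (hF' : Nondegenerate F) (hS : (solutions F).Finite) : ∀ᶠ t in cobounded ℂ,
      (∀ i, IsRegularAt τ t (F i)) ∧
      ∀ Ψ, IsRegularAt τ t Ψ → IsRegularAt τ t (pushforward F Ψ) ∧
        pushforward (fun i => specialize τ t (F i)) (specialize τ t Ψ) =
          specialize τ t (pushforward F Ψ) ∧
        ∀ x : Fin (N + 1) → ℂ, ∃ θ : hS.toFinset → Fin (N + 1) → ℂ,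
          (∀ Y i, eval (θ Y) (specialize τ t (F i)) = x i) ∧
          eval x (specialize τ t (pushforward F Ψ)) = ∏ Y, eval (θ Y) (specialize τ t Ψ) := by
  have : CharZero (RatFunc K) := charZero_of_injective_algebraMap (R := K) (algebraMap K _).injective
  have hint0 : ∀ Y ∈ solutions F, ∀ i,
      (algebraMap (MvPolynomial (Fin (N + 1)) (RatFunc K)) _).IsIntegralElem (Y i) :=
    fun Y hY i => toGenericClosure_id (k := RatFunc K) ▸
      isIntegralElem_of_mem_solutions hd hF hF' hY i
  have h1 : ∀ᶠ t in cobounded ℂ, ∀ i, IsRegularAt τ t (F i) :=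
    eventually_all.2 fun i => eventually_isRegularAt τ _
  have h2 : ∀ᶠ t in cobounded ℂ, ∀ Y ∈ hS.toFinset, ∀ i,
      (toGenericClosure N (inclAt τ t)).IsIntegralElem (Y i) := by
    rw [Finset.eventually_all]
    exact fun Y hY => eventually_all.2 fun i =>
      eventually_isIntegralElem τ (hint0 Y (hS.mem_toFinset.1 hY) i)
  have h3 : ∀ᶠ t in cobounded ℂ, ∀ Y ∈ hS.toFinset, ∀ Y' ∈ hS.toFinset, Y ≠ Y' →
      ∃ c : MvPolynomial (Fin (N + 1)) (regularAt τ t), MvPolynomial.map (evalAt τ t) c ≠ 0 ∧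
        ∃ i w, (toGenericClosure N (inclAt τ t)).IsIntegralElem w ∧
          toGenericClosure N (inclAt τ t) c = (Y i - Y' i) * w := by
    rw [Finset.eventually_all]
    intro Y hY
    rw [Finset.eventually_all]
    intro Y' hY'
    by_cases hne : Y = Y'
    · exact Eventually.of_forall fun t h => absurd hne h
    obtain ⟨i, hi⟩ := Function.ne_iff.1 hne
    obtain ⟨c, hc, w, hw, hcw⟩ := exists_eq_mul_of_isIntegralElem
      ((hint0 Y (hS.mem_toFinset.1 hY) i).sub _ (hint0 Y' (hS.mem_toFinset.1 hY') i))
      (sub_ne_zero.2 hi)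
    filter_upwards [eventually_isRegularAt τ c, eventually_specialize_ne_zero τ hc,
      eventually_isIntegralElem τ hw] with t ⟨c', hc'⟩ h2 h3 _
    refine ⟨c', ?_, i, w, h3, ?_⟩
    · rwa [← specialize_map, hc']
    · rw [toGenericClosure, RingHom.comp_apply, hc', hcw]
  filter_upwards [h1, h2, h3] with t h1 h2 h3
  refine ⟨h1, ?_⟩
  choose F' hFF using h1
  obtain rfl : F = fun i => MvPolynomial.map (inclAt τ t) (F' i) := (funext hFF).symm
  rintro Ψ ⟨Ψ', rfl⟩
  have hint : ∀ Y ∈ solutions fun i => MvPolynomial.map (inclAt τ t) (F' i), ∀ i,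
    (toGenericClosure N (inclAt τ t)).IsIntegralElem (Y i) := fun Y hY => h2 Y (hS.mem_toFinset.2 hY)
  obtain ⟨Q, hQ⟩ := exists_map_eq_pushforward (inclAt τ t) hS
    (mem_range_inclAt_of_isIntegralElem τ t) (Ψ := MvPolynomial.map (inclAt τ t) Ψ')
    fun Y hY => isIntegralElem_aeval_map _ (hint Y hY) _
  refine ⟨⟨Q, hQ⟩, ?_, fun x => ?_⟩
  · rw [← hQ, specialize_map, specialize_map]
    simp only [specialize_map]
    exact pushforward_map_eq (inclAt_injective τ t) (mem_range_inclAt_of_isIntegralElem τ t) hd hF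
      hF' hint (fun Y hY Y' hY' => h3 Y (hS.mem_toFinset.2 hY) Y' (hS.mem_toFinset.2 hY')) hQ
  · obtain ⟨θ, hθ, hθQ⟩ := exists_points (inclAt_injective τ t) hd hF hF' hint hS (evalAt τ t) x
    refine ⟨θ, fun Y i => ?_, ?_⟩
    · rw [specialize_map, eval_map, hθ]
    · rw [← hQ, specialize_map, specialize_map, eval_map, hθQ Q Ψ' hQ]
      simp only [eval_map]

end Eventually

/-! ### Size and Lipschitz bounds in powers of `‖t‖` -/

section Growth

variable {K : Type*} [Field K] (τ : K →+* ℂ) {N : ℕ}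

/-- Built up from constants, sums and products with variables; numerical factors are absorbed into
the exponent because `‖t‖ ≥ 2`. -/
theorem exists_growth_bound (P : MvPolynomial (Fin (N + 1)) (RatFunc K)) : ∃ A : ℕ,
    ∀ᶠ t in cobounded ℂ, IsRegularAt τ t P ∧ ∀ B : ℝ, 1 ≤ B → ∀ x y : Fin (N + 1) → ℂ,
      ‖x‖ ≤ B → ‖y‖ ≤ B → ‖eval x (specialize τ t P)‖ ≤ (‖t‖ * B) ^ A ∧
        ‖eval x (specialize τ t P) - eval y (specialize τ t P)‖ ≤ (‖t‖ * B) ^ A * ‖x - y‖ := by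
  have hbig : ∀ᶠ t in cobounded ℂ, 2 ≤ ‖t‖ := tendsto_norm_cobounded_atTop.eventually_ge_atTop 2
  induction P using MvPolynomial.induction_on with
  | C c =>
    by_cases hc : c = 0
    · refine ⟨0, Eventually.of_forall fun t => ⟨by rw [hc, C_0]; exact isRegularAt_zero τ t, ?_⟩⟩
      have : specialize τ t (C c : MvPolynomial (Fin (N + 1)) (RatFunc K)) = 0 := by
        rw [hc, C_0]; simp [specialize]
      simp [this]
    obtain ⟨A, hA⟩ := exists_pow_norm_ratFunc_bound τ hc
    refine ⟨A, ?_⟩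
    filter_upwards [hA, hbig, eventually_mem_regularAt τ c] with t ht h2 hreg
    have e : MvPolynomial.map (inclAt τ t) (C ⟨c, hreg⟩) =
        (C c : MvPolynomial (Fin (N + 1)) (RatFunc K)) := by rw [map_C]; rfl
    refine ⟨⟨_, e⟩, fun B hB x y hx hy => ?_⟩
    rw [← e, specialize_map, map_C, eval_C, eval_C]
    constructor
    · refine ht.1.trans (pow_le_pow_left₀ (by positivity) ?_ _)
      exact le_mul_of_one_le_right (by positivity) hB
    · rw [sub_self, norm_zero]; positivity
  | add p q hp hq =>
    obtain ⟨A₁, h₁⟩ := hp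
    obtain ⟨A₂, h₂⟩ := hq
    refine ⟨max A₁ A₂ + 1, ?_⟩
    filter_upwards [h₁, h₂, hbig] with t ⟨⟨p', hp'⟩, h1⟩ ⟨⟨q', hq'⟩, h2⟩ h3
    have e : MvPolynomial.map (inclAt τ t) (p' + q') = p + q := by rw [map_add, hp', hq']
    refine ⟨⟨_, e⟩, fun B hB x y hx hy => ?_⟩
    obtain ⟨a1, a2⟩ := h1 B hB x y hx hy
    obtain ⟨b1, b2⟩ := h2 B hB x y hx hy
    rw [← hp', specialize_map] at a1 a2
    rw [← hq', specialize_map] at b1 b2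
    rw [← e, specialize_map, map_add, map_add, map_add]
    have hTB : 2 ≤ ‖t‖ * B := by nlinarith
    have c1 : (‖t‖ * B) ^ A₁ ≤ (‖t‖ * B) ^ max A₁ A₂ :=
      pow_le_pow_right₀ (by linarith) (le_max_left _ _)
    have c2 : (‖t‖ * B) ^ A₂ ≤ (‖t‖ * B) ^ max A₁ A₂ :=
      pow_le_pow_right₀ (by linarith) (le_max_right _ _)
    have c3 : 2 * (‖t‖ * B) ^ max A₁ A₂ ≤ (‖t‖ * B) ^ (max A₁ A₂ + 1) := by
      rw [pow_succ']; gcongr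
    constructor
    · exact (norm_add_le _ _).trans (by linarith)
    · rw [add_sub_add_comm]
      refine (norm_add_le _ _).trans ((add_le_add a2 b2).trans ?_)
      rw [← add_mul]
      gcongr
      linarith
  | mul_X p i hp =>
    obtain ⟨A, h⟩ := hp
    refine ⟨A + 2, ?_⟩
    filter_upwards [h, hbig] with t ⟨⟨p', hp'⟩, h1⟩ h3
    have e : MvPolynomial.map (inclAt τ t) (p' * X i) = p * X i := by rw [map_mul, hp', map_X]
    refine ⟨⟨_, e⟩, fun B hB x y hx hy => ?_⟩
    obtain ⟨a1, a2⟩ := h1 B hB x y hx hy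
    obtain ⟨b1, -⟩ := h1 B hB y y hy hy
    rw [← hp', specialize_map] at a1 a2 b1
    rw [← e, specialize_map, map_mul, map_mul, map_mul, map_X, eval_X, eval_X]
    have hTB : 2 ≤ ‖t‖ * B := by nlinarith
    have hBT : B ≤ ‖t‖ * B := by nlinarith
    have hxi : ‖x i‖ ≤ B := (norm_le_pi_norm x i).trans hx
    have hxy : ‖x i - y i‖ ≤ ‖x - y‖ := norm_le_pi_norm (x - y) i
    set M := ‖t‖ * B with hM
    have hMA : 0 ≤ M ^ A := by positivity
    constructor
    · rw [norm_mul]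
      calc _ ≤ M ^ A * M := by gcongr; linarith
        _ ≤ M ^ A * M * M := le_mul_of_one_le_right (by positivity) (by linarith)
        _ = _ := by ring
    · have e2 : ∀ a b u v : ℂ, a * u - b * v = (a - b) * u + b * (u - v) := by intros; ring
      rw [e2]
      refine (norm_add_le _ _).trans ?_
      rw [norm_mul, norm_mul]
      calc _ ≤ (M ^ A * ‖x - y‖) * M + M ^ A * ‖x - y‖ := by
            gcongr; linarith
        _ = (M ^ A * ‖x - y‖) * (M + 1) := by ring
        _ ≤ (M ^ A * ‖x - y‖) * (M * M) := by gcongr; nlinarith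
        _ = _ := by ring

end Growth

end FormPushforward

namespace FormPushforward

open MvPolynomial Filter Bornology MeasureTheory

/-! ### Backward orbits and points avoiding small values -/

section Dynamics

variable {n d : ℕ} {G : (Fin n → ℂ) → (Fin n → ℂ)} {T : ℝ} {A : ℕ}

/-- If `‖G y‖ ≤ T^A r`, then `‖y‖^d ≤ (T^A)^2 r ≤ (T^A r)^2`, and `d ≥ 2` gives back `‖y‖ ≤ T^A r`.
The bound reproduces itself, hence does not depend on `k`. -/
theorem norm_iterate_le (hd : 2 ≤ d) (hT : 1 ≤ T) (hG : ∀ y, ‖y‖ ^ d ≤ T ^ A * ‖G y‖) {r : ℝ}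
    (hr : 1 ≤ r) {k : ℕ} {y : Fin n → ℂ} (hy : ‖G^[k] y‖ ≤ r) : ∀ i ≤ k, ‖G^[i] y‖ ≤ T ^ A * r := by
  have hTA : 1 ≤ T ^ A := one_le_pow₀ hT
  induction k generalizing y with
  | zero =>
    intro i hi
    obtain rfl : i = 0 := by omega
    exact hy.trans (le_mul_of_one_le_left (by linarith) hTA)
  | succ k ih =>
    have h1 := ih (y := G y) hy
    intro i hi
    cases i with
    | succ i => exact h1 i (by omega)
    | zero =>
      have h2 := h1 0 (by omega)
      simp only [Function.iterate_zero, id] at h2 ⊢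
      by_contra! hlt
      have h3 : 1 ≤ T ^ A * r := by nlinarith
      have h4 : (T ^ A * r) ^ 2 ≤ (T ^ A * r) ^ d := pow_le_pow_right₀ h3 hd
      have h5 : (T ^ A * r) ^ d < ‖y‖ ^ d := pow_lt_pow_left₀ hlt (by linarith) (by omega)
      have h6 := hG y
      have h7 : T ^ A * ‖G y‖ ≤ T ^ A * (T ^ A * r) := by gcongr
      nlinarith

/-- The `k`-fold image of the set where `f` is below `‖c‖ * η ^ e` is too small to cover the unit
ball, so some `x` has no controlled backward orbit starting there, and all its backward orbits are
controlled. -/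
theorem exists_forall_iterate_eq_le_norm (hd : 2 ≤ d) (hT : 2 ≤ T)
    (hG : ∀ y, ‖y‖ ^ d ≤ T ^ A * ‖G y‖)
    (hLip : ∀ B : ℝ, 1 ≤ B → ∀ x y : Fin n → ℂ, ‖x‖ ≤ B → ‖y‖ ≤ B →
      ‖G x - G y‖ ≤ (T * B) ^ A * ‖x - y‖)
    {f : (Fin n → ℂ) → ℂ} (hf : Continuous f) {v : Fin n → ℂ} {c : ℂ} {e b : ℕ}
    (hroots : ∀ y, ∃ l : Multiset ℂ, l.card = e ∧
      ∀ z : ℂ, f (y + z • v) = c * (l.map fun a => z - a).prod)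
    (hc : 1 ≤ T ^ A * ‖c‖) (hv : ‖v‖ ≤ 2 ^ b) (he : e < 2 ^ b) (k : ℕ) :
    ∃ x : Fin n → ℂ, ‖x‖ ≤ 1 ∧ ∀ y, G^[k] y = x →
      1 ≤ T ^ ((A + e * ((A + 1) * A * (2 * n) + b + (A + b + 1) * (2 * n))) * (k + 1)) * ‖f y‖ := by
  -- The three summands dominate the volume expansion per step, the degree `e`, and the volume of
  -- the enlarged ball.
  set s := (A + 1) * A * (2 * n) + b + (A + b + 1) * (2 * n) with hs
  have hT1 : 1 ≤ T := by linarith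
  have hT0 : 0 < T := by linarith
  set η : ℝ := (T ^ (s * (k + 1)))⁻¹ with hη
  have hη0 : 0 < η := by positivity
  set B : ℝ := T ^ A with hB
  have hB1 : 1 ≤ B := one_le_pow₀ hT1
  set Λ : NNReal := ⟨(T * B) ^ A, by positivity⟩ with hΛ
  have hLipOn : LipschitzOnWith Λ G (Metric.closedBall 0 B) := by
    refine LipschitzOnWith.of_dist_le_mul fun x hx y hy => ?_
    rw [dist_eq_norm, dist_eq_norm]
    exact hLip B hB1 x y (by simpa using hx) (by simpa using hy)
  set E := Metric.closedBall (0 : Fin n → ℂ) B ∩ {y | ‖f y‖ < ‖c‖ * η ^ e} with hE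
  have hvol := volume_sublevel_le hf hroots (B := B) hη0.le
  have hfin : Module.finrank ℝ (Fin n → ℂ) = 2 * n := by
    rw [Module.finrank_pi_fintype]; simp [mul_comm]
  rw [Measure.addHaar_closedBall' (volume : Measure ℂ) 0 hη0.le,
    Measure.addHaar_closedBall' (volume : Measure (Fin n → ℂ)) 0 (by positivity),
    Complex.finrank_real_complex, hfin] at hvol
  have h1ne : volume (Metric.closedBall (0 : ℂ) 1) ≠ 0 :=
    (Metric.measure_closedBall_pos volume _ one_pos).ne'
  have h1top : volume (Metric.closedBall (0 : ℂ) 1) ≠ ⊤ := measure_closedBall_lt_top.ne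
  have hnne : volume (Metric.closedBall (0 : Fin n → ℂ) 1) ≠ 0 :=
    (Metric.measure_closedBall_pos volume _ one_pos).ne'
  have hntop : volume (Metric.closedBall (0 : Fin n → ℂ) 1) ≠ ⊤ := measure_closedBall_lt_top.ne
  have hvolE : volume E ≤ ENNReal.ofReal (e * η ^ 2 * (B + ‖v‖) ^ (2 * n)) *
      volume (Metric.closedBall (0 : Fin n → ℂ) 1) := by
    rw [← ENNReal.mul_le_mul_iff_right h1ne h1top]
    refine hvol.trans (le_of_eq ?_)
    rw [ENNReal.ofReal_mul (by positivity), ENNReal.ofReal_mul (by positivity),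
      ENNReal.ofReal_natCast]
    ring
  have hsmall : ((Λ : ENNReal) ^ (2 * n)) ^ k * volume E <
      volume (Metric.closedBall (0 : Fin n → ℂ) 1) := by
    have hΛ' : (Λ : ENNReal) = ENNReal.ofReal ((T * B) ^ A) := by
      rw [ENNReal.ofReal, Real.toNNReal_of_nonneg (by positivity)]
      rfl
    have hreal : (((T * B) ^ A) ^ (2 * n)) ^ k * (e * η ^ 2 * (B + ‖v‖) ^ (2 * n)) < 1 := by
      have e1 : (((T * B) ^ A) ^ (2 * n)) ^ k = T ^ ((A + 1) * A * (2 * n) * k) := by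
        rw [hB, ← pow_succ', ← pow_mul, ← pow_mul, ← pow_mul]
        congr 1
        ring
      have e2 : B + ‖v‖ ≤ T ^ (A + b + 1) := by
        have h1 : B ≤ T ^ (A + b) := pow_le_pow_right₀ hT1 (by omega)
        have h2 : ‖v‖ ≤ T ^ (A + b) :=
          hv.trans ((pow_le_pow_left₀ (by norm_num) hT b).trans (pow_le_pow_right₀ hT1 (by omega)))
        rw [pow_succ]
        have : 0 < T ^ (A + b) := by positivity
        nlinarith
      have e3 : (e : ℝ) < T ^ b :=
        lt_of_lt_of_le (by exact_mod_cast he) (pow_le_pow_left₀ (by norm_num) hT b)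
      have e4 : (B + ‖v‖) ^ (2 * n) ≤ T ^ ((A + b + 1) * (2 * n)) := by
        rw [pow_mul T (A + b + 1) (2 * n)]; exact pow_le_pow_left₀ (by positivity) e2 _
      have hBv : 0 < (B + ‖v‖) ^ (2 * n) := by positivity
      calc (((T * B) ^ A) ^ (2 * n)) ^ k * (e * η ^ 2 * (B + ‖v‖) ^ (2 * n))
          < T ^ ((A + 1) * A * (2 * n) * k) * (T ^ b * η ^ 2 * T ^ ((A + b + 1) * (2 * n))) := by
            rw [e1]
            refine mul_lt_mul_of_pos_left ?_ (by positivity)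
            exact mul_lt_mul (mul_lt_mul_of_pos_right e3 (by positivity)) e4 hBv (by positivity)
        _ = T ^ ((A + 1) * A * (2 * n) * k + b + (A + b + 1) * (2 * n)) * η ^ 2 := by ring
        _ ≤ T ^ (s * (k + 1) * 2) * η ^ 2 := by
            refine mul_le_mul_of_nonneg_right (pow_le_pow_right₀ hT1 ?_) (by positivity)
            rw [hs]
            nlinarith [Nat.zero_le ((A + 1) * A * (2 * n)), Nat.zero_le b,
              Nat.zero_le ((A + b + 1) * (2 * n)), Nat.zero_le k,
              Nat.zero_le (b * k), Nat.zero_le ((A + b + 1) * (2 * n) * k),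
              Nat.zero_le ((A + 1) * A * (2 * n) * k)]
        _ = 1 := by
            rw [hη, pow_mul, ← mul_pow, mul_inv_cancel₀ (by positivity), one_pow]
    calc ((Λ : ENNReal) ^ (2 * n)) ^ k * volume E
        ≤ ((Λ : ENNReal) ^ (2 * n)) ^ k * (ENNReal.ofReal (e * η ^ 2 * (B + ‖v‖) ^ (2 * n)) *
          volume (Metric.closedBall (0 : Fin n → ℂ) 1)) := by gcongr
      _ = ENNReal.ofReal ((((T * B) ^ A) ^ (2 * n)) ^ k *
            (e * η ^ 2 * (B + ‖v‖) ^ (2 * n))) *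
          volume (Metric.closedBall (0 : Fin n → ℂ) 1) := by
          rw [ENNReal.ofReal_mul (p := (((T * B) ^ A) ^ (2 * n)) ^ k) (by positivity),
            ENNReal.ofReal_pow (p := ((T * B) ^ A) ^ (2 * n)) (by positivity),
            ENNReal.ofReal_pow (p := (T * B) ^ A) (by positivity), ← hΛ']
          ring
      _ < 1 * volume (Metric.closedBall (0 : Fin n → ℂ) 1) := by
          refine ENNReal.mul_lt_mul_left hnne hntop ?_
          rwa [← ENNReal.ofReal_one, ENNReal.ofReal_lt_ofReal_iff one_pos]
      _ = _ := one_mul _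
  obtain ⟨x, hx, hxy⟩ := exists_mem_closedBall_of_volume_lt hLipOn hsmall
  refine ⟨x, by simpa using hx, fun y hy => ?_⟩
  have hball : ∀ i ≤ k, G^[i] y ∈ Metric.closedBall 0 B := fun i hi => by
    have := norm_iterate_le hd hT1 hG le_rfl (y := y) (by rw [hy]; simpa using hx) i hi
    simpa using this
  have hyE := hxy y hy hball
  have hlow : ‖c‖ * η ^ e ≤ ‖f y‖ := by
    by_contra! hlt
    exact hyE ⟨hball 0 (Nat.zero_le _), hlt⟩
  calc (1 : ℝ) ≤ T ^ A * ‖c‖ := hc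
    _ = T ^ A * ‖c‖ * (T ^ (s * (k + 1)) * η) ^ e := by
        rw [hη, mul_inv_cancel₀ (by positivity), one_pow, mul_one]
    _ = T ^ (A + s * (k + 1) * e) * (‖c‖ * η ^ e) := by
        rw [mul_pow, pow_add, pow_mul T (s * (k + 1)) e]; ring
    _ ≤ T ^ ((A + e * s) * (k + 1)) * ‖f y‖ := by
        refine mul_le_mul (pow_le_pow_right₀ hT1 ?_) hlow (by positivity) (by positivity)
        nlinarith [Nat.zero_le (A * k)]

end Dynamics

end FormPushforward

namespace FormPushforward

open MvPolynomial Filter Bornology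

/-! ### Uniform estimates for specialized forms -/

section Specialization

variable {K : Type*} [Field K] (τ : K →+* ℂ) {N d : ℕ}
  {F : Fin (N + 1) → MvPolynomial (Fin (N + 1)) (RatFunc K)}

theorem specialize_X_pow (t : ℂ) (i : Fin (N + 1)) (M : ℕ) :
    specialize τ t (X i ^ M : MvPolynomial (Fin (N + 1)) (RatFunc K)) = X i ^ M := by
  have : (X i ^ M : MvPolynomial (Fin (N + 1)) (RatFunc K)) =
      MvPolynomial.map (inclAt τ t) (X i ^ M) := by simp
  rw [this, specialize_map]
  simp

theorem specialize_sum_mul {t : ℂ} {ι : Type*} (s : Finset ι)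
    {P Q : ι → MvPolynomial (Fin (N + 1)) (RatFunc K)}
    (hP : ∀ i ∈ s, IsRegularAt τ t (P i)) (hQ : ∀ i ∈ s, IsRegularAt τ t (Q i)) :
    specialize τ t (∑ i ∈ s, P i * Q i) = ∑ i ∈ s, specialize τ t (P i) * specialize τ t (Q i) := by
  have : ∀ i : s, ∃ p q, MvPolynomial.map (inclAt τ t) p = P i ∧
      MvPolynomial.map (inclAt τ t) q = Q i := fun i => by
    obtain ⟨p, hp⟩ := hP i i.2
    obtain ⟨q, hq⟩ := hQ i i.2
    exact ⟨p, q, hp, hq⟩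
  choose p q hp hq using this
  rw [← Finset.sum_coe_sort s, ← Finset.sum_coe_sort s]
  simp only [← hp, ← hq, ← map_mul, ← map_sum, specialize_map]

theorem eval_eq_norm_pow_mul {P : MvPolynomial (Fin (N + 1)) ℂ} {e : ℕ} (hP : P.IsHomogeneous e)
    {y : Fin (N + 1) → ℂ} (hy : y ≠ 0) :
    ∃ u : Fin (N + 1) → ℂ, ‖u‖ = 1 ∧ eval y P = (‖y‖ : ℂ) ^ e * eval u P := by
  have hy' : (‖y‖ : ℂ) ≠ 0 := by simpa using hy
  refine ⟨(‖y‖ : ℂ)⁻¹ • y, ?_, ?_⟩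
  · rw [norm_smul, norm_inv, Complex.norm_real, norm_norm, inv_mul_cancel₀ (norm_ne_zero_iff.2 hy)]
  · rw [eval_eq', eval_eq', Finset.mul_sum]
    refine Finset.sum_congr rfl fun m hm => ?_
    have h1 : ∑ i, m i = e := by
      rw [← Finsupp.degree_eq_sum]
      exact (hP.degree_eq_sum_deg_support hm).symm
    simp only [Pi.smul_apply, smul_eq_mul, mul_pow, Finset.prod_mul_distrib]
    rw [Finset.prod_pow_eq_pow_sum, h1, inv_pow]
    field_simp

/-- A lower bound for the growth of a nondegenerate tuple of forms. -/
theorem exists_norm_pow_le (hd : 0 < d) (hF : ∀ i, (F i).IsHomogeneous d) (hF' : Nondegenerate F) :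
    ∃ A : ℕ, ∀ᶠ t in cobounded ℂ, ∀ y : Fin (N + 1) → ℂ,
      ‖y‖ ^ d ≤ ‖t‖ ^ A * ‖fun i => eval y (specialize τ t (F i))‖ := by
  obtain ⟨M, g, hdM, hM, hg, hX⟩ := exists_X_pow_eq_sum hF hF'
  choose A hA using fun i j => exists_growth_bound τ (g i j)
  set A' := ∑ i, ∑ j, A i j with hA'
  have hAA' : ∀ i j, A i j ≤ A' := fun i j =>
    (Finset.single_le_sum (f := fun j => A i j) (fun _ _ => Nat.zero_le _) (Finset.mem_univ j)).trans
      (Finset.single_le_sum (f := fun i => ∑ j, A i j) (fun _ _ => Nat.zero_le _)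
        (Finset.mem_univ i))
  have hbig : ∀ᶠ t in cobounded ℂ, 2 ≤ ‖t‖ := tendsto_norm_cobounded_atTop.eventually_ge_atTop 2
  have hreg : ∀ᶠ t in cobounded ℂ, ∀ i, IsRegularAt τ t (F i) :=
    eventually_all.2 fun i => eventually_isRegularAt τ _
  have hAt := eventually_all.2 fun i => eventually_all.2 fun j => hA i j
  refine ⟨N + 1 + A', ?_⟩
  filter_upwards [hbig, hreg, hAt] with t ht hreg hgt y
  rcases eq_or_ne y 0 with rfl | hy
  · rw [norm_zero, zero_pow hd.ne']; positivity
  set Gy : Fin (N + 1) → ℂ := fun i => eval y (specialize τ t (F i)) with hGy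
  have hy0 : 0 < ‖y‖ := norm_pos_iff.2 hy
  have ht1 : 1 ≤ ‖t‖ := by linarith
  -- Homogeneity reduces the bound to the unit sphere and produces the exact power `‖y‖ ^ (M - d)`,
  -- which cancels at the end.
  have hgb : ∀ i j, ‖eval y (specialize τ t (g i j))‖ ≤ ‖y‖ ^ (M - d) * ‖t‖ ^ A' := fun i j => by
    obtain ⟨u, hu, hyu⟩ := eval_eq_norm_pow_mul (isHomogeneous_specialize τ (t := t) (hg i j)) hy
    rw [hyu, norm_mul, norm_pow, Complex.norm_real, norm_norm]
    have h1 := ((hgt i j).2 1 le_rfl u u hu.le hu.le).1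
    rw [mul_one] at h1
    have h2 : ‖t‖ ^ A i j ≤ ‖t‖ ^ A' := pow_le_pow_right₀ ht1 (hAA' i j)
    gcongr
    exact h1.trans h2
  have hyi : ∀ i, ‖y i‖ ^ M ≤ (N + 1) * (‖y‖ ^ (M - d) * ‖t‖ ^ A' * ‖Gy‖) := fun i => by
    have h1 := congrArg (fun p => eval y (specialize τ t p)) (hX i)
    simp only [specialize_X_pow] at h1
    rw [specialize_sum_mul τ _ (fun j _ => (hgt i j).1) (fun j _ => hreg j)] at h1
    simp only [map_pow, eval_X, map_sum, map_mul] at h1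
    rw [← norm_pow, h1]
    refine (norm_sum_le _ _).trans ?_
    refine (Finset.sum_le_card_nsmul _ _ (‖y‖ ^ (M - d) * ‖t‖ ^ A' * ‖Gy‖) fun j _ => ?_).trans ?_
    · rw [norm_mul]
      have := hgb i j
      have h2 : ‖eval y (specialize τ t (F j))‖ ≤ ‖Gy‖ := norm_le_pi_norm Gy j
      gcongr
    · simp
  have hyM : ‖y‖ ^ M ≤ (N + 1) * (‖y‖ ^ (M - d) * ‖t‖ ^ A' * ‖Gy‖) := by
    by_contra! hlt
    obtain ⟨i, hi⟩ : ∃ i, ‖y‖ ≤ ‖y i‖ := by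
      by_contra! h
      exact lt_irrefl _ ((pi_norm_lt_iff hy0).2 h)
    exact absurd (hyi i) (not_le.2 (hlt.trans_le (pow_le_pow_left₀ hy0.le hi M)))
  have hN : ((N : ℝ) + 1) ≤ ‖t‖ ^ (N + 1) := by
    have : N + 1 ≤ 2 ^ (N + 1) := Nat.lt_two_pow_self.le
    calc ((N : ℝ) + 1) ≤ 2 ^ (N + 1) := by exact_mod_cast this
      _ ≤ ‖t‖ ^ (N + 1) := pow_le_pow_left₀ (by norm_num) ht _
  have h3 : ‖y‖ ^ (M - d) * ‖y‖ ^ d ≤ ‖y‖ ^ (M - d) * (‖t‖ ^ (N + 1 + A') * ‖Gy‖) := by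
    rw [← pow_add, Nat.sub_add_cancel hdM]
    refine hyM.trans ?_
    rw [pow_add]
    calc ((N : ℝ) + 1) * (‖y‖ ^ (M - d) * ‖t‖ ^ A' * ‖Gy‖)
        ≤ ‖t‖ ^ (N + 1) * (‖y‖ ^ (M - d) * ‖t‖ ^ A' * ‖Gy‖) := by gcongr
      _ = _ := by ring
  exact le_of_mul_le_mul_left h3 (by positivity)

theorem exists_lipschitz_bound :
    ∃ A : ℕ, ∀ᶠ t in cobounded ℂ, ∀ B : ℝ, 1 ≤ B → ∀ x y : Fin (N + 1) → ℂ, ‖x‖ ≤ B → ‖y‖ ≤ B →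
      ‖(fun i => eval x (specialize τ t (F i))) - fun i => eval y (specialize τ t (F i))‖ ≤
        (‖t‖ * B) ^ A * ‖x - y‖ := by
  choose A hA using fun i => exists_growth_bound τ (F i)
  have hAt := eventually_all.2 hA
  have hbig : ∀ᶠ t in cobounded ℂ, 2 ≤ ‖t‖ := tendsto_norm_cobounded_atTop.eventually_ge_atTop 2
  refine ⟨∑ i, A i, ?_⟩
  filter_upwards [hbig, hAt] with t ht h B hB x y hx hy
  have h1 : 1 ≤ ‖t‖ * B := by nlinarith
  refine (pi_norm_le_iff_of_nonneg (by positivity)).2 fun i => ?_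
  refine ((h i).2 B hB x y hx hy).2.trans ?_
  gcongr ?_ * _
  exact pow_le_pow_right₀ h1 <| Finset.single_le_sum (f := A) (fun _ _ => Nat.zero_le _) (Finset.mem_univ i)

/-- A nonzero polynomial does not vanish at some point, uniformly in the specialization. -/
theorem exists_eval_specialize_bound {P : MvPolynomial (Fin (N + 1)) (RatFunc K)} [CharZero K]
    (hP : P ≠ 0) : ∃ (v : Fin (N + 1) → ℂ) (A : ℕ), ∀ᶠ t in cobounded ℂ,
      1 ≤ ‖t‖ ^ A * ‖eval v (specialize τ t P)‖ := by
  have : CharZero (RatFunc K) := charZero_of_injective_algebraMap (R := K) (algebraMap K _).injective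
  -- A point with natural number coordinates is the same for all `t`, and the value of `P` there is
  -- a nonzero rational function of `s`.
  obtain ⟨v, hv⟩ : ∃ v : Fin (N + 1) → ℕ, eval (fun i => (v i : RatFunc K)) P ≠ 0 := by
    by_contra! h
    refine hP (MvPolynomial.funext_set (fun _ => Set.range ((↑) : ℕ → RatFunc K))
      (fun i => Set.infinite_range_of_injective Nat.cast_injective) fun x hx => ?_)
    choose v hv using fun i => hx i (Set.mem_univ i)
    rw [show x = fun i => (v i : RatFunc K) from funext fun i => (hv i).symm, h, map_zero]
  obtain ⟨A, hA⟩ := exists_pow_norm_ratFunc_bound τ hv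
  refine ⟨fun i => v i, A, ?_⟩
  filter_upwards [hA, eventually_isRegularAt τ P] with t ht ⟨Ψ, hΨ⟩
  have h1 : eval (fun i => (v i : ℂ)) (specialize τ t P) =
      ratEval τ t (eval (fun i => (v i : RatFunc K)) P) := by
    rw [← hΨ, specialize_map, eval_map, eval_map]
    have h2 : (fun i => (v i : ℂ)) = fun i => evalAt τ t (v i : regularAt τ t) := by
      ext i; simp
    have h3 : (fun i => (v i : RatFunc K)) = fun i => inclAt τ t (v i : regularAt τ t) := by
      ext i; simp
    rw [h2, h3]
    have h4 := eval₂_comp_left (evalAt τ t) (RingHom.id _) (fun i => (v i : regularAt τ t)) Ψ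
    have h5 := eval₂_comp_left (inclAt τ t) (RingHom.id _) (fun i => (v i : regularAt τ t)) Ψ
    simp only [RingHom.comp_id] at h4 h5
    exact h4.symm.trans ((evalAt_apply τ t _).trans (congrArg _ h5))
  rw [h1]
  exact ht.2

end Specialization

end FormPushforward

namespace FormPushforward

open MvPolynomial Filter Bornology

/-! ### Bounds for values and coefficients of iterated pushforwards -/

section Iterate

variable {K : Type*} [Field K] (τ : K →+* ℂ) {N d : ℕ}
  {F : Fin (N + 1) → MvPolynomial (Fin (N + 1)) (RatFunc K)}

/-- Bounds on the backward orbit of `x` propagate to the iterated pushforward. -/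
theorem eval_iterate_pushforward_mem {t : ℂ} {Φ : MvPolynomial (Fin (N + 1)) (RatFunc K)}
    {ι : Type*} [Fintype ι]
    (h : ∀ Ψ, IsRegularAt τ t Ψ → IsRegularAt τ t (pushforward F Ψ) ∧
        ∀ x : Fin (N + 1) → ℂ, ∃ θ : ι → Fin (N + 1) → ℂ,
          (∀ Y i, eval (θ Y) (specialize τ t (F i)) = x i) ∧
          eval x (specialize τ t (pushforward F Ψ)) = ∏ Y, eval (θ Y) (specialize τ t Ψ))
    (hΦ : IsRegularAt τ t Φ) (k : ℕ) : IsRegularAt τ t ((pushforward F)^[k] Φ) ∧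
      ∀ (x : Fin (N + 1) → ℂ) (a b : ℝ), 0 ≤ a →
        (∀ y, (fun y i => eval y (specialize τ t (F i)))^[k] y = x →
          a ≤ ‖eval y (specialize τ t Φ)‖ ∧ ‖eval y (specialize τ t Φ)‖ ≤ b) →
        a ^ Fintype.card ι ^ k ≤ ‖eval x (specialize τ t ((pushforward F)^[k] Φ))‖ ∧
          ‖eval x (specialize τ t ((pushforward F)^[k] Φ))‖ ≤ b ^ Fintype.card ι ^ k := by
  induction k with
  | zero => exact ⟨hΦ, fun x a b _ hx => by simpa using hx x rfl⟩
  | succ k ih =>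
    rw [Function.iterate_succ_apply']
    obtain ⟨h1, h2⟩ := h _ ih.1
    refine ⟨h1, fun x a b ha hx => ?_⟩
    obtain ⟨θ, hθ, hprod⟩ := h2 x
    have h3 : ∀ Y, _ := fun Y => ih.2 (θ Y) a b ha fun y hy => hx y (by
      rw [Function.iterate_succ_apply', hy]
      exact funext (hθ Y))
    rw [hprod, norm_prod, pow_succ, pow_mul, pow_mul]
    constructor
    · calc (a ^ Fintype.card ι ^ k) ^ Fintype.card ι
          = ∏ _Y : ι, a ^ Fintype.card ι ^ k := by rw [Finset.prod_const, Finset.card_univ]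
        _ ≤ _ := Finset.prod_le_prod (fun _ _ => by positivity) fun Y _ => (h3 Y).1
    · calc _ ≤ ∏ _Y : ι, b ^ Fintype.card ι ^ k :=
            Finset.prod_le_prod (fun _ _ => norm_nonneg _) fun Y _ => (h3 Y).2
        _ = _ := by rw [Finset.prod_const, Finset.card_univ]

theorem iterate_pushforward_specialize {t : ℂ} {Φ : MvPolynomial (Fin (N + 1)) (RatFunc K)}
    (h : ∀ Ψ, IsRegularAt τ t Ψ → IsRegularAt τ t (pushforward F Ψ) ∧
      pushforward (fun i => specialize τ t (F i)) (specialize τ t Ψ) =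
        specialize τ t (pushforward F Ψ))
    (hΦ : IsRegularAt τ t Φ) (k : ℕ) : IsRegularAt τ t ((pushforward F)^[k] Φ) ∧
      (pushforward fun i => specialize τ t (F i))^[k] (specialize τ t Φ) =
        specialize τ t ((pushforward F)^[k] Φ) := by
  induction k with
  | zero => exact ⟨hΦ, rfl⟩
  | succ k ih =>
    rw [Function.iterate_succ_apply', Function.iterate_succ_apply', ih.2]
    exact h _ ih.1

/-- Uniform bounds for the values of the specialized iterated pushforwards. -/
theorem exists_eval_iterate_bounds [CharZero K] {e : ℕ} (hd : 2 ≤ d)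
    (hF : ∀ i, (F i).IsHomogeneous d) (hF' : Nondegenerate F) (hS : (solutions F).Finite)
    {Φ : MvPolynomial (Fin (N + 1)) (RatFunc K)} (hΦ : Φ.IsHomogeneous e) (hΦ' : Φ ≠ 0) :
    ∃ A : ℕ, ∀ᶠ t in cobounded ℂ, ∀ k : ℕ,
      IsRegularAt τ t ((pushforward F)^[k] Φ) ∧
      (pushforward fun i => specialize τ t (F i))^[k] (specialize τ t Φ) =
        specialize τ t ((pushforward F)^[k] Φ) ∧
      (∀ (r : ℝ) (x : Fin (N + 1) → ℂ), 1 ≤ r → ‖x‖ ≤ r →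
        ‖eval x (specialize τ t ((pushforward F)^[k] Φ))‖ ≤
          (‖t‖ * r) ^ (A * hS.toFinset.card ^ k)) ∧
      ∃ x : Fin (N + 1) → ℂ, ‖x‖ ≤ 1 ∧
        1 ≤ ‖t‖ ^ (A * (k + 1) * hS.toFinset.card ^ k) *
          ‖eval x (specialize τ t ((pushforward F)^[k] Φ))‖ := by
  obtain ⟨A₁, h₁⟩ := exists_norm_pow_le τ (by omega : 0 < d) hF hF'
  obtain ⟨A₂, h₂⟩ := exists_lipschitz_bound τ (F := F)
  obtain ⟨v, A₃, h₃⟩ := exists_eval_specialize_bound τ hΦ'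
  obtain ⟨A₄, h₄⟩ := exists_growth_bound τ Φ
  -- Powers of `2` can later be replaced by powers of `‖t‖`.
  obtain ⟨b, hb⟩ : ∃ b : ℕ, ‖v‖ ≤ 2 ^ b ∧ e < 2 ^ b := by
    obtain ⟨b, hb⟩ := pow_unbounded_of_one_lt (max ‖v‖ e) (one_lt_two (α := ℝ))
    rw [max_lt_iff] at hb
    exact ⟨b, hb.1.le, by exact_mod_cast hb.2⟩
  set A := A₁ + A₂ + A₃ with hA
  set A₅ := A + e * ((A + 1) * A * (2 * (N + 1)) + b + (A + b + 1) * (2 * (N + 1))) with hA₅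
  have hbig : ∀ᶠ t in cobounded ℂ, 2 ≤ ‖t‖ := tendsto_norm_cobounded_atTop.eventually_ge_atTop 2
  refine ⟨A₅ + (A + 1) * A₄, ?_⟩
  filter_upwards [h₁, h₂, h₃, h₄, hbig, eventually_pushforward τ (by omega) hF hF' hS]
    with t h₁ h₂ h₃ h₄ ht h₅ k
  have ht1 : 1 ≤ ‖t‖ := by linarith
  set m := hS.toFinset.card with hm
  have hcard : Fintype.card hS.toFinset = m := Fintype.card_coe _
  set G : (Fin (N + 1) → ℂ) → Fin (N + 1) → ℂ := fun y i => eval y (specialize τ t (F i)) with hG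
  have hbounds := (eval_iterate_pushforward_mem τ (fun Ψ hΨ =>
    ⟨(h₅.2 Ψ hΨ).1, (h₅.2 Ψ hΨ).2.2⟩) h₄.1 k).2
  rw [hcard] at hbounds
  have hGexp : ∀ y, ‖y‖ ^ d ≤ ‖t‖ ^ A * ‖G y‖ := fun y =>
    (h₁ y).trans (mul_le_mul_of_nonneg_right (pow_le_pow_right₀ ht1 (by omega)) (norm_nonneg _))
  have hleaf : ∀ (r : ℝ) (x : Fin (N + 1) → ℂ), 1 ≤ r → ‖x‖ ≤ r → ∀ y, G^[k] y = x →
      ‖eval y (specialize τ t Φ)‖ ≤ (‖t‖ * (‖t‖ ^ A * r)) ^ A₄ := fun r x hr hx y hy => by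
    have h6 := norm_iterate_le hd ht1 hGexp hr (y := y) (k := k) (by rw [hy]; exact hx) 0 k.zero_le
    have h7 : 1 ≤ ‖t‖ ^ A * r := one_le_mul_of_one_le_of_one_le (one_le_pow₀ ht1) hr
    exact (h₄.2 _ h7 y y h6 h6).1
  have hreg := iterate_pushforward_specialize τ (fun Ψ hΨ => ⟨(h₅.2 Ψ hΨ).1, (h₅.2 Ψ hΨ).2.1⟩)
    h₄.1 k
  refine ⟨hreg.1, hreg.2, fun r x hr hx => ?_, ?_⟩
  · refine (hbounds x 0 _ le_rfl fun y hy => ⟨norm_nonneg _, hleaf r x hr hx y hy⟩).2.trans ?_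
    have h8 : ‖t‖ * (‖t‖ ^ A * r) ≤ (‖t‖ * r) ^ (A + 1) := by
      rw [mul_pow, ← mul_assoc, ← pow_succ']
      gcongr
      exact le_self_pow₀ hr (by omega)
    have h9 : 1 ≤ ‖t‖ * r := one_le_mul_of_one_le_of_one_le ht1 hr
    calc ((‖t‖ * (‖t‖ ^ A * r)) ^ A₄) ^ m ^ k ≤ (((‖t‖ * r) ^ (A + 1)) ^ A₄) ^ m ^ k := by gcongr
      _ = (‖t‖ * r) ^ ((A + 1) * A₄ * m ^ k) := by rw [← pow_mul, ← pow_mul, mul_assoc]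
      _ ≤ _ := pow_le_pow_right₀ h9 (Nat.mul_le_mul_right _ (by omega))
  · have hhom := isHomogeneous_specialize τ (t := t) hΦ
    have hvne : eval v (specialize τ t Φ) ≠ 0 := fun h0 => by
      rw [h0] at h₃; norm_num at h₃
    obtain ⟨x, hx, hxy⟩ := exists_forall_iterate_eq_le_norm (G := G) (A := A)
      (f := fun y => eval y (specialize τ t Φ)) (c := eval v (specialize τ t Φ)) hd ht hGexp
      (fun B hB x y hx hy => (h₂ B hB x y hx hy).trans (by
        gcongr ?_ * _
        exact pow_le_pow_right₀ (one_le_mul_of_one_le_of_one_le ht1 hB) (by omega)))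
      (continuous_eval _) (exists_roots_of_isHomogeneous hhom hvne)
      (h₃.trans (mul_le_mul_of_nonneg_right (pow_le_pow_right₀ ht1 (by omega)) (norm_nonneg _)))
      hb.1 hb.2 k
    refine ⟨x, hx, ?_⟩
    have hpos : 0 < ‖t‖ ^ (A₅ * (k + 1)) := by positivity
    have h6 := (hbounds x (‖t‖ ^ (A₅ * (k + 1)))⁻¹ _ (by positivity) fun y hy =>
      ⟨(inv_le_iff_one_le_mul₀' hpos).2 (hxy y hy), hleaf 1 x le_rfl hx y hy⟩).1
    rw [inv_pow, inv_le_iff_one_le_mul₀' (by positivity), ← pow_mul] at h6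
    refine h6.trans (mul_le_mul_of_nonneg_right (pow_le_pow_right₀ ht1 ?_) (norm_nonneg _))
    exact Nat.mul_le_mul_right _ (Nat.mul_le_mul_right _ (by omega))

theorem norm_coeff_le_coeffNorm (Ψ : MvPolynomial (Fin (N + 1)) ℂ) (μ : Fin (N + 1) →₀ ℕ) :
    ‖coeff μ Ψ‖ ≤ coeffNorm Ψ := by
  by_cases hμ : μ ∈ Ψ.support
  · exact_mod_cast Finset.le_sup (f := fun m => ‖coeff m Ψ‖₊) hμ
  · rw [notMem_support_iff.1 hμ, norm_zero]
    exact NNReal.coe_nonneg _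

theorem coeffNorm_le {Ψ : MvPolynomial (Fin (N + 1)) ℂ} {B : ℝ} (hB : 0 ≤ B)
    (h : ∀ μ, ‖coeff μ Ψ‖ ≤ B) : coeffNorm Ψ ≤ B := by
  lift B to NNReal using hB
  exact_mod_cast Finset.sup_le (f := fun m => ‖coeff m Ψ‖₊) fun μ _ => h μ

theorem norm_eval_le_mul_coeffNorm {Ψ : MvPolynomial (Fin (N + 1)) ℂ} {x : Fin (N + 1) → ℂ}
    (hx : ‖x‖ ≤ 1) : ‖eval x Ψ‖ ≤ (Ψ.totalDegree + 1) ^ (N + 1) * coeffNorm Ψ := by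
  rw [eval_eq']
  refine (norm_sum_le _ _).trans ((Finset.sum_le_card_nsmul _ _ (coeffNorm Ψ) fun μ _ => ?_).trans ?_)
  · rw [norm_mul, norm_prod]
    refine (mul_le_of_le_one_right (norm_nonneg _) ?_).trans (norm_coeff_le_coeffNorm _ _)
    refine Finset.prod_le_one (fun _ _ => norm_nonneg _) fun i _ => ?_
    rw [norm_pow]
    exact pow_le_one₀ (norm_nonneg _) ((norm_le_pi_norm x i).trans hx)
  · rw [nsmul_eq_mul]
    refine mul_le_mul_of_nonneg_right ?_ (NNReal.coe_nonneg _)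
    have : Ψ.support.card ≤ (Ψ.totalDegree + 1) ^ (N + 1) := by
      have h1 : Ψ.support.image (fun μ i => μ i) ⊆
          Fintype.piFinset fun _ : Fin (N + 1) => Finset.range (Ψ.totalDegree + 1) := by
        intro f hf
        obtain ⟨μ, hμ, rfl⟩ := Finset.mem_image.1 hf
        refine Fintype.mem_piFinset.2 fun i => Finset.mem_range.2 (Nat.lt_succ_of_le ?_)
        refine (le_trans ?_ (le_totalDegree hμ))
        rw [Finsupp.sum_fintype _ _ (by simp)]
        exact Finset.single_le_sum (f := fun i => μ i) (fun _ _ => Nat.zero_le _) (Finset.mem_univ i)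
      have h2 := Finset.card_le_card h1
      rwa [Finset.card_image_of_injective _ DFunLike.coe_injective, Fintype.card_piFinset_const,
        Finset.card_range] at h2
    exact_mod_cast this

/-- Uniform bounds for the coefficients of the specialized iterated pushforwards. -/
theorem exists_coeff_iterate_bounds [CharZero K] {e : ℕ} (hd : 2 ≤ d)
    (hF : ∀ i, (F i).IsHomogeneous d) (hF' : Nondegenerate F) (hS : (solutions F).Finite)
    {Φ : MvPolynomial (Fin (N + 1)) (RatFunc K)} (hΦ : Φ.IsHomogeneous e) (hΦ' : Φ ≠ 0) :
    ∃ A : ℕ, (∀ k, ((pushforward F)^[k] Φ).totalDegree ≤ A * hS.toFinset.card ^ k) ∧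
      ∀ᶠ t in cobounded ℂ, ∀ k : ℕ,
      IsRegularAt τ t ((pushforward F)^[k] Φ) ∧
      (pushforward fun i => specialize τ t (F i))^[k] (specialize τ t Φ) =
        specialize τ t ((pushforward F)^[k] Φ) ∧
      (∀ μ, ‖ratEval τ t (coeff μ ((pushforward F)^[k] Φ))‖ ≤
        ‖t‖ ^ (A * hS.toFinset.card ^ k)) ∧
      1 ≤ ‖t‖ ^ (A * (k + 1) * hS.toFinset.card ^ k) *
        coeffNorm (specialize τ t ((pushforward F)^[k] Φ)) := by
  obtain ⟨A, hA⟩ := exists_eval_iterate_bounds τ hd hF hF' hS hΦ hΦ'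
  set m := hS.toFinset.card with hm
  have hbig : ∀ᶠ t in cobounded ℂ, 2 ≤ ‖t‖ := tendsto_norm_cobounded_atTop.eventually_ge_atTop 2
  have hcoeff : ∀ᶠ t in cobounded ℂ, ∀ k : ℕ, ∀ r : ℝ, 1 ≤ r → ∀ μ,
      ‖ratEval τ t (coeff μ ((pushforward F)^[k] Φ))‖ * r ^ μ.degree ≤
        (‖t‖ * r) ^ (A * m ^ k) := by
    filter_upwards [hA] with t ht k r hr μ
    rw [← coeff_specialize]
    refine norm_coeff_mul_pow_degree_le _ (by linarith) (fun x hx => (ht k).2.2.1 r x hr ?_) μ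
    exact (pi_norm_le_iff_of_nonneg (by linarith)).2 fun i => (hx i).le
  have hdeg : ∀ k, ((pushforward F)^[k] Φ).totalDegree ≤ A * m ^ k := fun k => by
    refine Finset.sup_le fun μ hμ => ?_
    rw [Finsupp.sum_fintype _ _ (by simp), ← Finsupp.degree_eq_sum]
    by_contra! hlt
    obtain ⟨B, hB⟩ := exists_pow_norm_ratFunc_bound τ (mem_support_iff.1 hμ)
    obtain ⟨t, ht, hBt, h2⟩ := (hcoeff.and (hB.and hbig)).exists
    obtain ⟨hB1, hB2⟩ := hBt
    have ht0 : 0 < ‖t‖ := by linarith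
    set z := ‖ratEval τ t (coeff μ ((pushforward F)^[k] Φ))‖ with hz
    have hz0 : 0 < z := by
      by_contra! h
      nlinarith [pow_pos ht0 B]
    -- A monomial of too large degree would force `z * r ≤ ‖t‖ ^ (A * m ^ k)`; this radius violates
    -- that.
    set r : ℝ := ‖t‖ ^ (A * m ^ k) / z + 1 with hr
    have hr1 : 1 ≤ r := le_add_of_nonneg_left (by positivity)
    have h3 := ht k r hr1 μ
    have h4 : z * r ^ (A * m ^ k + 1) ≤ ‖t‖ ^ (A * m ^ k) * r ^ (A * m ^ k) := by
      rw [← mul_pow]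
      exact (mul_le_mul_of_nonneg_left (pow_le_pow_right₀ hr1 hlt) hz0.le).trans h3
    rw [pow_succ', ← mul_assoc] at h4
    have h5 := le_of_mul_le_mul_right h4 (by positivity)
    rw [hr, mul_add, mul_div_cancel₀ _ hz0.ne'] at h5
    linarith
  refine ⟨A + A * (N + 1), fun k => (hdeg k).trans (Nat.mul_le_mul_right _ (by omega)), ?_⟩
  filter_upwards [hA, hcoeff, hbig] with t ht hc h2 k
  have ht1 : 1 ≤ ‖t‖ := by linarith
  refine ⟨(ht k).1, (ht k).2.1, fun μ => ?_, ?_⟩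
  · have := hc k 1 le_rfl μ
    rw [one_pow, mul_one, mul_one] at this
    exact this.trans (pow_le_pow_right₀ ht1 (Nat.mul_le_mul_right _ (by omega)))
  · obtain ⟨x, hx, hle⟩ := (ht k).2.2.2
    have h3 : (specialize τ t ((pushforward F)^[k] Φ)).totalDegree ≤ A * m ^ k := by
      refine le_trans ?_ (hdeg k)
      refine Finset.sup_mono fun μ hμ => ?_
      rw [mem_support_iff, coeff_specialize] at hμ
      rw [mem_support_iff]
      intro h0
      exact hμ (by rw [h0, ratEval_zero])
    set D := (specialize τ t ((pushforward F)^[k] Φ)).totalDegree with hD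
    -- The number of monomials is exponential in `m ^ k` at worst, hence also a power of `‖t‖` of
    -- admissible exponent.
    have h4 : ((D : ℝ) + 1) ^ (N + 1) ≤ ‖t‖ ^ (A * m ^ k * (N + 1)) := by
      rw [pow_mul]
      refine pow_le_pow_left₀ (by positivity) ?_ _
      calc (D : ℝ) + 1 ≤ 2 ^ (A * m ^ k) := by
            have : D + 1 ≤ 2 ^ (A * m ^ k) :=
              (Nat.succ_le_succ h3).trans (Nat.succ_le_of_lt Nat.lt_two_pow_self)
            exact_mod_cast this
        _ ≤ _ := pow_le_pow_left₀ (by norm_num) h2 _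
    have h5 : 0 ≤ coeffNorm (specialize τ t ((pushforward F)^[k] Φ)) := NNReal.coe_nonneg _
    calc (1 : ℝ) ≤ _ := hle
      _ ≤ ‖t‖ ^ (A * (k + 1) * m ^ k) * (‖t‖ ^ (A * m ^ k * (N + 1)) *
          coeffNorm (specialize τ t ((pushforward F)^[k] Φ))) := by
        gcongr
        exact (norm_eval_le_mul_coeffNorm hx).trans (mul_le_mul_of_nonneg_right h4 h5)
      _ = ‖t‖ ^ (A * (k + 1) * m ^ k + A * m ^ k * (N + 1)) *
          coeffNorm (specialize τ t ((pushforward F)^[k] Φ)) := by rw [pow_add]; ring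
      _ ≤ _ := by
        refine mul_le_mul_of_nonneg_right (pow_le_pow_right₀ ht1 ?_) h5
        have : A * m ^ k * (N + 1) ≤ A * m ^ k * (N + 1) * (k + 1) :=
          Nat.le_mul_of_pos_right _ k.succ_pos
        calc _ ≤ A * (k + 1) * m ^ k + A * m ^ k * (N + 1) * (k + 1) := by omega
          _ = _ := by ring

end Iterate

end FormPushforward

namespace FormPushforward

open MvPolynomial

/-! ### Denominators of iterated pushforwards -/

section Denominators

variable {k A : Type*} [Field k] [CommRing A] {N d : ℕ} (j : A →+* k)
  {F : Fin (N + 1) → MvPolynomial (Fin (N + 1)) k}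

theorem toGenericClosure_C (D : A) :
    toGenericClosure N j (C D) = algebraMap k (GenericClosure k N) (j D) := by
  simp [toGenericClosure, IsScalarTower.algebraMap_apply k (MvPolynomial (Fin (N + 1)) k)
    (GenericClosure k N)]

/-- A monomial of degree at most `E` uses at most `E` factors `D` to make its coordinates integral;
the remaining factors are harmless. -/
theorem isIntegralElem_aeval_C_pow_mul {D : A} {Y : Fin (N + 1) → GenericClosure k N}
    (hY : ∀ i, (toGenericClosure N j).IsIntegralElem (toGenericClosure N j (C D) * Y i))
    {Q : MvPolynomial (Fin (N + 1)) A} {E : ℕ} (hQ : (map j Q).totalDegree ≤ E) :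
    (toGenericClosure N j).IsIntegralElem (aeval Y (C (j D ^ E) * map j Q)) := by
  have h : aeval Y (C (j D ^ E) * map j Q) = ∑ m ∈ (map j Q).support,
      toGenericClosure N j (C (coeff m Q) * C D ^ (E - m.degree)) *
        ∏ i, (toGenericClosure N j (C D) * Y i) ^ m i := by
    conv_lhs => rw [map_mul, (map j Q).as_sum, map_sum, Finset.mul_sum, aeval_C, map_pow]
    refine Finset.sum_congr rfl fun m hm => ?_
    have h1 : m.degree ≤ E := by
      refine le_trans ?_ ((le_totalDegree hm).trans hQ)
      rw [Finsupp.degree_eq_sum, Finsupp.sum_fintype _ _ (by simp)]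
    simp only [mul_pow, Finset.prod_mul_distrib, map_mul, map_pow, toGenericClosure_C]
    rw [Finset.prod_pow_eq_pow_sum, ← Finsupp.degree_eq_sum, aeval_monomial,
      Finsupp.prod_fintype _ _ (by simp), coeff_map]
    obtain ⟨l, rfl⟩ := Nat.exists_eq_add_of_le h1
    rw [Nat.add_sub_cancel_left, pow_add]
    ring
  rw [h]
  refine isIntegralElem_sum _ _ fun m _ => ?_
  refine RingHom.IsIntegralElem.mul _ (RingHom.isIntegralElem_map _) ?_
  refine isIntegralElem_prod _ _ fun i _ => ?_
  algebraize [toGenericClosure N j]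
  exact IsIntegral.pow (R := MvPolynomial (Fin (N + 1)) A) (hY i) _

variable [IsDomain A]

theorem exists_common_denominator (hden : ∀ c : k, ∃ D : A, D ≠ 0 ∧ j D * c ∈ j.range)
    {ι : Type*} (s : Finset ι) (c : ι → k) :
    ∃ D : A, D ≠ 0 ∧ ∀ i ∈ s, j D * c i ∈ j.range := by
  classical
  choose D hD hDc using fun i => hden (c i)
  refine ⟨∏ i ∈ s, D i, Finset.prod_ne_zero_iff.2 fun i _ => hD i, fun i hi => ?_⟩
  rw [← Finset.prod_erase_mul s D hi, map_mul, mul_assoc]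
  exact mul_mem ⟨_, rfl⟩ (hDc i)

theorem exists_map_eq_C_mul (hden : ∀ c : k, ∃ D : A, D ≠ 0 ∧ j D * c ∈ j.range)
    (P : MvPolynomial (Fin (N + 1)) k) :
    ∃ D : A, D ≠ 0 ∧ ∃ Q : MvPolynomial (Fin (N + 1)) A, map j Q = C (j D) * P := by
  obtain ⟨D, hD, h⟩ := exists_common_denominator j hden P.support fun m => coeff m P
  refine ⟨D, hD, ?_⟩
  have : C (j D) * P ∈ Set.range (map j) := by
    rw [mem_range_map_iff_coeffs_subset]
    intro c hc
    obtain ⟨m, hm, rfl⟩ := mem_coeffs_iff.1 hc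
    rw [coeff_C_mul]
    by_cases hm' : m ∈ P.support
    · exact h m hm'
    · rw [notMem_support_iff.1 hm', mul_zero]
      exact ⟨0, map_zero _⟩
  exact this

theorem exists_isIntegralElem_mul (hden : ∀ c : k, ∃ D : A, D ≠ 0 ∧ j D * c ∈ j.range)
    {z : GenericClosure k N} (hz : (toGenericClosure N (RingHom.id k)).IsIntegralElem z) :
    ∃ D : A, D ≠ 0 ∧ (toGenericClosure N j).IsIntegralElem (toGenericClosure N j (C D) * z) := by
  obtain ⟨p, hp, hpz⟩ := hz
  rw [toGenericClosure_id] at hpz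
  choose D hD Q hQ using fun i : ℕ => exists_map_eq_C_mul j hden (p.coeff i)
  set E := ∏ i ∈ p.support, D i with hE
  refine ⟨E, Finset.prod_ne_zero_iff.2 fun i _ => hD i, ?_⟩
  have hl : p.scaleRoots (C (j E)) ∈ Polynomial.lifts (map j : MvPolynomial (Fin (N + 1)) A →+* _) := by
    rw [Polynomial.lifts_iff_coeff_lifts]
    intro i
    rw [Polynomial.coeff_scaleRoots]
    by_cases hi : i ∈ p.support
    · rcases (Polynomial.le_natDegree_of_mem_supp i hi).eq_or_lt with h | h
      · rw [h, hp.coeff_natDegree, Nat.sub_self, pow_zero, mul_one]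
        exact ⟨1, map_one _⟩
      -- Scaling the roots by `E` multiplies a coefficient below the leading one by a positive power
      -- of `E`, and one factor `E` already clears its denominator.
      · obtain ⟨l, hl⟩ := Nat.exists_eq_add_of_lt h
        refine ⟨Q i * C (∏ i ∈ p.support.erase i, D i) * C E ^ l, ?_⟩
        rw [hl, show i + l + 1 - i = l + 1 by omega, pow_succ']
        have : j E = j (D i) * j (∏ i ∈ p.support.erase i, D i) := by
          rw [hE, ← Finset.mul_prod_erase _ _ hi, map_mul]
        simp only [map_mul, map_pow, hQ, map_C, this]
        ring
    · rw [Polynomial.notMem_support_iff.1 hi, zero_mul]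
      exact ⟨0, map_zero _⟩
  obtain ⟨q, hq, -, hqm⟩ := Polynomial.lifts_and_natDegree_eq_and_monic hl
    ((Polynomial.monic_scaleRoots_iff _).2 hp)
  refine ⟨q, hqm, ?_⟩
  have h1 := Polynomial.scaleRoots_eval₂_eq_zero (algebraMap _ (GenericClosure k N))
    (s := C (j E)) hpz
  rw [← hq, Polynomial.eval₂_map] at h1
  have h2 : toGenericClosure N j (C E) = algebraMap (MvPolynomial (Fin (N + 1)) k)
      (GenericClosure k N) (C (j E)) := by
    simp [toGenericClosure]
  rw [h2]
  exact h1

theorem exists_isIntegralElem_mul_solutions (hden : ∀ c : k, ∃ D : A, D ≠ 0 ∧ j D * c ∈ j.range)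
    (hd : 0 < d) (hF : ∀ i, (F i).IsHomogeneous d) (hF' : Nondegenerate F)
    (hS : (solutions F).Finite) : ∃ D : A, D ≠ 0 ∧ ∀ Y ∈ solutions F, ∀ i,
      (toGenericClosure N j).IsIntegralElem (toGenericClosure N j (C D) * Y i) := by
  classical
  choose D hD h using fun (p : hS.toFinset × Fin (N + 1)) =>
    exists_isIntegralElem_mul j hden
      (isIntegralElem_of_mem_solutions hd hF hF' (hS.mem_toFinset.1 p.1.2) p.2)
  refine ⟨∏ p, D p, Finset.prod_ne_zero_iff.2 fun p _ => hD p, fun Y hY i => ?_⟩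
  set p : hS.toFinset × Fin (N + 1) := (⟨Y, hS.mem_toFinset.2 hY⟩, i)
  rw [← Finset.prod_erase_mul _ D (Finset.mem_univ p), C_mul, map_mul, mul_assoc]
  exact RingHom.IsIntegralElem.mul _ (RingHom.isIntegralElem_map _) (h p)

theorem pushforward_C_mul [CharZero k] (hd : 0 < d) (hF : ∀ i, (F i).IsHomogeneous d)
    (hF' : Nondegenerate F) (hS : (solutions F).Finite) (c : k)
    (Ψ : MvPolynomial (Fin (N + 1)) k) :
    pushforward F (C c * Ψ) = C (c ^ hS.toFinset.card) * pushforward F Ψ := by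
  apply algebraMap_genericClosure_injective
  rw [map_mul, algebraMap_pushforward hd hF hF' hS, algebraMap_pushforward hd hF hF' hS]
  simp only [map_mul, aeval_C, Finset.prod_mul_distrib, Finset.prod_const]
  rw [map_pow, map_pow, IsScalarTower.algebraMap_apply k (MvPolynomial (Fin (N + 1)) k)
    (GenericClosure k N)]
  rfl

/-- The denominators of the iterated pushforwards divide a slowly growing power of a fixed
element. -/
theorem exists_map_eq_C_pow_mul_iterate [CharZero k]
    (hj : ∀ c : k, j.IsIntegralElem c → c ∈ j.range)
    (hden : ∀ c : k, ∃ D : A, D ≠ 0 ∧ j D * c ∈ j.range)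
    (hd : 0 < d) (hF : ∀ i, (F i).IsHomogeneous d) (hF' : Nondegenerate F)
    (hS : (solutions F).Finite) {Φ : MvPolynomial (Fin (N + 1)) k} {B : ℕ} (hB : 0 < B)
    (hdeg : ∀ n, ((pushforward F)^[n] Φ).totalDegree ≤ B * hS.toFinset.card ^ n) :
    ∃ D : A, D ≠ 0 ∧ ∀ n, ∃ Q : MvPolynomial (Fin (N + 1)) A,
      map j Q = C (j D ^ (B * (n + 1) * hS.toFinset.card ^ n)) * (pushforward F)^[n] Φ := by
  obtain ⟨D₁, hD₁, h₁⟩ := exists_isIntegralElem_mul_solutions j hden hd hF hF' hS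
  obtain ⟨D₂, hD₂, Q₂, hQ₂⟩ := exists_map_eq_C_mul j hden Φ
  set m := hS.toFinset.card with hm
  refine ⟨D₁ * D₂, mul_ne_zero hD₁ hD₂, fun n => ?_⟩
  induction n with
  | zero =>
    -- A factor `D₂` must be available to clear the denominators of `Φ`; this is why `B` has to be
    -- positive.
    obtain ⟨b, rfl⟩ : ∃ b, B = b + 1 := ⟨B - 1, by omega⟩
    refine ⟨C (D₁ * (D₁ * D₂) ^ b) * Q₂, ?_⟩
    simp only [map_mul, map_C, hQ₂, map_pow, zero_add, mul_one, pow_zero, Function.iterate_zero,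
      id_eq]
    ring
  | succ n ih =>
    obtain ⟨Q, hQ⟩ := ih
    have hY : ∀ Y ∈ solutions F, ∀ i, (toGenericClosure N j).IsIntegralElem
        (toGenericClosure N j (C (D₁ * D₂)) * Y i) := fun Y hY i => by
      rw [C_mul, map_mul, mul_comm (toGenericClosure N j (C D₁)), mul_assoc]
      exact RingHom.IsIntegralElem.mul _ (RingHom.isIntegralElem_map _) (h₁ Y hY i)
    have hQdeg : (map j Q).totalDegree ≤ B * m ^ n := by
      rw [hQ]
      refine (totalDegree_mul _ _).trans ?_
      rw [totalDegree_C, zero_add]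
      exact hdeg n
    obtain ⟨Q', hQ'⟩ := exists_map_eq_pushforward j hS hj fun Y hYS =>
      isIntegralElem_aeval_C_pow_mul j (hY Y hYS) hQdeg
    refine ⟨Q', ?_⟩
    -- One step adds `B * m ^ n` to the exponent to make the values integral, and the product over
    -- the fibre multiplies it by `m`: `(B(n+1)m^n + B m^n) m = B(n+2)m^(n+1)`.
    rw [hQ', hQ, ← mul_assoc, ← C_mul, ← pow_add, pushforward_C_mul hd hF hF' hS, ← hm, ← pow_mul,
      Function.iterate_succ_apply']
    congr 3
    ring

end Denominators

/-! ### The ring `A[s]` inside `K(s)` -/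

section Polynomial

open Polynomial in
/-- The inclusion of `A[s]` in `K(s)`. -/
noncomputable def polynomialToRatFunc (A K : Type*) [CommRing A] [Field K] [Algebra A K] :
    A[X] →+* RatFunc K :=
  (algebraMap K[X] (RatFunc K)).comp (Polynomial.mapRingHom (algebraMap A K))

variable {A K : Type*} [CommRing A] [Field K] [Algebra A K] [IsFractionRing A K]

/-- An element integral over `A[s]` is first a polynomial over `K`, and then has coefficients
integral over `A`. -/
theorem mem_range_polynomialToRatFunc [IsIntegrallyClosed A] (c : RatFunc K)
    (hc : (polynomialToRatFunc A K).IsIntegralElem c) : c ∈ (polynomialToRatFunc A K).range := by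
  obtain ⟨p, hp, hpc⟩ := hc
  have h1 : IsIntegral (Polynomial K) c := by
    refine ⟨p.map (Polynomial.mapRingHom (algebraMap A K)), hp.map _, ?_⟩
    rw [Polynomial.eval₂_map]
    exact hpc
  obtain ⟨q, rfl⟩ := IsIntegrallyClosed.isIntegral_iff.1 h1
  algebraize [Polynomial.mapRingHom (algebraMap A K)]
  have h2 : IsIntegral (Polynomial A) q := by
    refine ⟨p, hp, ?_⟩
    apply RatFunc.algebraMap_injective K
    rw [polynomialToRatFunc, ← Polynomial.hom_eval₂] at hpc
    rw [map_zero, ← hpc]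
    rfl
  rw [Polynomial.isIntegral_iff_isIntegral_coeff] at h2
  have h3 : q ∈ Polynomial.lifts (algebraMap A K) := by
    rw [Polynomial.lifts_iff_coeff_lifts]
    exact fun i => IsIntegrallyClosed.isIntegral_iff.1 (h2 i)
  obtain ⟨r, hr⟩ := (Polynomial.mem_lifts _).1 h3
  exact ⟨r, by rw [← hr]; rfl⟩

theorem exists_denominator_polynomialToRatFunc [IsDomain A] (c : RatFunc K) : ∃ D : Polynomial A, D ≠ 0 ∧
    polynomialToRatFunc A K D * c ∈ (polynomialToRatFunc A K).range := by
  have hinj : Function.Injective (algebraMap A K) := IsFractionRing.injective A K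
  have key : ∀ p : Polynomial K, ∃ b : A, b ≠ 0 ∧ ∃ q : Polynomial A,
      q.map (algebraMap A K) = Polynomial.C (algebraMap A K b) * p := fun p => by
    obtain ⟨b, hb0, hb⟩ := IsLocalization.integerNormalization_spec (nonZeroDivisors A) p
    refine ⟨b, nonZeroDivisors.ne_zero hb0, _, hb.trans ?_⟩
    rw [Algebra.smul_def]
    rfl
  obtain ⟨b₁, hb₁, q₁, hq₁⟩ := key c.num
  obtain ⟨b₂, hb₂, q₂, hq₂⟩ := key c.denom
  refine ⟨Polynomial.C b₁ * q₂, mul_ne_zero (Polynomial.C_ne_zero.2 hb₁) ?_, Polynomial.C b₂ * q₁, ?_⟩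
  · rintro rfl
    rw [Polynomial.map_zero] at hq₂
    exact mul_ne_zero (Polynomial.C_ne_zero.2 fun h => hb₂ (hinj (h.trans (map_zero _).symm)))
      c.denom_ne_zero hq₂.symm
  · have hc : algebraMap _ (RatFunc K) c.denom ≠ 0 := RatFunc.algebraMap_ne_zero c.denom_ne_zero
    conv_rhs => rw [← RatFunc.num_div_denom c]
    simp only [polynomialToRatFunc, RingHom.comp_apply, Polynomial.coe_mapRingHom,
      Polynomial.map_C, hq₁, hq₂, map_mul]
    field_simp

end Polynomial

end FormPushforward

namespace FormPushforward

open Polynomial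

/-! ### Polynomials over `𝓞 K` of controlled height -/

section Heights

/-- Cauchy estimates on circles of radius `r ≥ R`: large `r` bounds the degree, `r = R` the
coefficients. -/
theorem norm_coeff_le_of_norm_eval_le {p : ℂ[X]} {R : ℝ} (hR : 1 ≤ R) {H : ℕ}
    (h : ∀ t : ℂ, R ≤ ‖t‖ → ‖p.eval t‖ ≤ ‖t‖ ^ H) : p.natDegree ≤ H ∧ ∀ i, ‖p.coeff i‖ ≤ R ^ H := by
  have key : ∀ r : ℝ, R ≤ r → ∀ i, ‖p.coeff i‖ * r ^ i ≤ r ^ H := fun r hr i =>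
    norm_coeff_mul_pow_le p (by linarith) (fun z hz => (h z (by rw [hz]; exact hr)).trans_eq
      (by rw [hz])) i
  constructor
  · rw [natDegree_le_iff_coeff_eq_zero]
    intro i hi
    by_contra h0
    have hpos : 0 < ‖p.coeff i‖ := norm_pos_iff.2 h0
    set r := R + ‖p.coeff i‖⁻¹ with hr
    have hrR : R ≤ r := le_add_of_nonneg_right (by positivity)
    have hr1 : 1 ≤ r := hR.trans hrR
    have h1 : ‖p.coeff i‖ * r ^ (H + 1) ≤ r ^ H :=
      (mul_le_mul_of_nonneg_left (pow_le_pow_right₀ hr1 hi) hpos.le).trans (key r hrR i)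
    rw [pow_succ', ← mul_assoc] at h1
    have h2 : ‖p.coeff i‖ * r ≤ 1 :=
      le_of_mul_le_mul_right (by rwa [one_mul]) (by positivity : 0 < r ^ H)
    rw [hr, mul_add, mul_inv_cancel₀ hpos.ne'] at h2
    nlinarith
  · intro i
    have h1 := key R le_rfl i
    have h2 : 1 ≤ R ^ i := one_le_pow₀ hR
    nlinarith [norm_nonneg (p.coeff i)]

-- The norm of a nonzero algebraic integer is a nonzero integer, so one conjugate is small only if
-- another is large.
open NumberField in
theorem one_le_pow_mul_norm_embedding {K : Type*} [Field K] [NumberField K] {x : 𝓞 K} (hx : x ≠ 0)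
    {B : ℝ} (hB : 1 ≤ B) (h : ∀ τ : K →+* ℂ, ‖τ x‖ ≤ B) (σ : K →+* ℂ) :
    1 ≤ B ^ Fintype.card (K →+* ℂ) * ‖σ x‖ := by
  classical
  have h1 : (1 : ℝ) ≤ ∏ τ : K →+* ℂ, ‖τ x‖ := by
    have h2 := Algebra.norm_eq_prod_embeddings ℚ ℂ (x : K)
    have h3 : Algebra.norm ℤ x ≠ 0 := Algebra.norm_ne_zero_iff.2 hx
    have h4 : (∏ τ : K →+* ℂ, ‖τ x‖) = ∏ τ : K →ₐ[ℚ] ℂ, ‖τ x‖ :=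
      Fintype.prod_equiv (RingHom.equivRatAlgHom K ℂ) _ _ fun τ => rfl
    rw [h4, ← norm_prod, ← h2, ← Algebra.coe_norm_int]
    simp only [eq_ratCast, Rat.cast_intCast, Complex.norm_intCast]
    exact_mod_cast Int.one_le_abs h3
  rw [← Finset.prod_erase_mul _ _ (Finset.mem_univ σ)] at h1
  refine h1.trans (mul_le_mul_of_nonneg_right ?_ (norm_nonneg _))
  calc ∏ τ ∈ Finset.univ.erase σ, ‖τ x‖ ≤ ∏ _τ ∈ Finset.univ.erase σ, B :=
        Finset.prod_le_prod (fun _ _ => norm_nonneg _) fun τ _ => h τ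
    _ = B ^ (Finset.univ.erase σ).card := Finset.prod_const _
    _ ≤ _ := pow_le_pow_right₀ hB (Finset.card_le_univ _)

/-- The lower terms contribute at most `H * R ^ H * ‖t‖ ^ (D - 1)` for `D > 0`, the leading term at
least `R ^ (-g * H) * ‖t‖ ^ D`. As `H` and `2` are at most `R ^ H`, the exponent `(g + 3) * H` in
the threshold makes the leading term dominate by a factor `2`. -/
theorem norm_eval_bounds_of_large {p : ℂ[X]} {R : ℝ} (hR : 2 ≤ R) {H g : ℕ} (hH : 1 ≤ H)
    (hdeg : p.natDegree ≤ H) (hcoeff : ∀ i, ‖p.coeff i‖ ≤ R ^ H)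
    (hlead : 1 ≤ R ^ (g * H) * ‖p.leadingCoeff‖) {t : ℂ} (ht : R ^ ((g + 3) * H) ≤ ‖t‖) :
    ‖p.eval t‖ ≤ R ^ ((g + 3) * H) * ‖t‖ ^ p.natDegree ∧
      ‖t‖ ^ p.natDegree ≤ R ^ ((g + 3) * H) * ‖p.eval t‖ := by
  have hR1 : 1 ≤ R := by linarith
  have ht1 : 1 ≤ ‖t‖ := (one_le_pow₀ hR1).trans ht
  set D := p.natDegree with hD
  have hHR : ((H : ℝ) + 1) ≤ R ^ H := by
    have : H + 1 ≤ 2 ^ H := Nat.lt_two_pow_self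
    calc ((H : ℝ) + 1) ≤ 2 ^ H := by exact_mod_cast this
      _ ≤ R ^ H := pow_le_pow_left₀ (by norm_num) hR _
  have hDH : (D : ℝ) ≤ H := by exact_mod_cast hdeg
  have hsum : p.eval t = ∑ i ∈ Finset.range D, p.coeff i * t ^ i + p.leadingCoeff * t ^ D := by
    rw [eval_eq_sum_range, Finset.sum_range_succ]; rfl
  have hlow : ‖∑ i ∈ Finset.range D, p.coeff i * t ^ i‖ * ‖t‖ ≤ D * (R ^ H * ‖t‖ ^ D) := by
    rw [← norm_mul, Finset.sum_mul]
    refine (norm_sum_le _ _).trans ((Finset.sum_le_card_nsmul _ _ (R ^ H * ‖t‖ ^ D)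
      fun i hi => ?_).trans ?_)
    · rw [mul_assoc, ← pow_succ, norm_mul, norm_pow]
      exact mul_le_mul (hcoeff i) (pow_le_pow_right₀ ht1 (Finset.mem_range.1 hi)) (by positivity)
        (by positivity)
    · simp
  set S := ‖∑ i ∈ Finset.range D, p.coeff i * t ^ i‖ with hS
  have hS0 : 0 ≤ S := norm_nonneg _
  have hTD : 0 < ‖t‖ ^ D := by positivity
  have hRH : 0 < R ^ H := by positivity
  constructor
  · have h1 : S ≤ D * (R ^ H * ‖t‖ ^ D) := (le_mul_of_one_le_right hS0 ht1).trans hlow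
    calc ‖p.eval t‖ ≤ S + ‖p.leadingCoeff * t ^ D‖ := by rw [hsum]; exact norm_add_le _ _
      _ ≤ H * (R ^ H * ‖t‖ ^ D) + R ^ H * ‖t‖ ^ D := by
        rw [norm_mul, norm_pow]
        gcongr
        · exact h1.trans (by gcongr)
        · exact hcoeff _
      _ = (H + 1) * R ^ H * ‖t‖ ^ D := by ring
      _ ≤ R ^ H * R ^ H * ‖t‖ ^ D := by gcongr
      _ = R ^ (2 * H) * ‖t‖ ^ D := by ring
      _ ≤ _ := by
        gcongr ?_ * _
        exact pow_le_pow_right₀ hR1 (Nat.mul_le_mul_right _ (by omega))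
  · have h2 : R ^ (g * H) * (2 * S) ≤ ‖t‖ ^ D := by
      have h3 : R ^ (g * H) * (2 * S) * ‖t‖ ≤ ‖t‖ ^ D * ‖t‖ := by
        calc R ^ (g * H) * (2 * S) * ‖t‖ = R ^ (g * H) * 2 * (S * ‖t‖) := by ring
          _ ≤ R ^ (g * H) * R * (R ^ H * (R ^ H * ‖t‖ ^ D)) := by
            refine mul_le_mul (by gcongr) (hlow.trans ?_) (by positivity) (by positivity)
            gcongr
            linarith
          _ = R ^ (g * H + 1 + H + H) * ‖t‖ ^ D := by ring
          _ ≤ ‖t‖ * ‖t‖ ^ D := by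
            gcongr
            refine le_trans (pow_le_pow_right₀ hR1 ?_) ht
            nlinarith
          _ = _ := mul_comm _ _
      exact le_of_mul_le_mul_right h3 (by linarith)
    have h4 : ‖t‖ ^ D ≤ R ^ (g * H) * (S + ‖p.eval t‖) := by
      have h5 : ‖p.leadingCoeff * t ^ D‖ ≤ S + ‖p.eval t‖ := by
        have : p.leadingCoeff * t ^ D = p.eval t - ∑ i ∈ Finset.range D, p.coeff i * t ^ i := by
          rw [hsum]; ring
        rw [this, add_comm]
        exact norm_sub_le _ _
      rw [norm_mul, norm_pow] at h5
      calc ‖t‖ ^ D ≤ R ^ (g * H) * ‖p.leadingCoeff‖ * ‖t‖ ^ D :=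
            le_mul_of_one_le_left hTD.le hlead
        _ = R ^ (g * H) * (‖p.leadingCoeff‖ * ‖t‖ ^ D) := by ring
        _ ≤ _ := by gcongr
    calc ‖t‖ ^ D ≤ 2 * R ^ (g * H) * ‖p.eval t‖ := by linarith
      _ ≤ R * R ^ (g * H) * ‖p.eval t‖ := by gcongr
      _ = R ^ (g * H + 1) * ‖p.eval t‖ := by ring
      _ ≤ _ := by
        gcongr ?_ * _
        exact pow_le_pow_right₀ hR1 (by nlinarith)

open NumberField in
/-- An integral polynomial of small height is comparable to its leading term outside of a disc whose
radius is controlled by the height. -/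
theorem norm_eval₂_bounds_of_large {K : Type*} [Field K] [NumberField K] {q : (𝓞 K)[X]} (hq : q ≠ 0)
    {R : ℝ} (hR : 2 ≤ R) {H : ℕ} (hH : 1 ≤ H)
    (h : ∀ (τ : K →+* ℂ) (t : ℂ), R ≤ ‖t‖ →
      ‖(q.map (algebraMap (𝓞 K) K)).eval₂ τ t‖ ≤ ‖t‖ ^ H) (σ : K →+* ℂ) :
    q.natDegree ≤ H ∧ ∀ t : ℂ, R ^ ((Fintype.card (K →+* ℂ) + 3) * H) ≤ ‖t‖ →
      ‖(q.map (algebraMap (𝓞 K) K)).eval₂ σ t‖ ≤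
        R ^ ((Fintype.card (K →+* ℂ) + 3) * H) * ‖t‖ ^ q.natDegree ∧
      ‖t‖ ^ q.natDegree ≤ R ^ ((Fintype.card (K →+* ℂ) + 3) * H) *
        ‖(q.map (algebraMap (𝓞 K) K)).eval₂ σ t‖ := by
  have hR1 : 1 ≤ R := by linarith
  have hinj : ∀ τ : K →+* ℂ, Function.Injective (τ.comp (algebraMap (𝓞 K) K)) := fun τ =>
    τ.injective.comp RingOfIntegers.coe_injective
  have hev : ∀ (τ : K →+* ℂ) (t : ℂ), (q.map (algebraMap (𝓞 K) K)).eval₂ τ t =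
      (q.map (τ.comp (algebraMap (𝓞 K) K))).eval t := fun τ t => by
    rw [← Polynomial.map_map, eval_map]
  have hdeg : ∀ τ : K →+* ℂ, (q.map (τ.comp (algebraMap (𝓞 K) K))).natDegree = q.natDegree :=
    fun τ => natDegree_map_eq_of_injective (hinj τ) q
  have hb := fun τ => norm_coeff_le_of_norm_eval_le hR1 fun t ht => hev τ t ▸ h τ t ht
  have hlead : 1 ≤ R ^ (Fintype.card (K →+* ℂ) * H) *
      ‖(q.map (σ.comp (algebraMap (𝓞 K) K))).leadingCoeff‖ := by
    have h1 := one_le_pow_mul_norm_embedding (leadingCoeff_ne_zero.2 hq) (one_le_pow₀ hR1 (n := H))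
      (fun τ => by simpa using (hb τ).2 q.natDegree) σ
    rw [leadingCoeff_map_of_injective (hinj σ), mul_comm (Fintype.card _), pow_mul]
    exact h1
  refine ⟨hdeg σ ▸ (hb σ).1, fun t ht => ?_⟩
  rw [hev, ← hdeg σ]
  exact norm_eval_bounds_of_large hR hH (hb σ).1 (hb σ).2 hlead ht

end Heights

end FormPushforward

namespace FormPushforward

open MvPolynomial Filter Bornology

/-! ### From coefficients to `degS`, and assembly of the estimates -/

section Arithmetic

variable {K : Type*} [Field K] (τ : K →+* ℂ) {N : ℕ}

theorem exists_intDegree_eq_degS {P : MvPolynomial (Fin (N + 1)) (RatFunc K)} (hP : P ≠ 0) :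
    ∃ μ ∈ P.support, (coeff μ P).intDegree = degS P := by
  have h : P.support.Nonempty := support_nonempty.2 hP
  obtain ⟨μ, hμ, h1⟩ := Finset.exists_mem_eq_sup' h fun m => (coeff m P).intDegree
  exact ⟨μ, hμ, by rw [degS, dif_pos h, h1]⟩

theorem intDegree_le_degS {P : MvPolynomial (Fin (N + 1)) (RatFunc K)} {μ} (hμ : μ ∈ P.support) :
    (coeff μ P).intDegree ≤ degS P := by
  rw [degS, dif_pos ⟨μ, hμ⟩]
  exact Finset.le_sup' (fun m => (coeff m P).intDegree) hμ

/-- A coefficient of maximal degree gives the lower bound; as `log ‖t‖ ≥ 0`, coefficients of smaller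
degree do not spoil the upper bound. -/
theorem abs_log_coeffNorm_sub_degS_le {P : MvPolynomial (Fin (N + 1)) (RatFunc K)} (hP : P ≠ 0)
    {t : ℂ} (ht : 1 ≤ ‖t‖) {B : ℝ} (h : ∀ μ ∈ P.support, ratEval τ t (coeff μ P) ≠ 0 ∧
      |Real.log ‖ratEval τ t (coeff μ P)‖ - (coeff μ P).intDegree * Real.log ‖t‖| ≤ B) :
    |Real.log (coeffNorm (specialize τ t P)) - degS P * Real.log ‖t‖| ≤ B := by
  have hlog : 0 ≤ Real.log ‖t‖ := Real.log_nonneg ht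
  obtain ⟨μ, hμ, hdeg⟩ := exists_intDegree_eq_degS hP
  have hle : ‖ratEval τ t (coeff μ P)‖ ≤ coeffNorm (specialize τ t P) :=
    coeff_specialize τ (t := t) P μ ▸ norm_coeff_le_coeffNorm _ μ
  have hpos : 0 < ‖ratEval τ t (coeff μ P)‖ := norm_pos_iff.2 (h μ hμ).1
  rw [abs_le]
  constructor
  · have h1 := (abs_le.1 (h μ hμ).2).1
    rw [hdeg] at h1
    have h2 := Real.log_le_log hpos hle
    linarith
  · rw [sub_le_iff_le_add', ← Real.log_exp (degS P * Real.log ‖t‖ + B)]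
    refine Real.log_le_log (hpos.trans_le hle) (coeffNorm_le (Real.exp_pos _).le fun ν => ?_)
    rw [coeff_specialize]
    by_cases hν : ν ∈ P.support
    · rw [← Real.log_le_iff_le_exp (norm_pos_iff.2 (h ν hν).1)]
      have h1 := (abs_le.1 (h ν hν).2).2
      have h2 : ((coeff ν P).intDegree : ℝ) ≤ degS P := by exact_mod_cast intDegree_le_degS hν
      have h3 := mul_le_mul_of_nonneg_right h2 hlog
      linarith
    · rw [notMem_support_iff.1 hν, ratEval_zero, norm_zero]
      exact (Real.exp_pos _).le

variable {A : Type*} [CommRing A] [Algebra A K]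

theorem ratEval_polynomialToRatFunc (t : ℂ) (q : Polynomial A) :
    ratEval τ t (polynomialToRatFunc A K q) = (q.map (algebraMap A K)).eval₂ τ t := by
  rw [ratEval, polynomialToRatFunc, RingHom.comp_apply, RatFunc.num_algebraMap,
    RatFunc.denom_algebraMap]
  simp

theorem polynomialToRatFunc_injective [FaithfulSMul A K] :
    Function.Injective (polynomialToRatFunc A K) :=
  (RatFunc.algebraMap_injective K).comp
    (Polynomial.map_injective _ (FaithfulSMul.algebraMap_injective A K))

theorem intDegree_polynomialToRatFunc [FaithfulSMul A K] (q : Polynomial A) :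
    (polynomialToRatFunc A K q).intDegree = q.natDegree := by
  rw [polynomialToRatFunc, RingHom.comp_apply, RatFunc.intDegree_polynomial,
    Polynomial.coe_mapRingHom,
    Polynomial.natDegree_map_eq_of_injective (FaithfulSMul.algebraMap_injective A K)]

theorem eval₂_eq_of_polynomialToRatFunc_eq {t : ℂ} {q D : Polynomial A} {a : ℕ} {c : RatFunc K}
    (hc : c ∈ regularAt τ t) (h : polynomialToRatFunc A K q = polynomialToRatFunc A K D ^ a * c) :
    (q.map (algebraMap A K)).eval₂ τ t =
      (D.map (algebraMap A K)).eval₂ τ t ^ a * ratEval τ t c := by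
  rw [← ratEval_polynomialToRatFunc, h, ← map_pow, ratEval_mul τ ?_ hc,
    ratEval_polynomialToRatFunc, Polynomial.map_pow, Polynomial.eval₂_pow]
  rw [polynomialToRatFunc, RingHom.comp_apply, RatFunc.denom_algebraMap]
  simp

theorem intDegree_eq_of_polynomialToRatFunc_eq [IsDomain A] [FaithfulSMul A K]
    {q D : Polynomial A} {a : ℕ} {c : RatFunc K} (hD : D ≠ 0) (hc : c ≠ 0)
    (h : polynomialToRatFunc A K q = polynomialToRatFunc A K D ^ a * c) :
    c.intDegree = q.natDegree - a * D.natDegree := by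
  have h1 := congrArg RatFunc.intDegree h
  rw [← map_pow, RatFunc.intDegree_mul ((map_ne_zero_iff _ polynomialToRatFunc_injective).2
    (pow_ne_zero _ hD)) hc, intDegree_polynomialToRatFunc, intDegree_polynomialToRatFunc,
    Polynomial.natDegree_pow] at h1
  push_cast at h1
  linarith

end Arithmetic

theorem eventually_cobounded_iff_exists_norm {p : ℂ → Prop} :
    (∀ᶠ t in cobounded ℂ, p t) ↔ ∃ R : ℝ, ∀ t, R ≤ ‖t‖ → p t := by
  rw [← comap_norm_atTop, (atTop_basis.comap _).eventually_iff]
  simp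

open NumberField in
/-- The data needed to compare the specialized iterated pushforwards with their degrees: bounds on
the specializations, and integral coefficients of controlled size. -/
theorem exists_iterate_data {K : Type*} [Field K] [NumberField K] {N d e : ℕ} (hd : 2 ≤ d)
    {F : Fin (N + 1) → MvPolynomial (Fin (N + 1)) (RatFunc K)}
    (hF : ∀ i, (F i).IsHomogeneous d) (hF' : Nondegenerate F)
    {Φ : MvPolynomial (Fin (N + 1)) (RatFunc K)} (hΦ : Φ.IsHomogeneous e) (hΦ' : Φ ≠ 0) :
    ∃ (B : ℕ) (R : ℝ) (D : Polynomial (𝓞 K)), 1 ≤ B ∧ 2 ≤ R ∧ D ≠ 0 ∧ ∀ k : ℕ, ∃ a : ℕ,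
      a ≤ B * (k + 1) * (d ^ (N + 1)) ^ k ∧
      ∃ Q : (Fin (N + 1) →₀ ℕ) → Polynomial (𝓞 K),
        (∀ μ, polynomialToRatFunc (𝓞 K) K (Q μ) =
          polynomialToRatFunc (𝓞 K) K D ^ a * coeff μ ((pushforward F)^[k] Φ)) ∧
        ∀ (τ : K →+* ℂ) (t : ℂ), R ≤ ‖t‖ →
          IsRegularAt τ t ((pushforward F)^[k] Φ) ∧
          (pushforward fun i => specialize τ t (F i))^[k] (specialize τ t Φ) =
            specialize τ t ((pushforward F)^[k] Φ) ∧
          coeffNorm (specialize τ t ((pushforward F)^[k] Φ)) ≤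
            ‖t‖ ^ (B * (k + 1) * (d ^ (N + 1)) ^ k) ∧
          1 ≤ ‖t‖ ^ (B * (k + 1) * (d ^ (N + 1)) ^ k) *
            coeffNorm (specialize τ t ((pushforward F)^[k] Φ)) ∧
          ∀ μ, ‖((Q μ).map (algebraMap (𝓞 K) K)).eval₂ τ t‖ ≤
            ‖t‖ ^ (B * (k + 1) * (d ^ (N + 1)) ^ k) := by
  classical
  have : CharZero (RatFunc K) := charZero_of_injective_algebraMap (R := K) (algebraMap K _).injective
  have hd0 : 0 < d := by omega
  have hS := finite_solutions hd0 hF hF'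
  set m := hS.toFinset.card with hm
  have hmd : ∀ k, m ^ k ≤ (d ^ (N + 1)) ^ k := fun k =>
    Nat.pow_le_pow_left (card_solutions_le hd0 hF hS) k
  choose A hAdeg hA using fun τ : K →+* ℂ => exists_coeff_iterate_bounds τ hd hF hF' hS hΦ hΦ'
  -- One exponent for all the finitely many embeddings, as the product of conjugates requires; the
  -- `1` makes it positive.
  set A' := ∑ τ, A τ + 1 with hA'
  have hAA' : ∀ τ, A τ ≤ A' := fun τ =>
    (Finset.single_le_sum (f := A) (fun _ _ => Nat.zero_le _) (Finset.mem_univ τ)).trans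
      (Nat.le_succ _)
  obtain ⟨σ⟩ : Nonempty (K →+* ℂ) := inferInstance
  obtain ⟨D, hD, hQ⟩ := exists_map_eq_C_pow_mul_iterate (polynomialToRatFunc (𝓞 K) K)
    mem_range_polynomialToRatFunc exists_denominator_polynomialToRatFunc hd0 hF hF' hS
    (B := A') (Φ := Φ) (by omega)
    fun n => (hAdeg σ n).trans (Nat.mul_le_mul_right _ (hAA' σ))
  choose Q hQ using hQ
  have hD' : polynomialToRatFunc (𝓞 K) K D ≠ 0 :=
    (map_ne_zero_iff _ polynomialToRatFunc_injective).2 hD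
  choose E hE using fun τ : K →+* ℂ => exists_pow_norm_ratFunc_bound τ hD'
  set E' := ∑ τ, E τ with hE'
  have hEE' : ∀ τ, E τ ≤ E' := fun τ =>
    Finset.single_le_sum (f := E) (fun _ _ => Nat.zero_le _) (Finset.mem_univ τ)
  obtain ⟨R, hR⟩ := eventually_cobounded_iff_exists_norm.1
    ((eventually_all.2 hA).and (eventually_all.2 hE))
  -- The summand `E' * A'` pays for `D ^ a`, since `D` is at most `‖t‖ ^ E'` and `a` is at most `A'
  -- * (k + 1) * (d ^ (N + 1)) ^ k`.
  refine ⟨E' * A' + A', max R 2, D, by omega, le_max_right _ _, hD, fun k => ?_⟩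
  have hAk : ∀ τ, A τ * m ^ k ≤ A' * (k + 1) * (d ^ (N + 1)) ^ k := fun τ =>
    Nat.mul_le_mul ((hAA' τ).trans (Nat.le_mul_of_pos_right _ k.succ_pos)) (hmd k)
  have hAk' : ∀ τ, A τ * (k + 1) * m ^ k ≤ A' * (k + 1) * (d ^ (N + 1)) ^ k := fun τ =>
    Nat.mul_le_mul (Nat.mul_le_mul_right _ (hAA' τ)) (hmd k)
  have hAB : A' * (k + 1) * (d ^ (N + 1)) ^ k ≤ (E' * A' + A') * (k + 1) * (d ^ (N + 1)) ^ k := by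
    gcongr; omega
  refine ⟨A' * (k + 1) * m ^ k, (Nat.mul_le_mul_left _ (hmd k)).trans hAB,
    fun μ => coeff μ (Q k), fun μ => ?_, fun τ t ht => ?_⟩
  · rw [← coeff_map, hQ, coeff_C_mul]
  obtain ⟨h1, h2⟩ := hR t ((le_max_left _ _).trans ht)
  obtain ⟨hreg, hspec, hup, hlow⟩ := h1 τ k
  have ht2 : 2 ≤ ‖t‖ := (le_max_right _ _).trans ht
  have ht1 : 1 ≤ ‖t‖ := by linarith
  refine ⟨hreg, hspec, ?_, ?_, fun μ => ?_⟩
  · refine coeffNorm_le (by positivity) fun μ => ?_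
    rw [coeff_specialize]
    exact (hup μ).trans (pow_le_pow_right₀ ht1 ((hAk τ).trans hAB))
  · exact hlow.trans (mul_le_mul_of_nonneg_right
      (pow_le_pow_right₀ ht1 ((hAk' τ).trans hAB)) (NNReal.coe_nonneg _))
  · have hc : coeff μ ((pushforward F)^[k] Φ) ∈ regularAt τ t := by
      obtain ⟨P, hP⟩ := hreg
      rw [← hP, coeff_map]
      exact (coeff μ P).2
    rw [eval₂_eq_of_polynomialToRatFunc_eq τ hc (q := coeff μ (Q k)) (D := D)
      (a := A' * (k + 1) * m ^ k) (by rw [← coeff_map, hQ, coeff_C_mul]), norm_mul, norm_pow,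
      ← ratEval_polynomialToRatFunc]
    calc ‖ratEval τ t (polynomialToRatFunc (𝓞 K) K D)‖ ^ (A' * (k + 1) * m ^ k) *
          ‖ratEval τ t (coeff μ ((pushforward F)^[k] Φ))‖
        ≤ (‖t‖ ^ E') ^ (A' * (k + 1) * (d ^ (N + 1)) ^ k) *
          ‖t‖ ^ (A' * (k + 1) * (d ^ (N + 1)) ^ k) := by
          refine mul_le_mul ?_ ((hup μ).trans (pow_le_pow_right₀ ht1 (hAk τ))) (norm_nonneg _)
            (by positivity)
          refine (pow_le_pow_left₀ (norm_nonneg _)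
            ((h2 τ).1.trans (pow_le_pow_right₀ ht1 (hEE' τ))) _).trans ?_
          exact pow_le_pow_right₀ (one_le_pow₀ ht1) (Nat.mul_le_mul_left _ (hmd k))
      _ = _ := by rw [← pow_mul, ← pow_add]; congr 1; ring

/-- This is the origin of the `3` in the final exponent: `H ^ 2` contributes `M ^ (2 * k)`, and the
last `M ^ k` absorbs `(k + 1) ^ 2`. -/
theorem sq_succ_mul_pow_le {M : ℕ} (hM : 2 ≤ M) (k : ℕ) :
    ((k : ℝ) + 1) ^ 2 * ((M : ℝ) ^ k) ^ 2 ≤ 4 * (M : ℝ) ^ (3 * k) := by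
  have h1 : ∀ k : ℕ, (k + 1) ^ 2 ≤ 4 * 2 ^ k := fun k => by
    rcases Nat.even_or_odd' k with ⟨l, rfl | rfl⟩
    · have := Nat.lt_two_pow_self (n := l)
      rw [pow_mul', sq]
      nlinarith
    · have := Nat.lt_two_pow_self (n := l)
      rw [pow_succ 2 (2 * l), pow_mul']
      nlinarith
  have h2 : ((k : ℝ) + 1) ^ 2 ≤ 4 * (M : ℝ) ^ k := by
    calc ((k : ℝ) + 1) ^ 2 ≤ 4 * 2 ^ k := by exact_mod_cast h1 k
      _ ≤ _ := by gcongr; exact_mod_cast hM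
  calc ((k : ℝ) + 1) ^ 2 * ((M : ℝ) ^ k) ^ 2 ≤ 4 * (M : ℝ) ^ k * ((M : ℝ) ^ k) ^ 2 := by gcongr
    _ = _ := by ring

end FormPushforward

/-! ### The main theorem -/

open FormPushforward MvPolynomial NumberField in
theorem mainTheorem3 {K : Type*} [Field K] [NumberField K] (σ : K →+* ℂ)
    (N d e : ℕ) (hd : 2 ≤ d)
    (F : Fin (N + 1) → MvPolynomial (Fin (N + 1)) (RatFunc K))
    (hF : ∀ i, (F i).IsHomogeneous d)
    (hF' : FormPushforward.Nondegenerate F)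
    (Φ : MvPolynomial (Fin (N + 1)) (RatFunc K))
    (hΦ : Φ.IsHomogeneous e) (hΦ' : Φ ≠ 0) :
    ∃ C R : ℝ, ∀ (k : ℕ) (t : ℂ), R < ‖t‖ →
      (FormPushforward.pushforward F)^[k] Φ ≠ 0 ∧
      (FormPushforward.pushforward fun i => FormPushforward.specialize σ t (F i))^[k]
        (FormPushforward.specialize σ t Φ) ≠ 0 ∧
      |Real.log (FormPushforward.coeffNorm
            ((FormPushforward.pushforward fun i => FormPushforward.specialize σ t (F i))^[k]
              (FormPushforward.specialize σ t Φ)))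
          - (FormPushforward.degS ((FormPushforward.pushforward F)^[k] Φ) : ℝ)
            * Real.posLog ‖t‖|
        ≤ C * (d : ℝ) ^ (3 * k * (N + 1)) := by
  obtain ⟨B, R, D, hB, hR, hD, hdata⟩ := exists_iterate_data hd hF hF' hΦ hΦ'
  obtain ⟨C₀, hC₀⟩ := exists_log_norm_eval₂_bound σ
    (Polynomial.map_ne_zero_iff (RingOfIntegers.coe_injective (K := K)) |>.2 hD)
  obtain ⟨R₁, hR₁⟩ := eventually_cobounded_iff_exists_norm.1 hC₀
  set g := Fintype.card (K →+* ℂ) + 3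
  set C₁ : ℝ := g * Real.log R + |C₀| with hC₁
  set C₂ : ℝ := (2 + D.natDegree) * (g * Real.log R) with hC₂
  have hlogR : 0 ≤ Real.log R := Real.log_nonneg (by linarith)
  have hC₁0 : 0 ≤ C₁ := by positivity
  have hC₂0 : 0 ≤ C₂ := by positivity
  -- `C₁` comes from the range `‖t‖ ≥ R ^ (g * H)` and `C₂` from its complement; `B ^ 2 * 4`
  -- converts `H ^ 2` into the required power of `d`.
  refine ⟨(C₁ + C₂) * B ^ 2 * 4, max R R₁, fun k t ht => ?_⟩
  obtain ⟨a, ha, Q, hQ, hQt⟩ := hdata k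
  set P := (pushforward F)^[k] Φ with hP
  set H := B * (k + 1) * (d ^ (N + 1)) ^ k with hH
  have hH1 : 1 ≤ H := Nat.mul_pos (Nat.mul_pos hB k.succ_pos) (by positivity)
  have htR : R ≤ ‖t‖ := (le_max_left _ _).trans ht.le
  have ht1 : 1 ≤ ‖t‖ := by linarith
  obtain ⟨hreg, hspec, hup, hlow, hQle⟩ := hQt σ t htR
  have hnorm : 0 < coeffNorm (specialize σ t P) := by
    by_contra! h
    nlinarith [pow_pos (by linarith : 0 < ‖t‖) H]
  have hspec0 : specialize σ t P ≠ 0 := fun h => by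
    rw [h] at hnorm
    simp [coeffNorm] at hnorm
  have hP0 : P ≠ 0 := fun h => hspec0 (by rw [h]; simp [specialize])
  rw [hspec, Real.posLog_eq_log (by rwa [abs_of_nonneg (norm_nonneg t)])]
  refine ⟨hP0, hspec0, ?_⟩
  have hlogt : 0 ≤ Real.log ‖t‖ := Real.log_nonneg ht1
  have hHR : (1 : ℝ) ≤ H := by exact_mod_cast hH1
  have haH : (a : ℝ) ≤ H := by exact_mod_cast ha
  have hQ0 : ∀ μ ∈ P.support, Q μ ≠ 0 := fun μ hμ h => by
    have h1 := hQ μ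
    rw [h, map_zero] at h1
    exact mul_ne_zero (pow_ne_zero _ ((map_ne_zero_iff _ polynomialToRatFunc_injective).2 hD))
      (mem_support_iff.1 hμ) h1.symm
  have hlarge := fun μ (hμ : μ ∈ P.support) => norm_eval₂_bounds_of_large (hQ0 μ hμ) hR hH1
    (fun τ t ht => (hQt τ t ht).2.2.2.2 μ) σ
  have hint : ∀ μ ∈ P.support, ((coeff μ P).intDegree : ℝ) = (Q μ).natDegree - a * D.natDegree :=
    fun μ hμ => by
      exact_mod_cast intDegree_eq_of_polynomialToRatFunc_eq hD (mem_support_iff.1 hμ) (hQ μ)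
  suffices hmain : |Real.log (coeffNorm (specialize σ t P)) - degS P * Real.log ‖t‖| ≤
      (C₁ + C₂) * (H : ℝ) ^ 2 by
    refine hmain.trans ?_
    have h1 := sq_succ_mul_pow_le (M := d ^ (N + 1))
      (hd.trans (Nat.le_self_pow N.succ_ne_zero d)) k
    calc (C₁ + C₂) * (H : ℝ) ^ 2
        = (C₁ + C₂) * B ^ 2 * (((k : ℝ) + 1) ^ 2 * ((((d ^ (N + 1) : ℕ) : ℝ)) ^ k) ^ 2) := by
          rw [hH]; push_cast; ring
      _ ≤ (C₁ + C₂) * B ^ 2 * (4 * ((d ^ (N + 1) : ℕ) : ℝ) ^ (3 * k)) := by gcongr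
      _ = _ := by
          rw [mul_assoc _ 4 _]
          push_cast
          rw [← pow_mul]
          ring_nf
  have hHsq : (H : ℝ) ≤ (H : ℝ) ^ 2 := le_self_pow₀ hHR two_ne_zero
  -- Beyond this radius the cleared coefficients follow their leading terms and `D` follows its own,
  -- with total error linear in `H`.
  by_cases hbig : R ^ (g * H) ≤ ‖t‖
  · refine (abs_log_coeffNorm_sub_degS_le σ hP0 ht1 (B := C₁ * H) fun μ hμ => ?_).trans ?_
    · obtain ⟨hDt, hDlog⟩ := hR₁ t ((le_max_right _ _).trans ht.le)
      obtain ⟨h1, h2⟩ := (hlarge μ hμ).2 t hbig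
      have hc : coeff μ P ∈ regularAt σ t := by
        obtain ⟨p, hp⟩ := hreg
        rw [← hp, coeff_map]
        exact (coeff μ p).2
      have h3 := eval₂_eq_of_polynomialToRatFunc_eq σ hc (hQ μ)
      have hq : (Polynomial.map (algebraMap (𝓞 K) K) (Q μ)).eval₂ σ t ≠ 0 := fun h => by
        rw [h, norm_zero, mul_zero] at h2
        exact absurd h2 (not_le.2 (by positivity))
      have hr : ratEval σ t (coeff μ P) ≠ 0 := fun h => hq (by rw [h3, h, mul_zero])
      refine ⟨hr, ?_⟩
      have hqpos := norm_pos_iff.2 hq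
      have hRpos : 0 < R ^ (g * H) := by positivity
      have htpos : 0 < ‖t‖ ^ (Q μ).natDegree := by positivity
      have h4 := Real.log_le_log hqpos h1
      have h5 := Real.log_le_log htpos h2
      rw [Real.log_mul hRpos.ne' htpos.ne', Real.log_pow, Real.log_pow] at h4
      rw [Real.log_mul hRpos.ne' hqpos.ne', Real.log_pow, Real.log_pow] at h5
      have h6 : Real.log ‖(Polynomial.map (algebraMap (𝓞 K) K) (Q μ)).eval₂ σ t‖ =
          a * Real.log ‖(Polynomial.map (algebraMap (𝓞 K) K) D).eval₂ σ t‖ +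
            Real.log ‖ratEval σ t (coeff μ P)‖ := by
        rw [h3, norm_mul, norm_pow, Real.log_mul (pow_ne_zero _ (norm_ne_zero_iff.2 hDt))
          (norm_ne_zero_iff.2 hr), Real.log_pow]
      rw [hint μ hμ]
      rw [Polynomial.natDegree_map_eq_of_injective (RingOfIntegers.coe_injective (K := K))] at hDlog
      have h7 : |(a : ℝ) * (Real.log ‖(Polynomial.map (algebraMap (𝓞 K) K) D).eval₂ σ t‖ -
          D.natDegree * Real.log ‖t‖)| ≤ H * |C₀| := by
        rw [abs_mul, Nat.abs_cast]
        exact mul_le_mul haH (hDlog.trans (le_abs_self _)) (abs_nonneg _) (by positivity)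
      rw [abs_le] at h7 ⊢
      push_cast at h4 h5
      rw [hC₁]
      constructor <;> nlinarith
    · calc C₁ * (H : ℝ) ≤ (C₁ + C₂) * H := by gcongr; linarith
        _ ≤ _ := by gcongr
  -- Below the radius `log ‖t‖` is itself linear in `H`, so estimating both terms separately loses
  -- only a second factor `H`.
  · have htlog : Real.log ‖t‖ ≤ g * H * Real.log R := by
      have := Real.log_le_log (by linarith) (not_le.1 hbig).le
      rwa [Real.log_pow, Nat.cast_mul] at this
    have h1 : |Real.log (coeffNorm (specialize σ t P))| ≤ H * Real.log ‖t‖ := by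
      have hT : 0 < ‖t‖ ^ H := by positivity
      have h2 := Real.log_le_log hnorm hup
      have h3 := Real.log_le_log one_pos hlow
      rw [Real.log_one, Real.log_mul hT.ne' hnorm.ne', Real.log_pow] at h3
      rw [Real.log_pow] at h2
      exact abs_le.2 ⟨by linarith, h2⟩
    have h2 : |(degS P : ℝ)| ≤ H * (1 + D.natDegree) := by
      obtain ⟨μ, hμ, hdeg⟩ := exists_intDegree_eq_degS hP0
      have h3 : ((Q μ).natDegree : ℝ) ≤ H := by exact_mod_cast (hlarge μ hμ).1
      have h4 : (a : ℝ) * D.natDegree ≤ H * D.natDegree := by gcongr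
      have h5 : (0 : ℝ) ≤ a * D.natDegree := by positivity
      have h6 : (0 : ℝ) ≤ (Q μ).natDegree := by positivity
      have h7 : (0 : ℝ) ≤ (D.natDegree : ℝ) := by positivity
      rw [← hdeg, hint μ hμ, abs_le]
      constructor <;> nlinarith
    calc |Real.log (coeffNorm (specialize σ t P)) - degS P * Real.log ‖t‖|
        ≤ |Real.log (coeffNorm (specialize σ t P))| + |(degS P : ℝ)| * Real.log ‖t‖ := by
          refine (abs_sub _ _).trans_eq ?_
          rw [abs_mul, abs_of_nonneg hlogt]
      _ ≤ H * Real.log ‖t‖ + H * (1 + D.natDegree) * Real.log ‖t‖ := by gcongr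
      _ = H * (2 + D.natDegree) * Real.log ‖t‖ := by ring
      _ ≤ H * (2 + D.natDegree) * (g * H * Real.log R) := by gcongr
      _ = C₂ * (H : ℝ) ^ 2 := by rw [hC₂]; ring
      _ ≤ _ := by gcongr; linarith
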